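/- Let $1\le n<N$ be integers, let $\mathbb T^2=\mathbb R^2/(2\pi\mathbb Z)^2$, and let $\mathcal E$ be the space of Hermitian $N\times N$ complex matrices; write $\lambda_1(A)\le\dots\le\lambda_N(A)$ for the eigenvalues of $A\in\mathcal E$, repeated according to multiplicity. Let $H_0,H_1\in C^\infty(\mathbb T^2,\mathcal E)$ satisfy $\lambda_n(H_j(\xi))<\lambda_{n+1}(H_j(\xi))$ for all $\xi\in\mathbb T^2$ and $j=0,1$, and let $\mathscr V_j\to\mathbb T^2$ be the rank-$n$ vector bundle with fibers $\mathscr V_j(\xi)=\sum_{i=1}^n\ker\big(H_j(\xi)-\lambda_i(H_j(\xi))\big)\subset\mathbb C^N$. Its first Chern number is $$c_1(\mathscr V_j)=\frac{i}{2\pi}\int_{\mathbb T^2}\operatorname{Tr}\big(\Pi_j[\partial_{\xi_1}\Pi_j,\partial_{\xi_2}\Pi_j]\big)\,d\xi_1\,d\xi_2,$$ where $\Pi_j(\xi)$ is the orthogonal projector onto $\mathscr V_j(\xi)$. Let $H\in C^\infty([0,1]\times\mathbb T^2,\mathcal E)$ (smooth up to the boundary) with $H(0,\cdot)=H_0$ and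 $H(1,\cdot)=H_1$. A point $\zeta=(s,\xi)\in[0,1]\times\mathbb T^2$ is a crossing if $\lambda_n(H(\zeta))=\lambda_{n+1}(H(\zeta))$; it is a conical crossing if, moreover, this eigenvalue has multiplicity exactly two and there are $a\in\mathbb R^3$ and an invertible $S\in M_3(\mathbb R)$ such that, as $\mathbb R^3\ni\varepsilon\to0$, $$\lambda_n(H(\zeta+\varepsilon))=\lambda_n(H(\zeta))+\langle a,\varepsilon\rangle-\|S\varepsilon\|+o(\varepsilon),\qquad \lambda_{n+1}(H(\zeta+\varepsilon))=\lambda_n(H(\zeta))+\langle a,\varepsilon\rangle+\|S\varepsilon\|+o(\varepsilon).$$ Suppose that all crossings of $\lambda_n(H)$ and $\lambda_{n+1}(H)$ are conical, and that they are precisely the distinct points $\zeta_1,\dots,\zeta_K$. For each $k$, let $(f_{k,1},f_{k,2})$ be any orthonormal basis of $\ker\big(H(\zeta_k)-\lambda_n(H(\zeta_k))\big)$, let $J_k:\mathbb C^N\to\mathbb C^2$ be the linear map $(J_kv)_j=\langle v,f_{k,j}\rangle$ (inner product linear in $v$), and let $A_k\in M_3(\mathbb R)$ be the matrix for which, with some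 $a_k\in\mathbb R^3$, as $\varepsilon=(\varepsilon_s,\varepsilon_{\xi_1},\varepsilon_{\xi_2})\to0$, $$J_kH(\zeta_k+\varepsilon)J_k^*=J_kH(\zeta_k)J_k^*+\langle a_k,\varepsilon\rangle\,\mathrm{Id}_2+\sum_{j=1}^3(A_k\varepsilon)_j\,\sigma_j+O(\|\varepsilon\|^2),$$ where $\sigma_1=\begin{pmatrix}0&1\\1&0\end{pmatrix}$, $\sigma_2=\begin{pmatrix}0&-i\\i&0\end{pmatrix}$, $\sigma_3=\begin{pmatrix}1&0\\0&-1\end{pmatrix}$. Then $$c_1(\mathscr V_1)-c_1(\mathscr V_0)=\sum_{k=1}^K\operatorname{sgn}\big(\det A_k\big).$$ -/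

import Mathlib

open Set Filter Topology Asymptotics
open scoped Real ContDiff Matrix

noncomputable section

/-- The two-dimensional torus `ℝ² / (2πℤ)²`. -/
abbrev Torus2 : Type := AddCircle (2 * π) × AddCircle (2 * π)

/-- Hermitian `N × N` complex matrices. -/
abbrev Herm (N : ℕ) : Type := {A : Matrix (Fin N) (Fin N) ℂ // A.IsHermitian}

/-- `eig A j`, for `1 ≤ j ≤ N`, is the `j`-th eigenvalue of `A`, in increasing order and repeated
according to multiplicity (Mathlib lists the eigenvalues in decreasing order); it is only used
for such `j`. -/
def eig {N : ℕ} (A : Herm N) (j : ℕ) : ℝ :=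
  if h : 1 ≤ j ∧ j ≤ N then
    A.2.eigenvalues₀ ⟨N - j, by rw [Fintype.card_fin]; omega⟩
  else 0

/-- `ker (A - μ)`. -/
def eigSpace {N : ℕ} (A : Herm N) (μ : ℝ) : Submodule ℂ (EuclideanSpace ℂ (Fin N)) :=
  Module.End.eigenspace (Matrix.toEuclideanLin A.1) (μ : ℂ)

/-- Smooth maps from the torus to Hermitian matrices, i.e. smooth doubly periodic maps on `ℝ²`. -/
def SmoothTorus {N : ℕ} (H : Torus2 → Herm N) : Prop :=
  ∀ i j : Fin N, ContDiff ℝ ∞ fun p : ℝ × ℝ =>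
    (H ((p.1 : AddCircle (2 * π)), (p.2 : AddCircle (2 * π)))).1 i j

/-- The set `[0,1] × 𝕋²`. -/
def cylinder : Set (ℝ × Torus2) := Icc (0 : ℝ) 1 ×ˢ univ

/-- Smooth maps from `[0,1] × 𝕋²` to Hermitian matrices (smooth up to the boundary). The values of
`H` outside `[0,1] × 𝕋²` are irrelevant. -/
def SmoothCylinder {N : ℕ} (H : ℝ × Torus2 → Herm N) : Prop :=
  ∀ i j : Fin N, ContDiffOn ℝ ∞
    (fun p : ℝ × ℝ × ℝ =>
      (H (p.1, ((p.2.1 : AddCircle (2 * π)), (p.2.2 : AddCircle (2 * π))))).1 i j)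
    (Icc (0 : ℝ) 1 ×ˢ univ)

/-- The spectral gap condition: `λ_n < λ_{n+1}` everywhere on the torus. -/
def Gapped {N : ℕ} (n : ℕ) (H : Torus2 → Herm N) : Prop :=
  ∀ ξ : Torus2, eig (H ξ) n < eig (H ξ) (n + 1)

/-- The set of smooth homotopies from `H₀` to `H₁`. -/
def homotopies {N : ℕ} (H₀ H₁ : Torus2 → Herm N) : Set (ℝ × Torus2 → Herm N) :=
  {H | SmoothCylinder H ∧ (∀ ξ, H (0, ξ) = H₀ ξ) ∧ (∀ ξ, H (1, ξ) = H₁ ξ)}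

/-- The points of `[0,1] × 𝕋²` at which `λ_n` and `λ_{n+1}` cross. -/
def crossings {N : ℕ} (n : ℕ) (H : ℝ × Torus2 → Herm N) : Set (ℝ × Torus2) :=
  {ζ | ζ ∈ cylinder ∧ eig (H ζ) n = eig (H ζ) (n + 1)}

/-- The translate `ζ + ε` of `ζ = (s, ξ)` by a vector `ε ∈ ℝ³`. -/
def shiftPoint (ζ : ℝ × Torus2) (ε : EuclideanSpace ℝ (Fin 3)) : ℝ × Torus2 :=
  (ζ.1 + ε 0,
    (ζ.2.1 + ((ε 1 : ℝ) : AddCircle (2 * π)), ζ.2.2 + ((ε 2 : ℝ) : AddCircle (2 * π))))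

/-- The filter of small `ε ∈ ℝ³` such that `ζ + ε` is in `[0,1] × 𝕋²`; for `ζ` in
`(0,1) × 𝕋²` this is the neighbourhood filter of `0`. -/
def smallShifts (ζ : ℝ × Torus2) : Filter (EuclideanSpace ℝ (Fin 3)) :=
  𝓝[{ε | shiftPoint ζ ε ∈ cylinder}] 0

/-- `λ_n` and `λ_{n+1}` cross conically at `ζ`. -/
def CrossConically {N : ℕ} (n : ℕ) (H : ℝ × Torus2 → Herm N) (ζ : ℝ × Torus2) : Prop :=
  ζ ∈ crossings n H ∧
  Module.finrank ℂ (eigSpace (H ζ) (eig (H ζ) n)) = 2 ∧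
  ∃ (a : EuclideanSpace ℝ (Fin 3)) (S : Matrix (Fin 3) (Fin 3) ℝ), IsUnit S ∧
    ((fun ε => eig (H (shiftPoint ζ ε)) n -
        (eig (H ζ) n + inner ℝ a ε - ‖Matrix.toEuclideanLin S ε‖))
      =o[smallShifts ζ] fun ε => ε) ∧
    ((fun ε => eig (H (shiftPoint ζ ε)) (n + 1) -
        (eig (H ζ) n + inner ℝ a ε + ‖Matrix.toEuclideanLin S ε‖))
      =o[smallShifts ζ] fun ε => ε)

/-- The set `𝕃` of smooth homotopies from `H₀` to `H₁` all of whose crossings of `λ_n` and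
`λ_{n+1}` are conical. -/
def conicalHomotopies {N : ℕ} (n : ℕ) (H₀ H₁ : Torus2 → Herm N) :
    Set (ℝ × Torus2 → Herm N) :=
  {H | H ∈ homotopies H₀ H₁ ∧ ∀ ζ ∈ crossings n H, CrossConically n H ζ}

/-- The eigenbundle of the first `n` eigenvalues: its fibre at `ξ` is the sum of the
`ker (H ξ - λ_j (H ξ))` over `1 ≤ j ≤ n`. -/
def eigenbundle {N : ℕ} (n : ℕ) (H : Torus2 → Herm N) (ξ : Torus2) :
    Submodule ℂ (EuclideanSpace ℂ (Fin N)) :=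
  ⨆ j ∈ Finset.Icc 1 n, eigSpace (H ξ) (eig (H ξ) j)

/-- The matrix of the orthogonal projection onto a subspace of `ℂ^N`. -/
def projMatrix {N : ℕ} (W : Submodule ℂ (EuclideanSpace ℂ (Fin N))) :
    Matrix (Fin N) (Fin N) ℂ :=
  Matrix.toEuclideanLin.symm (W.starProjection : EuclideanSpace ℂ (Fin N) →ₗ[ℂ] _)

/-- The entrywise partial derivative in `ξ₁` of a matrix-valued function on the torus. -/
def partial₁ {N : ℕ} (P : Torus2 → Matrix (Fin N) (Fin N) ℂ) (ξ : Torus2) :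
    Matrix (Fin N) (Fin N) ℂ :=
  Matrix.of fun i j => deriv (fun t : ℝ => P (ξ.1 + (t : AddCircle (2 * π)), ξ.2) i j) 0

/-- The entrywise partial derivative in `ξ₂` of a matrix-valued function on the torus. -/
def partial₂ {N : ℕ} (P : Torus2 → Matrix (Fin N) (Fin N) ℂ) (ξ : Torus2) :
    Matrix (Fin N) (Fin N) ℂ :=
  Matrix.of fun i j => deriv (fun t : ℝ => P (ξ.1, ξ.2 + (t : AddCircle (2 * π))) i j) 0

/-- The Berry curvature `Tr (Π [∂₁ Π, ∂₂ Π])` of a subbundle `V` of the trivial bundle `ℂ^N` over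
the torus, where `Π` is the orthogonal projector onto the fibres. It is the trace of the curvature
`Π dΠ ∧ dΠ` of the connection `Π d` on `V`, evaluated on `(∂₁, ∂₂)`. -/
def berryCurvature {N : ℕ} (V : Torus2 → Submodule ℂ (EuclideanSpace ℂ (Fin N)))
    (ξ : Torus2) : ℂ :=
  let P : Torus2 → Matrix (Fin N) (Fin N) ℂ := fun η => projMatrix (V η)
  (P ξ * (partial₁ P ξ * partial₂ P ξ - partial₂ P ξ * partial₁ P ξ)).trace

/-- The first Chern number `∫_{𝕋²} (i / 2π) Tr F` of a smooth subbundle `V` of the trivial bundle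
`ℂ^N` over the torus oriented by `dξ₁ ∧ dξ₂`, with `F` the curvature of the connection `Π d`. -/
def chernNumber {N : ℕ} (V : Torus2 → Submodule ℂ (EuclideanSpace ℂ (Fin N))) : ℂ :=
  Complex.I / (2 * π) * ∫ x in (0 : ℝ)..(2 * π), ∫ y in (0 : ℝ)..(2 * π),
    berryCurvature V ((x : AddCircle (2 * π)), (y : AddCircle (2 * π)))

/-- The Pauli matrices `σ₁, σ₂, σ₃`. -/
def pauli : Fin 3 → Matrix (Fin 2) (Fin 2) ℂ :=
  ![!![0, 1; 1, 0], !![0, -Complex.I; Complex.I, 0], !![1, 0; 0, -1]]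

/-- The matrix of `J : ℂ^N → ℂ²`, `(J v)_j = ⟨v, f_j⟩` (linear in `v`). -/
def coordMatrix {N : ℕ} (f : Fin 2 → EuclideanSpace ℂ (Fin N)) :
    Matrix (Fin 2) (Fin N) ℂ :=
  Matrix.of fun j i => star (f j i)

/-- The reduced `2 × 2` matrix `J A J*`. -/
def reduced {N : ℕ} (f : Fin 2 → EuclideanSpace ℂ (Fin N)) (A : Herm N) :
    Matrix (Fin 2) (Fin 2) ℂ :=
  coordMatrix f * A.1 * (coordMatrix f)ᴴ

/-- `f` is an orthonormal basis of `ker (H ζ - λ_n (H ζ))` and `A` is the matrix of Pauli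
coefficients of the linearization at `ζ` of the family reduced by `f`:
`J H(ζ+ε) J* = J H(ζ) J* + ⟨a, ε⟩ Id + ∑_j (A ε)_j σ_j + O(|ε|²)` for some `a ∈ ℝ³`. -/
def IsPauliLinearization {N : ℕ} (n : ℕ) (H : ℝ × Torus2 → Herm N) (ζ : ℝ × Torus2)
    (f : Fin 2 → EuclideanSpace ℂ (Fin N)) (A : Matrix (Fin 3) (Fin 3) ℝ) : Prop :=
  Orthonormal ℂ f ∧
  Submodule.span ℂ (range f) = eigSpace (H ζ) (eig (H ζ) n) ∧
  ∃ a : EuclideanSpace ℝ (Fin 3), ∀ i j : Fin 2,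
    (fun ε : EuclideanSpace ℝ (Fin 3) =>
      (reduced f (H (shiftPoint ζ ε)) - reduced f (H ζ)
        - ((inner ℝ a ε : ℝ) : ℂ) • (1 : Matrix (Fin 2) (Fin 2) ℂ)
        - ∑ l : Fin 3, ((Matrix.toEuclideanLin A ε l : ℝ) : ℂ) • pauli l) i j)
      =O[smallShifts ζ] fun ε => ‖ε‖ ^ 2

end

/-! The Berry curvature of the lower projector `P` is the restriction to a slice `s = const` of the
2-form `Tr(P dP ∧ dP)` on the complement of the crossings in `[0,1] × 𝕋²`. This form is closed: its
exterior derivative is a combination of traces `Tr(∂P ∂P ∂P)`, and each of these vanishes because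
`∂P` exchanges the range and the kernel of `P` (`berryField_divergence`). Written as a
divergence-free vector field `X` on `ℝ³`, Stokes' theorem says that the flux of `X` through `s = 1`
minus the flux through `s = 0` is the sum of the fluxes out of small surfaces around the crossings,
the lateral faces of a period box cancelling by periodicity.

The local flux comes from a blow-up. First-order perturbation theory writes the curvature as a sum
over pairs (low level, high level) with denominators `(λ_i - λ_j)²` (`trace_lowProj_comm_eq`). Along
a ray `p₀ + rη` only the pair `(n, n+1)` has a closing gap, of size about `2r‖Sη‖`, so `r²` times
the curvature has a limit that depends only on the compressed 2×2 linearization. The Pauli algebra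
gives `-(i/2) Aη · (A e_a × A e_b) / ‖Aη‖³` (`ConicalAt.tendsto_berryForm`), the field of a
monopole. The same limit shows `‖Sη‖ = ‖Aη‖`, so `A` is invertible and `sgn det A` is `±1`. The
outward flux is `-2πi sgn det A`, and `i/(2π)` times it is `sgn det A`.

Surface integrals are avoided: `X` is multiplied by a cutoff that vanishes near every crossing and
is `1` on the boundary of the box. The divergence of the product is the pairing of `X` with the
gradient of the cutoff, supported on ellipsoidal shells `r ≤ ‖A(p - p₀)‖ ≤ 2r`; its integral is
computed as `r → 0` by rescaling and dominated convergence
(`ConicalAt.tendsto_integral_fluxDensity`), and `sum_flux_eq` assembles the global balance.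

Eigenvectors are never chosen continuously. Compactness of the unitary group supplies convergent
subsequences of eigenframes, and every limit needed turns out not to depend on the subsequence. -/

/-! ### Sorted diagonalizations and continuity of eigenvalues -/

/-- `A = U diag(d) U*` with `U` unitary and `d` increasing. -/
def SortedDiag {N : ℕ} (A U : Matrix (Fin N) (Fin N) ℂ) (d : Fin N → ℝ) : Prop :=
  U ∈ Matrix.unitaryGroup (Fin N) ℂ ∧ Monotone d ∧
    A = U * Matrix.diagonal (fun i => (d i : ℂ)) * Uᴴ

namespace SortedDiag
variable {N : ℕ} {A U U' : Matrix (Fin N) (Fin N) ℂ} {d d' : Fin N → ℝ}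

lemma star_mul (h : SortedDiag A U d) : Uᴴ * U = 1 := Matrix.mem_unitaryGroup_iff'.1 h.1
lemma mul_star (h : SortedDiag A U d) : U * Uᴴ = 1 := Matrix.mem_unitaryGroup_iff.1 h.1

lemma conj_eq (h : SortedDiag A U d) : Uᴴ * A * U = Matrix.diagonal (fun i => (d i : ℂ)) := by
  rw [h.2.2]
  calc Uᴴ * (U * Matrix.diagonal (fun i => (d i : ℂ)) * Uᴴ) * U
      = (Uᴴ * U) * Matrix.diagonal (fun i => (d i : ℂ)) * (Uᴴ * U) := by simp only [mul_assoc]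
    _ = _ := by rw [h.star_mul]; simp

lemma mul_eq (h : SortedDiag A U d) : A * U = U * Matrix.diagonal (fun i => (d i : ℂ)) := by
  rw [h.2.2, mul_assoc, h.star_mul, mul_one]

lemma star_mul_eq (h : SortedDiag A U d) :
    Uᴴ * A = Matrix.diagonal (fun i => (d i : ℂ)) * Uᴴ := by
  rw [h.2.2, mul_assoc U, ← mul_assoc, h.star_mul, one_mul]

lemma charpoly_roots (h : SortedDiag A U d) :
    A.charpoly.roots = Multiset.map (fun i => (d i : ℂ)) Finset.univ.val := by
  have : A.charpoly = ∏ i, (Polynomial.X - Polynomial.C (d i : ℂ)) := by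
    rw [h.2.2, Matrix.charpoly_mul_comm, ← mul_assoc, h.star_mul, one_mul]
    simp [Matrix.charpoly_diagonal]
  rw [this, Polynomial.roots_prod]
  · simp
  · exact Finset.prod_ne_zero_iff.2 fun i _ => Polynomial.X_sub_C_ne_zero _

/-- The roots of the characteristic polynomial determine the values as a multiset, and a multiset of
reals has only one increasing enumeration. -/
lemma unique (h : SortedDiag A U d) (h' : SortedDiag A U' d') : d = d' := by
  have h1 := h.charpoly_roots.symm.trans h'.charpoly_roots
  have h2 := congrArg (Multiset.map Complex.re) h1
  simp only [Multiset.map_map, Function.comp_def, Complex.ofReal_re] at h2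
  rw [Fin.univ_val_map, Fin.univ_val_map] at h2
  have h3 : (List.ofFn d).Perm (List.ofFn d') := Multiset.coe_eq_coe.1 h2
  exact List.ofFn_injective (h3.eq_of_pairwise' (r := (· ≤ ·)) 
    (List.sortedLE_iff_pairwise.1 h.2.1.sortedLE_ofFn)
    (List.sortedLE_iff_pairwise.1 h'.2.1.sortedLE_ofFn))

end SortedDiag

lemma exists_sortedDiag {N : ℕ} (A : Herm N) :
    ∃ U, SortedDiag A.1 U (fun i : Fin N => eig A (i + 1)) := by
  classical
  -- Reversal turns the decreasing enumeration of `eigenvalues₀` into an increasing one; the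
  -- zero-based index `i` then carries `λ_{i+1}`.
  let e : Fin N ≃ Fin (Fintype.card (Fin N)) :=
    Fin.revPerm.trans (finCongr (Fintype.card_fin N).symm)
  let σ : Fin N ≃ Fin N := e.trans (Fintype.equivOfCardEq (Fintype.card_fin _))
  let W : Matrix (Fin N) (Fin N) ℂ := A.2.eigenvectorUnitary
  have hW : Wᴴ * W = 1 := Matrix.mem_unitaryGroup_iff'.1 A.2.eigenvectorUnitary.2
  have hev : ∀ i : Fin N, eig A (i + 1) = A.2.eigenvalues (σ i) := by
    intro i
    have h1 : 1 ≤ (i : ℕ) + 1 ∧ (i : ℕ) + 1 ≤ N := by omega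
    simp only [eig, h1, and_self, dite_true, Matrix.IsHermitian.eigenvalues]
    congr 1
    simp only [σ, Equiv.trans_apply, Equiv.symm_apply_apply, e]
    ext
    simp
  refine ⟨W.submatrix id σ, ?_, ?_, ?_⟩
  · rw [Matrix.mem_unitaryGroup_iff']
    change (W.submatrix id σ)ᴴ * W.submatrix id σ = 1
    rw [Matrix.conjTranspose_submatrix, ← Matrix.submatrix_mul _ _ σ id σ Function.bijective_id, hW]
    simp
  · intro i j hij
    simp only [hev, Matrix.IsHermitian.eigenvalues]
    apply A.2.eigenvalues₀_antitone
    simp only [σ, Equiv.trans_apply, Equiv.symm_apply_apply, e]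
    have : (i : ℕ) ≤ j := hij
    simp [Fin.le_def]
    omega
  · have h := A.2.spectral_theorem
    rw [Unitary.conjStarAlgAut_apply] at h
    have hd : Matrix.diagonal (fun i : Fin N => (eig A (i + 1) : ℂ)) =
        (Matrix.diagonal (RCLike.ofReal ∘ A.2.eigenvalues) : Matrix _ _ ℂ).submatrix σ σ := by
      ext i j
      simp [Matrix.diagonal_apply, hev]
    rw [hd, Matrix.conjTranspose_submatrix, Matrix.submatrix_mul_equiv, Matrix.submatrix_mul_equiv]
    exact h

lemma SortedDiag.eig_eq {N : ℕ} {A : Herm N} {U : Matrix (Fin N) (Fin N) ℂ} {d : Fin N → ℝ}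
    (h : SortedDiag A.1 U d) : d = fun i : Fin N => eig A (i + 1) :=
  h.unique (exists_sortedDiag A).choose_spec

lemma isCompact_unitaryGroup (N : ℕ) :
    IsCompact (Matrix.unitaryGroup (Fin N) ℂ : Set (Matrix (Fin N) (Fin N) ℂ)) := by
  have h1 : IsCompact (univ.pi fun _ : Fin N => univ.pi fun _ : Fin N =>
      Metric.closedBall (0 : ℂ) 1) :=
    isCompact_univ_pi fun _ => isCompact_univ_pi fun _ => isCompact_closedBall _ _
  refine IsCompact.of_isClosed_subset (X := Matrix (Fin N) (Fin N) ℂ) h1 ?_ ?_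
  · have : (Matrix.unitaryGroup (Fin N) ℂ : Set (Matrix (Fin N) (Fin N) ℂ)) =
        {U | Uᴴ * U = 1} := by
      ext U
      exact Matrix.mem_unitaryGroup_iff'
    rw [this]
    exact isClosed_eq (by fun_prop) continuous_const
  · intro U hU i _ j _
    simpa using entry_norm_bound_of_unitary hU i j

lemma Matrix.tendsto_mul {N : ℕ} {ι : Type*} {l : Filter ι}
    {f g : ι → Matrix (Fin N) (Fin N) ℂ} {a b : Matrix (Fin N) (Fin N) ℂ}
    (hf : Tendsto f l (𝓝 a)) (hg : Tendsto g l (𝓝 b)) :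
    Tendsto (fun m => f m * g m) l (𝓝 (a * b)) :=
  hf.mul hg

lemma Matrix.tendsto_conjTranspose {N : ℕ} {ι : Type*} {l : Filter ι}
    {f : ι → Matrix (Fin N) (Fin N) ℂ} {a : Matrix (Fin N) (Fin N) ℂ}
    (hf : Tendsto f l (𝓝 a)) : Tendsto (fun m => (f m)ᴴ) l (𝓝 aᴴ) :=
  ((Continuous.matrix_conjTranspose continuous_id).tendsto a).comp hf

lemma Matrix.tendsto_elem {N : ℕ} {ι : Type*} {l : Filter ι}
    {f : ι → Matrix (Fin N) (Fin N) ℂ} {a : Matrix (Fin N) (Fin N) ℂ}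
    (hf : Tendsto f l (𝓝 a)) (i j : Fin N) : Tendsto (fun m => f m i j) l (𝓝 (a i j)) := by
  have hc : Continuous fun M : Matrix (Fin N) (Fin N) ℂ => M i j := continuous_id.matrix_elem i j
  exact (hc.tendsto a).comp hf

/-- The eigenvalues are the diagonal entries of `U* A U`, so they converge with the frame;
diagonality and monotonicity are closed conditions. -/
lemma SortedDiag.of_tendsto {N : ℕ} {A : ℕ → Matrix (Fin N) (Fin N) ℂ}
    {A₀ : Matrix (Fin N) (Fin N) ℂ} {U : ℕ → Matrix (Fin N) (Fin N) ℂ}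
    {U₀ : Matrix (Fin N) (Fin N) ℂ} {d : ℕ → Fin N → ℝ}
    (h : ∀ m, SortedDiag (A m) (U m) (d m)) (hA : Tendsto A atTop (𝓝 A₀))
    (hU₀ : U₀ ∈ Matrix.unitaryGroup (Fin N) ℂ) (hU : Tendsto U atTop (𝓝 U₀)) :
    ∃ d₀, Tendsto d atTop (𝓝 d₀) ∧ SortedDiag A₀ U₀ d₀ := by
  have hD : Tendsto (fun m => Matrix.diagonal (fun i => (d m i : ℂ))) atTop
      (𝓝 (U₀ᴴ * A₀ * U₀)) := by
    refine (Matrix.tendsto_mul (Matrix.tendsto_mul (Matrix.tendsto_conjTranspose hU) hA)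
      hU).congr fun m => ?_
    exact (h m).conj_eq
  have hd : Tendsto d atTop (𝓝 fun i => ((U₀ᴴ * A₀ * U₀) i i).re) := by
    rw [tendsto_pi_nhds]
    intro i
    refine ((Complex.continuous_re.tendsto _).comp (Matrix.tendsto_elem hD i i)).congr fun m => ?_
    simp
  refine ⟨_, hd, hU₀, ?_, ?_⟩
  · intro i j hij
    exact le_of_tendsto_of_tendsto' (tendsto_pi_nhds.1 hd i) (tendsto_pi_nhds.1 hd j)
      fun m => (h m).2.1 hij
  · have hUU : U₀ * U₀ᴴ = 1 := Matrix.mem_unitaryGroup_iff.1 hU₀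
    have hDe : U₀ᴴ * A₀ * U₀ =
        Matrix.diagonal (fun i => (((U₀ᴴ * A₀ * U₀) i i).re : ℂ)) := by
      refine tendsto_nhds_unique hD ?_
      have hc : Continuous fun x : Fin N → ℝ => Matrix.diagonal fun i => (x i : ℂ) := by fun_prop
      exact (hc.tendsto _).comp hd
    rw [← hDe]
    calc A₀ = (U₀ * U₀ᴴ) * A₀ * (U₀ * U₀ᴴ) := by rw [hUU]; simp
      _ = _ := by simp only [mul_assoc]

lemma SortedDiag.exists_subseq {N : ℕ} {A : ℕ → Matrix (Fin N) (Fin N) ℂ}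
    {A₀ : Matrix (Fin N) (Fin N) ℂ} {U : ℕ → Matrix (Fin N) (Fin N) ℂ} {d : ℕ → Fin N → ℝ}
    (h : ∀ m, SortedDiag (A m) (U m) (d m)) (hA : Tendsto A atTop (𝓝 A₀)) :
    ∃ (U₀ : Matrix (Fin N) (Fin N) ℂ) (d₀ : Fin N → ℝ) (φ : ℕ → ℕ), StrictMono φ ∧
      Tendsto (U ∘ φ) atTop (𝓝 U₀) ∧ Tendsto (d ∘ φ) atTop (𝓝 d₀) ∧ SortedDiag A₀ U₀ d₀ := by
  have : FirstCountableTopology (Matrix (Fin N) (Fin N) ℂ) :=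
    inferInstanceAs (FirstCountableTopology (Fin N → Fin N → ℂ))
  obtain ⟨U₀, hU₀, φ, hφ, hU⟩ := (isCompact_unitaryGroup N).tendsto_subseq fun m => (h m).1
  obtain ⟨d₀, hd, hs⟩ := SortedDiag.of_tendsto (fun m => h (φ m)) (hA.comp hφ.tendsto_atTop) hU₀ hU
  exact ⟨U₀, d₀, φ, hφ, hU, hd, hs⟩

/-- A compactness argument: along any sequence the eigenframes subconverge to a frame diagonalizing
the limit, and the sorted eigenvalues do not depend on the frame by `SortedDiag.unique`. -/
lemma tendsto_eig {N : ℕ} {ι : Type*} {l : Filter ι} [l.IsCountablyGenerated] {A : ι → Herm N}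
    {A₀ : Herm N} (hA : Tendsto (fun x => (A x).1) l (𝓝 A₀.1)) (j : ℕ) :
    Tendsto (fun x => eig (A x) j) l (𝓝 (eig A₀ j)) := by
  by_cases hj : 1 ≤ j ∧ j ≤ N
  swap
  · simpa only [eig, hj, dite_false] using tendsto_const_nhds
  refine tendsto_of_subseq_tendsto fun ns hns => ?_
  choose U hU using fun m => exists_sortedDiag (A (ns m))
  obtain ⟨U₀, d₀, φ, hφ, -, hd, h0⟩ := SortedDiag.exists_subseq hU (hA.comp hns)
  refine ⟨φ, ?_⟩
  have := tendsto_pi_nhds.1 hd ⟨j - 1, by omega⟩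
  rw [h0.eig_eq] at this
  simpa [Function.comp_def, Nat.sub_add_cancel hj.1] using this

/-! ### The projector onto the lower levels -/

/-- The matrix of the orthogonal projection onto the first `n` eigenvectors. -/
noncomputable def lowProj {N : ℕ} (n : ℕ) (A : Herm N) : Matrix (Fin N) (Fin N) ℂ :=
  projMatrix (⨆ j ∈ Finset.Icc 1 n, eigSpace A (eig A j))

/-- The diagonal `0`-`1` matrix with ones at the first `n` places. -/
def lowDiag (N n : ℕ) : Matrix (Fin N) (Fin N) ℂ :=
  Matrix.diagonal fun i => if (i : ℕ) < n then 1 else 0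

lemma mem_eigSpace_iff {N : ℕ} {A : Herm N} {μ : ℝ} {v : EuclideanSpace ℂ (Fin N)} :
    v ∈ eigSpace A μ ↔ A.1 *ᵥ v.ofLp = (μ : ℂ) • v.ofLp := by
  rw [eigSpace, Module.End.mem_eigenspace_iff]
  constructor
  · intro h
    simpa using congrArg WithLp.ofLp h
  · intro h
    apply (WithLp.ofLp_injective 2)
    simpa using h

/-- The gap enters here: the lower eigenspaces are spanned by the first `n` columns of `U` only
because no level of index above `n` shares one of their eigenvalues. -/
lemma SortedDiag.lowProj_eq {N n : ℕ} {A : Herm N} {U : Matrix (Fin N) (Fin N) ℂ} {d : Fin N → ℝ}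
    (h : SortedDiag A.1 U d) (hgap : eig A n < eig A (n + 1)) (hnN : n < N) :
    lowProj n A = U * lowDiag N n * Uᴴ := by
  have hd := h.eig_eq
  rw [lowProj, projMatrix, LinearEquiv.symm_apply_eq]
  ext1 v
  refine Submodule.eq_starProjection_of_mem_of_inner_eq_zero ?_ ?_
  · have hsum : Matrix.toEuclideanLin (U * lowDiag N n * Uᴴ) v =
        ∑ i : Fin N, (if (i : ℕ) < n then (Uᴴ *ᵥ v.ofLp) i else 0) •
          (WithLp.toLp 2 (fun a => U a i) : EuclideanSpace ℂ (Fin N)) := by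
      apply WithLp.ofLp_injective 2
      ext a
      have hlow : ∀ x : Fin N → ℂ, lowDiag N n *ᵥ x =
          fun i : Fin N => if (i : ℕ) < n then x i else 0 := by
        intro x
        ext i
        rw [lowDiag, Matrix.mulVec_diagonal]
        split_ifs <;> simp
      rw [Matrix.toLpLin_apply, ← Matrix.mulVec_mulVec, ← Matrix.mulVec_mulVec, hlow,
        WithLp.ofLp_sum, Finset.sum_apply]
      simp only [Matrix.mulVec.eq_1 U, dotProduct]
      refine Finset.sum_congr rfl fun i _ => ?_
      rw [mul_comm]
      rfl
    rw [hsum]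
    refine Submodule.sum_mem _ fun i _ => ?_
    split_ifs with hi
    · refine Submodule.smul_mem _ _ ?_
      refine Submodule.mem_iSup_of_mem ((i : ℕ) + 1) (Submodule.mem_iSup_of_mem (by simp; omega) ?_)
      rw [mem_eigSpace_iff]
      ext a
      have := congrFun (congrFun h.mul_eq a) i
      rw [Matrix.mul_diagonal, hd] at this
      simpa [mul_comm, Matrix.mulVec, dotProduct, Matrix.mul_apply] using this
    · simp
  · intro w hw
    have hQ : Matrix.toEuclideanLin (U * lowDiag N n * Uᴴ) w = w := by
      suffices H : (⨆ j ∈ Finset.Icc 1 n, eigSpace A (eig A j)) ≤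
          LinearMap.eqLocus (Matrix.toEuclideanLin (U * lowDiag N n * Uᴴ)) LinearMap.id from H hw
      refine iSup₂_le fun j hj w hw => ?_
      rw [LinearMap.mem_eqLocus]
      apply WithLp.ofLp_injective 2
      simp only [Matrix.toLpLin_apply, LinearMap.id_apply]
      rw [mem_eigSpace_iff] at hw
      rw [Finset.mem_Icc] at hj
      have h1 : Uᴴ *ᵥ (A.1 *ᵥ w.ofLp) = (eig A j : ℂ) • (Uᴴ *ᵥ w.ofLp) := by
        rw [hw, Matrix.mulVec_smul]
      rw [Matrix.mulVec_mulVec, h.star_mul_eq, ← Matrix.mulVec_mulVec] at h1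
      -- In the frame `U` the vector has no component on a high column `i`, since `d i ≥ λ_{n+1} >
      -- λ_n ≥ λ_j`.
      have h2 : lowDiag N n *ᵥ (Uᴴ *ᵥ w.ofLp) = Uᴴ *ᵥ w.ofLp := by
        ext i
        rw [lowDiag, Matrix.mulVec_diagonal]
        split_ifs with hi
        · simp
        · have h3 := congrFun h1 i
          rw [Matrix.mulVec_diagonal, Pi.smul_apply, smul_eq_mul] at h3
          have hm : Monotone d := h.2.1
          have h4 : eig A j ≤ eig A n := by
            have := @hm ⟨j - 1, by omega⟩ ⟨n - 1, by omega⟩ (by simp [Fin.le_def]; omega)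
            rw [hd] at this
            simpa [Nat.sub_add_cancel hj.1, Nat.sub_add_cancel (hj.1.trans hj.2)] using this
          have h5 : eig A (n + 1) ≤ d i := by
            have := @hm ⟨n, hnN⟩ i (by simp [Fin.le_def]; omega)
            nth_rewrite 1 [hd] at this
            simpa using this
          have h6 : ((d i : ℂ) - eig A j) ≠ 0 := by
            rw [← Complex.ofReal_sub, Complex.ofReal_ne_zero]
            linarith
          have h7 : ((d i : ℂ) - eig A j) * (Uᴴ *ᵥ w.ofLp) i = 0 := by
            rw [sub_mul, h3, sub_self]
          rw [(mul_eq_zero.1 h7).resolve_left h6, mul_zero]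
      rw [← Matrix.mulVec_mulVec, ← Matrix.mulVec_mulVec, h2, Matrix.mulVec_mulVec, h.mul_star,
        Matrix.one_mulVec]
    have hherm : (U * lowDiag N n * Uᴴ).IsHermitian := by
      rw [Matrix.IsHermitian, Matrix.conjTranspose_mul, Matrix.conjTranspose_mul,
        Matrix.conjTranspose_conjTranspose, ← mul_assoc]
      congr 2
      rw [lowDiag, Matrix.diagonal_conjTranspose]
      congr 1
      ext i
      simp only [Pi.star_apply]
      split_ifs <;> simp
    have hsym := Matrix.isSymmetric_toEuclideanLin_iff.2 hherm
    rw [inner_sub_left, hsym v w, hQ, sub_self]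

/-- Limit frames are not unique, but all of them give the same projector at a gapped limit. -/
lemma tendsto_lowProj {N n : ℕ} {ι : Type*} {l : Filter ι} [l.IsCountablyGenerated] {A : ι → Herm N}
    {A₀ : Herm N} (hA : Tendsto (fun x => (A x).1) l (𝓝 A₀.1)) (hnN : n < N)
    (hgap : eig A₀ n < eig A₀ (n + 1)) :
    Tendsto (fun x => lowProj n (A x)) l (𝓝 (lowProj n A₀)) := by
  have hev : ∀ᶠ x in l, eig (A x) n < eig (A x) (n + 1) :=
    (tendsto_eig hA n).eventually_lt (tendsto_eig hA (n + 1)) hgap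
  refine tendsto_of_subseq_tendsto fun ns hns => ?_
  choose U hU using fun m => exists_sortedDiag (A (ns m))
  obtain ⟨U₀, d₀, φ, hφ, hU₀, hd, h0⟩ := SortedDiag.exists_subseq hU (hA.comp hns)
  refine ⟨φ, ?_⟩
  rw [h0.lowProj_eq hgap hnN]
  have hc : Continuous fun U : Matrix (Fin N) (Fin N) ℂ => U * lowDiag N n * Uᴴ := by fun_prop
  refine ((hc.tendsto U₀).comp hU₀).congr' ?_
  filter_upwards [(hns.comp hφ.tendsto_atTop).eventually hev] with m hm
  exact ((hU (φ m)).lowProj_eq hm hnN).symm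

lemma lowDiag_mul_self (N n : ℕ) : lowDiag N n * lowDiag N n = lowDiag N n := by
  rw [lowDiag, Matrix.diagonal_mul_diagonal]
  congr 1
  ext i
  split_ifs <;> simp

lemma lowProj_mul_self {N n : ℕ} {A : Herm N} (hnN : n < N) (hgap : eig A n < eig A (n + 1)) :
    lowProj n A * lowProj n A = lowProj n A := by
  obtain ⟨U, hU⟩ := exists_sortedDiag A
  rw [hU.lowProj_eq hgap hnN]
  calc _ = U * lowDiag N n * (Uᴴ * U) * lowDiag N n * Uᴴ := by simp only [mul_assoc]
    _ = _ := by rw [hU.star_mul, mul_one, mul_assoc U, lowDiag_mul_self]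

lemma mul_lowProj_comm {N n : ℕ} {A : Herm N} (hnN : n < N) (hgap : eig A n < eig A (n + 1)) :
    A.1 * lowProj n A = lowProj n A * A.1 := by
  obtain ⟨U, hU⟩ := exists_sortedDiag A
  rw [hU.lowProj_eq hgap hnN]
  have hD : Matrix.diagonal (fun i : Fin N => (eig A (i + 1) : ℂ)) * lowDiag N n =
      lowDiag N n * Matrix.diagonal (fun i : Fin N => (eig A (i + 1) : ℂ)) := by
    simp only [lowDiag, Matrix.diagonal_mul_diagonal, mul_comm]
  calc _ = (A.1 * U) * lowDiag N n * Uᴴ := by simp only [mul_assoc]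
    _ = U * (Matrix.diagonal (fun i : Fin N => (eig A (i + 1) : ℂ)) * lowDiag N n) * Uᴴ := by
      rw [hU.mul_eq, mul_assoc U]
    _ = U * lowDiag N n * (Uᴴ * A.1) := by
      rw [hD, hU.star_mul_eq]
      simp only [mul_assoc]
    _ = _ := by simp only [mul_assoc]

/-! ### Smooth dependence of the projector, by the implicit function theorem -/

section
open scoped Matrix.Norms.Operator

/-- The equation `specEq p A P = 0` characterizes the spectral projector `P` of `A` near `p`. -/
noncomputable def specEq {N : ℕ} (p : Matrix (Fin N) (Fin N) ℂ)
    (x : Matrix (Fin N) (Fin N) ℂ × Matrix (Fin N) (Fin N) ℂ) : Matrix (Fin N) (Fin N) ℂ :=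
  p * (x.1 * x.2 - x.2 * x.1) * (1 - p) + (1 - p) * (x.1 * x.2 - x.2 * x.1) * p +
    p * (x.2 * x.2 - x.2) * p + (1 - p) * (x.2 * x.2 - x.2) * (1 - p)

/-- The system `AP = PA`, `P² = P` is overdetermined. `specEq` keeps the off-diagonal blocks of the
first equation and the diagonal blocks of the second, which leaves as many equations as unknowns and
an invertible linearization in `P`. -/
lemma contDiff_specEq {N : ℕ} (p : Matrix (Fin N) (Fin N) ℂ) : ContDiff ℝ ∞ (specEq p) := by
  unfold specEq
  fun_prop

lemma specEq_eq_zero {N : ℕ} {p A P : Matrix (Fin N) (Fin N) ℂ} (h1 : A * P = P * A)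
    (h2 : P * P = P) : specEq p (A, P) = 0 := by
  simp [specEq, h1, h2]

lemma fderiv_specEq {N : ℕ} (p A δ : Matrix (Fin N) (Fin N) ℂ) :
    fderiv ℝ (specEq p) (A, p) (0, δ) =
      p * (A * δ - δ * A) * (1 - p) + (1 - p) * (A * δ - δ * A) * p +
        p * (p * δ + δ * p - δ) * p + (1 - p) * (p * δ + δ * p - δ) * (1 - p) := by
  have h1 : HasDerivAt (fun t : ℝ => specEq p ((A, p) + t • (0, δ)))
      (fderiv ℝ (specEq p) (A, p) (0, δ)) 0 := by
    have hF : HasFDerivAt (specEq p) (fderiv ℝ (specEq p) (A, p)) ((A, p) + (0 : ℝ) • (0, δ)) := by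
      rw [zero_smul, add_zero]
      exact ((contDiff_specEq p).differentiable (by simp) _).hasFDerivAt
    have hl : HasDerivAt (fun t : ℝ => (A, p) + t • ((0 : Matrix (Fin N) (Fin N) ℂ), δ))
        ((0 : Matrix (Fin N) (Fin N) ℂ), δ) 0 := by
      simpa using! ((hasDerivAt_id (0 : ℝ)).smul_const ((0 : Matrix (Fin N) (Fin N) ℂ), δ)).const_add
        (A, p)
    exact hF.comp_hasDerivAt (0 : ℝ) hl
  refine h1.unique ?_
  have h2 : (fun t : ℝ => specEq p ((A, p) + t • (0, δ))) = fun t : ℝ =>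
      specEq p (A, p) + t • (p * (A * δ - δ * A) * (1 - p) + (1 - p) * (A * δ - δ * A) * p +
        p * (p * δ + δ * p - δ) * p + (1 - p) * (p * δ + δ * p - δ) * (1 - p)) +
        t ^ 2 • (p * (δ * δ) * p + (1 - p) * (δ * δ) * (1 - p)) := by
    ext1 t
    simp only [specEq, Prod.fst_add, Prod.snd_add, Prod.smul_fst, Prod.smul_snd, smul_zero, add_zero,
      mul_add, add_mul, mul_sub, sub_mul, smul_add, smul_sub, mul_smul_comm, smul_mul_assoc, pow_two,
      mul_smul, mul_one, one_mul]
    abel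
  rw [h2]
  have := ((((hasDerivAt_id (0 : ℝ)).smul_const (p * (A * δ - δ * A) * (1 - p) +
    (1 - p) * (A * δ - δ * A) * p + p * (p * δ + δ * p - δ) * p +
    (1 - p) * (p * δ + δ * p - δ) * (1 - p))).const_add (specEq p (A, p))).add
    (((hasDerivAt_id (0 : ℝ)).pow 2).smul_const (p * (δ * δ) * p + (1 - p) * (δ * δ) * (1 - p))))
  simpa using! this

/-- In an eigenframe the linearized operator acts entry by entry: it multiplies an off-diagonal
entry by a difference of a low and a high eigenvalue, nonzero by the gap, and a diagonal-block entry
by `±1`. -/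
lemma specEq_linear_injective {N n : ℕ} {A : Herm N} (hnN : n < N)
    (hgap : eig A n < eig A (n + 1)) {δ p : Matrix (Fin N) (Fin N) ℂ} (hp : p = lowProj n A)
    (h : p * (A.1 * δ - δ * A.1) * (1 - p) + (1 - p) * (A.1 * δ - δ * A.1) * p +
        p * (p * δ + δ * p - δ) * p + (1 - p) * (p * δ + δ * p - δ) * (1 - p) = 0) : δ = 0 := by
  obtain ⟨U, hU⟩ := exists_sortedDiag A
  let φ := Unitary.conjStarAlgAut ℂ (Matrix (Fin N) (Fin N) ℂ) ⟨U, hU.1⟩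
  set D := Matrix.diagonal fun i : Fin N => (eig A (i + 1) : ℂ) with hD
  have hφ : ∀ X, φ X = U * X * Uᴴ := fun X => by
    rw [Unitary.conjStarAlgAut_apply]
    rfl
  obtain ⟨δ', rfl⟩ : ∃ δ', φ δ' = δ := EquivLike.surjective φ δ
  have hpφ : p = φ (lowDiag N n) := by rw [hp, hU.lowProj_eq hgap hnN, hφ]
  have hAφ : A.1 = φ D := by rw [hφ, ← hU.2.2]
  rw [hpφ, hAφ, ← map_one φ] at h
  simp only [← map_mul, ← map_sub, ← map_add] at h
  rw [← map_zero φ] at h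
  have h0 := EquivLike.injective φ h
  have : δ' = 0 := by
    ext i j
    have hij := congrFun (congrFun h0 i) j
    have hone : (1 : Matrix (Fin N) (Fin N) ℂ) - lowDiag N n =
        Matrix.diagonal fun i : Fin N => if (i : ℕ) < n then 0 else 1 := by
      rw [lowDiag, ← Matrix.diagonal_one, Matrix.diagonal_sub]
      congr 1
      ext i
      split_ifs <;> simp
    rw [hone] at hij
    have hmono : Monotone fun i : Fin N => eig A (i + 1) := hU.2.1
    simp only [lowDiag, hD, Matrix.add_apply, Matrix.sub_apply, Matrix.diagonal_mul,
      Matrix.mul_diagonal, Matrix.zero_apply] at hij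
    rw [Matrix.zero_apply]
    have key : ∀ i j : Fin N, (i : ℕ) < n → ¬ (j : ℕ) < n →
        (eig A (i + 1) : ℂ) - eig A (j + 1) ≠ 0 := by
      intro i j hi hj
      rw [← Complex.ofReal_sub, Complex.ofReal_ne_zero]
      have h1 := @hmono i ⟨n - 1, by omega⟩ (by simp [Fin.le_def]; omega)
      have h2 := @hmono ⟨n, hnN⟩ j (by simp [Fin.le_def]; omega)
      simp only [Nat.sub_add_cancel (show 1 ≤ n by omega)] at h1 h2
      linarith
    by_cases hi : (i : ℕ) < n <;> by_cases hj : (j : ℕ) < n <;>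
      simp only [hi, hj, if_true, if_false, mul_one, one_mul, mul_zero, zero_mul, add_zero,
        zero_add] at hij
    · simpa using hij
    · have : ((eig A (i + 1) : ℂ) - eig A (j + 1)) * δ' i j = 0 := by linear_combination hij
      exact (mul_eq_zero.1 this).resolve_left (key i j hi hj)
    · have : ((eig A (j + 1) : ℂ) - eig A (i + 1)) * δ' i j = 0 := by linear_combination -hij
      exact (mul_eq_zero.1 this).resolve_left (key j i hj hi)
    · simpa using hij
  rw [this, map_zero]

lemma contDiffAt_lowProj {E : Type*} [NormedAddCommGroup E] [NormedSpace ℝ E] {N n : ℕ}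
    {H : E → Herm N} {x : E} (hH : ContDiffAt ℝ ∞ (fun y => (H y).1) x) (hnN : n < N)
    (hgap : eig (H x) n < eig (H x) (n + 1)) :
    ContDiffAt ℝ ∞ (fun y => lowProj n (H y)) x := by
  set p := lowProj n (H x) with hp
  have hc : ContDiffAt ℝ ∞ (specEq p) ((H x).1, p) := (contDiff_specEq p).contDiffAt
  have hinv : (fderiv ℝ (specEq p) ((H x).1, p) ∘L .inr ℝ _ _).IsInvertible := by
    set L := fderiv ℝ (specEq p) ((H x).1, p) ∘L
      .inr ℝ (Matrix (Fin N) (Fin N) ℂ) (Matrix (Fin N) (Fin N) ℂ) with hL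
    have hinj : Function.Injective L.toLinearMap := by
      rw [← LinearMap.ker_eq_bot, LinearMap.ker_eq_bot']
      intro δ hδ
      refine specEq_linear_injective hnN hgap hp ?_
      rw [← fderiv_specEq]
      exact hδ
    refine ⟨(LinearEquiv.ofInjectiveEndo _ hinj).toContinuousLinearEquiv, ?_⟩
    ext1 δ
    rfl
  have hgap' : ∀ᶠ y in 𝓝 x, eig (H y) n < eig (H y) (n + 1) :=
    (tendsto_eig hH.continuousAt n).eventually_lt (tendsto_eig hH.continuousAt (n + 1)) hgap
  have hP : Tendsto (fun y => lowProj n (H y)) (𝓝 x) (𝓝 p) :=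
    tendsto_lowProj hH.continuousAt hnN hgap
  -- Local uniqueness in the implicit function theorem applies because `lowProj` is already known to
  -- be continuous, so the pair stays near `(H x, p)`.
  have hev := (hH.continuousAt.tendsto.prodMk_nhds hP).eventually
    (hc.eventually_apply_eq_iff_implicitFunction (by simp) hinv)
  have hcomp : ContDiffAt ℝ ∞ (fun y => hc.implicitFunction (by simp) hinv (H y).1) x :=
    ContDiffAt.comp x (hc.contDiffAt_implicitFunction (by simp) hinv) hH
  refine hcomp.congr_of_eventuallyEq ?_
  filter_upwards [hev, hgap'] with y hy hg
  refine (hy.1 ?_).symm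
  rw [specEq_eq_zero (mul_lowProj_comm hnN hg) (lowProj_mul_self hnN hg),
    specEq_eq_zero (mul_lowProj_comm hnN hgap) (lowProj_mul_self hnN hgap)]

end

/-! ### The curvature form is closed -/

section
open scoped Matrix.Norms.Operator

/-- The directional derivative along the `a`-th coordinate vector of `ℝ³`. -/
noncomputable def dirDeriv {N : ℕ} (P : (Fin 3 → ℝ) → Matrix (Fin N) (Fin N) ℂ) (a : Fin 3)
    (p : Fin 3 → ℝ) : Matrix (Fin N) (Fin N) ℂ :=
  fderiv ℝ P p (Pi.single a 1)

/-- The component `Tr (P [∂ₐ P, ∂_b P])` of the curvature form of a field of projections. -/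
noncomputable def berryForm {N : ℕ} (P : (Fin 3 → ℝ) → Matrix (Fin N) (Fin N) ℂ) (a b : Fin 3)
    (p : Fin 3 → ℝ) : ℂ :=
  (P p * (dirDeriv P a p * dirDeriv P b p - dirDeriv P b p * dirDeriv P a p)).trace

/-- The vector field on `ℝ³` dual to the curvature form. -/
noncomputable def berryField {N : ℕ} (P : (Fin 3 → ℝ) → Matrix (Fin N) (Fin N) ℂ)
    (p : Fin 3 → ℝ) (c : Fin 3) : ℂ :=
  berryForm P (c + 1) (c + 2) p

lemma contDiffAt_dirDeriv {N : ℕ} {P : (Fin 3 → ℝ) → Matrix (Fin N) (Fin N) ℂ} {p : Fin 3 → ℝ}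
    (hP : ContDiffAt ℝ ∞ P p) (a : Fin 3) : ContDiffAt ℝ ∞ (dirDeriv P a) p :=
  (hP.fderiv_right (m := ∞) (by simp)).clm_apply contDiffAt_const

lemma contDiffAt_berryForm {N : ℕ} {P : (Fin 3 → ℝ) → Matrix (Fin N) (Fin N) ℂ} {p : Fin 3 → ℝ}
    (hP : ContDiffAt ℝ ∞ P p) (a b : Fin 3) : ContDiffAt ℝ ∞ (berryForm P a b) p := by
  have ha := contDiffAt_dirDeriv hP a
  have hb := contDiffAt_dirDeriv hP b
  exact ((Matrix.traceLinearMap (Fin N) ℝ ℂ).toContinuousLinearMap.contDiff.contDiffAt).comp p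
    (hP.mul ((ha.mul hb).sub (hb.mul ha)))

lemma contDiffAt_berryField {N : ℕ} {P : (Fin 3 → ℝ) → Matrix (Fin N) (Fin N) ℂ} {p : Fin 3 → ℝ}
    (hP : ContDiffAt ℝ ∞ P p) : ContDiffAt ℝ ∞ (berryField P) p :=
  contDiffAt_pi.2 fun _ => contDiffAt_berryForm hP _ _

/-- The involution `R = 2P - 1` anticommutes with each of the three factors, so conjugating by `R`
reverses the sign of the product and preserves its trace. -/
lemma trace_mul_mul_eq_zero {N : ℕ} {P X Y Z : Matrix (Fin N) (Fin N) ℂ} (hP : P * P = P)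
    (hX : X * P + P * X = X) (hY : Y * P + P * Y = Y) (hZ : Z * P + P * Z = Z) :
    (X * Y * Z).trace = 0 := by
  set R := P - (1 - P) with hR
  have hRR : R * R = 1 := by
    rw [hR]
    simp only [mul_sub, sub_mul, mul_one, one_mul, hP]
    abel
  have anti : ∀ {W : Matrix (Fin N) (Fin N) ℂ}, W * P + P * W = W → W * R = -(R * W) := by
    intro W hW
    have : W * R + R * W = (W * P + P * W) + (W * P + P * W) - W - W := by
      rw [hR]
      simp only [mul_sub, sub_mul, mul_one, one_mul]
      abel
    rw [hW] at this
    rw [eq_neg_iff_add_eq_zero, this]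
    abel
  have h1 : X * Y * Z * R = -(R * (X * Y * Z)) := by
    calc X * Y * Z * R = X * Y * (Z * R) := by simp only [mul_assoc]
      _ = -(X * (Y * R) * Z) := by rw [anti hZ]; simp only [mul_assoc, mul_neg]
      _ = (X * R) * Y * Z := by rw [anti hY]; simp only [mul_assoc, mul_neg, neg_mul, neg_neg]
      _ = _ := by rw [anti hX]; simp only [mul_assoc, neg_mul]
  have h2 : (X * Y * Z).trace = -(X * Y * Z).trace := by
    calc (X * Y * Z).trace = (R * (X * Y * Z * R)).trace := by
          rw [Matrix.trace_mul_comm R, mul_assoc (X * Y * Z), hRR, mul_one]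
      _ = _ := by rw [h1, mul_neg, ← mul_assoc, hRR, one_mul, Matrix.trace_neg]
  linear_combination h2 / 2

lemma fderiv_berryForm {N : ℕ} {P : (Fin 3 → ℝ) → Matrix (Fin N) (Fin N) ℂ} {p : Fin 3 → ℝ}
    (hP : ContDiffAt ℝ ∞ P p) (a b c : Fin 3) :
    fderiv ℝ (berryForm P a b) p (Pi.single c 1) =
      (P p * (dirDeriv P a p * dirDeriv (dirDeriv P b) c p +
            dirDeriv (dirDeriv P a) c p * dirDeriv P b p -
          (dirDeriv P b p * dirDeriv (dirDeriv P a) c p +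
            dirDeriv (dirDeriv P b) c p * dirDeriv P a p)) +
        dirDeriv P c p *
          (dirDeriv P a p * dirDeriv P b p - dirDeriv P b p * dirDeriv P a p)).trace := by
  have hd : ∀ {Q : (Fin 3 → ℝ) → Matrix (Fin N) (Fin N) ℂ}, ContDiffAt ℝ ∞ Q p →
      HasFDerivAt Q (fderiv ℝ Q p) p := fun h => (h.differentiableAt (by simp)).hasFDerivAt
  have ha := hd (contDiffAt_dirDeriv hP a)
  have hb := hd (contDiffAt_dirDeriv hP b)
  have := ((Matrix.traceLinearMap (Fin N) ℝ ℂ).toContinuousLinearMap.hasFDerivAt).comp p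
    ((hd hP).mul' ((ha.mul' hb).sub (hb.mul' ha)))
  exact DFunLike.congr_fun (HasFDerivAt.fderiv (f := berryForm P a b) this) (Pi.single c 1)

/-- The terms with second derivatives cancel in the cyclic sum by symmetry of mixed partials; the
remaining terms are traces of three first derivatives. -/
lemma berryField_divergence {N : ℕ} {P : (Fin 3 → ℝ) → Matrix (Fin N) (Fin N) ℂ} {p : Fin 3 → ℝ}
    (hP : ContDiffAt ℝ ∞ P p) (hPP : ∀ᶠ q in 𝓝 p, P q * P q = P q) :
    ∑ c, fderiv ℝ (berryField P) p (Pi.single c 1) c = 0 := by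
  have hcomp : ∀ c, fderiv ℝ (berryField P) p (Pi.single c 1) c =
      fderiv ℝ (berryForm P (c + 1) (c + 2)) p (Pi.single c 1) := by
    intro c
    have h := ((contDiffAt_berryField hP).differentiableAt (by simp)).hasFDerivAt
    exact (DFunLike.congr_fun (HasFDerivAt.fderiv (f := berryForm P (c + 1) (c + 2))
      (hasFDerivAt_pi'.1 h c)) (Pi.single c 1)).symm
  have hsymm : ∀ a b, dirDeriv (dirDeriv P a) b p = dirDeriv (dirDeriv P b) a p := by
    have hs : IsSymmSndFDerivAt ℝ P p := hP.isSymmSndFDerivAt (by simp; exact WithTop.coe_le_coe.2 le_top)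
    have h2 : HasFDerivAt (fderiv ℝ P) (fderiv ℝ (fderiv ℝ P) p) p :=
      ((hP.fderiv_right (m := ∞) (by simp)).differentiableAt (by simp)).hasFDerivAt
    have : ∀ a b, dirDeriv (dirDeriv P a) b p =
        fderiv ℝ (fderiv ℝ P) p (Pi.single b 1) (Pi.single a 1) := by
      intro a b
      have h3 := DFunLike.congr_fun (HasFDerivAt.fderiv (f := dirDeriv P a)
        (h2.clm_apply (hasFDerivAt_const (Pi.single a 1) p))) (Pi.single b 1)
      refine h3.trans ?_
      change fderiv ℝ P p 0 + fderiv ℝ (fderiv ℝ P) p (Pi.single b 1) (Pi.single a 1) = _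
      rw [map_zero, zero_add]
    intro a b
    rw [this, this]
    exact hs _ _
  -- Differentiating `P² = P` shows that every `∂P` is off-diagonal with respect to `P`.
  have hodd : ∀ a, dirDeriv P a p * P p + P p * dirDeriv P a p = dirDeriv P a p := by
    intro a
    have h := (hP.differentiableAt (by simp)).hasFDerivAt
    have h1 := (h.mul' h).congr_of_eventuallyEq (hPP.mono fun q hq => hq.symm)
    have := DFunLike.congr_fun (h1.unique h) (Pi.single a 1)
    rw [add_comm]
    exact this
  have ht : ∀ a b c, (dirDeriv P a p * dirDeriv P b p * dirDeriv P c p).trace = 0 := fun a b c =>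
    trace_mul_mul_eq_zero hPP.self_of_nhds (hodd a) (hodd b) (hodd c)
  simp only [hcomp, Fin.sum_univ_three, fderiv_berryForm hP, mul_add, mul_sub, Matrix.trace_add,
    Matrix.trace_sub, ← mul_assoc, ht]
  rw [show (0 : Fin 3) + 1 = 1 from rfl, show (0 : Fin 3) + 2 = 2 from rfl,
    show (1 : Fin 3) + 1 = 2 from rfl, show (1 : Fin 3) + 2 = 0 from rfl,
    show (2 : Fin 3) + 1 = 0 from rfl, show (2 : Fin 3) + 2 = 1 from rfl,
    hsymm 2 0, hsymm 1 0, hsymm 2 1]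
  ring

end

/-! ### Curvature as a sum over pairs of levels -/

/-- First-order perturbation theory for the curvature of a spectral projection. -/
lemma trace_lowProj_comm_eq {N n : ℕ} {A : Herm N} (hnN : n < N) (hgap : eig A n < eig A (n + 1))
    {U : Matrix (Fin N) (Fin N) ℂ} {d : Fin N → ℝ} (hU : SortedDiag A.1 U d)
    {D B : Fin 2 → Matrix (Fin N) (Fin N) ℂ}
    (hD : ∀ a, D a * lowProj n A + lowProj n A * D a = D a)
    (hB : ∀ a, B a * lowProj n A + A.1 * D a = D a * A.1 + lowProj n A * B a) :
    (lowProj n A * (D 0 * D 1 - D 1 * D 0)).trace =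
      ∑ i : Fin N, ∑ j : Fin N, (if (i : ℕ) < n ∧ n ≤ (j : ℕ) then
        ((Uᴴ * B 0 * U) i j * (Uᴴ * B 1 * U) j i - (Uᴴ * B 1 * U) i j * (Uᴴ * B 0 * U) j i) /
          ((d i : ℂ) - d j) ^ 2 else 0) := by
  set φ := Unitary.conjStarAlgAut ℂ (Matrix (Fin N) (Fin N) ℂ) ⟨U, hU.1⟩
  have hφ : ∀ X, φ X = U * X * Uᴴ := fun X => by
    rw [Unitary.conjStarAlgAut_apply]
    rfl
  have hback : ∀ X, Uᴴ * φ X * U = X := fun X => by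
    rw [hφ]
    calc _ = (Uᴴ * U) * X * (Uᴴ * U) := by simp only [mul_assoc]
      _ = X := by rw [hU.star_mul, one_mul, mul_one]
  choose D' hD' using fun a => EquivLike.surjective φ (D a)
  choose B' hB' using fun a => EquivLike.surjective φ (B a)
  have hpφ : lowProj n A = φ (lowDiag N n) := by rw [hU.lowProj_eq hgap hnN, hφ]
  have hAφ : A.1 = φ (Matrix.diagonal fun i => (d i : ℂ)) := by rw [hφ, ← hU.2.2]
  rw [hpφ] at hD
  rw [hpφ, hAφ] at hB
  simp only [← hD', ← hB', ← map_mul, ← map_add] at hD hB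
  have hD2 := fun a => EquivLike.injective φ (hD a)
  have hB2 := fun a => EquivLike.injective φ (hB a)
  have hmono := hU.2.1
  have hd := hU.eig_eq
  have key : ∀ i j : Fin N, (i : ℕ) < n → ¬ (j : ℕ) < n → (d i : ℂ) - d j ≠ 0 := by
    intro i j hi hj
    rw [← Complex.ofReal_sub, Complex.ofReal_ne_zero]
    have h1 := @hmono i ⟨n - 1, by omega⟩ (by simp [Fin.le_def]; omega)
    have h2 := @hmono ⟨n, hnN⟩ j (by simp [Fin.le_def]; omega)
    have h3 : d ⟨n - 1, by omega⟩ = eig A n := by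
      rw [hd]
      simp [Nat.sub_add_cancel (show 1 ≤ n by omega)]
    have h4 : d ⟨n, hnN⟩ = eig A (n + 1) := by rw [hd]
    linarith
  have hDe : ∀ a i j, D' a i j * (if (j : ℕ) < n then 1 else 0) +
      (if (i : ℕ) < n then 1 else 0) * D' a i j = D' a i j := fun a i j => by
    simpa [lowDiag] using congrFun (congrFun (hD2 a) i) j
  have hBe : ∀ a i j, B' a i j * (if (j : ℕ) < n then 1 else 0) + d i * D' a i j =
      D' a i j * d j + (if (i : ℕ) < n then 1 else 0) * B' a i j := fun a i j => by
    simpa [lowDiag] using congrFun (congrFun (hB2 a) i) j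
  have htr : ∀ X, (φ X).trace = X.trace := fun X => by
    rw [hφ, Matrix.trace_mul_comm, ← mul_assoc, hU.star_mul, one_mul]
  simp only [hpφ, ← hD', ← hB', hback, ← map_mul, ← map_sub, htr]
  rw [Matrix.trace]
  refine Finset.sum_congr rfl fun i _ => ?_
  rw [Matrix.diag_apply, lowDiag, Matrix.diagonal_mul, Matrix.sub_apply, Matrix.mul_apply,
    Matrix.mul_apply, ← Finset.sum_sub_distrib, Finset.mul_sum]
  refine Finset.sum_congr rfl fun j _ => ?_
  by_cases hi : (i : ℕ) < n
  swap
  · simp [hi]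
  by_cases hj : (j : ℕ) < n
  · have h0 : ∀ a, D' a i j = 0 := fun a => by
      have := hDe a i j
      simpa [hi, hj] using this
    have : ¬ n ≤ (j : ℕ) := by omega
    simp [h0, this]
  -- The differentiated relation `AP = PA`, read between a low and a high level, gives `∂P` as `∂A`
  -- divided by the eigenvalue difference; the two signs agree, so the product has the square in the
  -- denominator.
  · have h1 : ∀ a, D' a i j = B' a i j / (d i - d j) := fun a => by
      have := hBe a i j
      simp only [hi, hj, if_true, if_false] at this
      rw [eq_div_iff (key i j hi hj)]
      linear_combination this
    have h2 : ∀ a, D' a j i = B' a j i / (d i - d j) := fun a => by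
      have := hBe a j i
      simp only [hi, hj, if_true, if_false] at this
      rw [eq_div_iff (key i j hi hj)]
      linear_combination -this
    have hk := key i j hi hj
    simp only [hi, not_lt.1 hj, and_self, if_true, h1, h2]
    field_simp

/-! ### Pauli algebra of a two-level system -/

/-- The matrix `∑ l, u l • σ l`. -/
noncomputable def pauliComb (u : Fin 3 → ℝ) : Matrix (Fin 2) (Fin 2) ℂ :=
  ∑ l : Fin 3, ((u l : ℝ) : ℂ) • pauli l

lemma pauliComb_eq (u : Fin 3 → ℝ) :
    pauliComb u = !![(u 2 : ℂ), u 0 - Complex.I * u 1; u 0 + Complex.I * u 1, -u 2] := by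
  ext i j
  fin_cases i <;> fin_cases j <;> simp [pauliComb, pauli, Fin.sum_univ_three] <;> ring

lemma pauliComb_trace (u : Fin 3 → ℝ) : (pauliComb u).trace = 0 := by
  simp [pauliComb_eq, Matrix.trace_fin_two]

lemma pauliComb_anticomm (u v : Fin 3 → ℝ) :
    pauliComb u * pauliComb v + pauliComb v * pauliComb u = ((2 * (u ⬝ᵥ v) : ℝ) : ℂ) • 1 := by
  have hI := Complex.I_mul_I
  ext i j
  fin_cases i <;> fin_cases j <;>
    simp [pauliComb_eq, dotProduct, Fin.sum_univ_three] <;>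
    first
    | ring1
    | linear_combination (-2 * (u 1 : ℂ) * v 1) * hI

lemma pauliComb_comm (u v : Fin 3 → ℝ) :
    pauliComb u * pauliComb v - pauliComb v * pauliComb u =
      (2 * Complex.I) • pauliComb (crossProduct u v) := by
  have hI := Complex.I_mul_I
  ext i j
  fin_cases i <;> fin_cases j <;>
    simp [pauliComb_eq, cross_apply] <;>
    first
    | ring1
    | linear_combination (2 * (u 2 : ℂ) * v 0 - 2 * u 0 * v 2) * hI
    | linear_combination (-2 * (u 2 : ℂ) * v 0 + 2 * u 0 * v 2) * hI

/-- The Berry curvature numerator of a two-level system. -/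
lemma pauliComb_conj_comm {V : Matrix (Fin 2) (Fin 2) ℂ} (hV : Vᴴ * V = 1) {u : Fin 3 → ℝ} {ρ : ℝ}
    (hρ : ρ ≠ 0) (hu : Vᴴ * pauliComb u * V = Matrix.diagonal ![-(ρ : ℂ), ρ]) (p q : Fin 3 → ℝ) :
    (Vᴴ * pauliComb p * V) 0 1 * (Vᴴ * pauliComb q * V) 1 0 -
      (Vᴴ * pauliComb q * V) 0 1 * (Vᴴ * pauliComb p * V) 1 0 =
      -2 * Complex.I * ((u ⬝ᵥ crossProduct p q : ℝ) : ℂ) / ρ := by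
  have hV' : V * Vᴴ = 1 := mul_eq_one_comm.1 hV
  have hmul : ∀ X Y : Matrix (Fin 2) (Fin 2) ℂ, (Vᴴ * X * V) * (Vᴴ * Y * V) = Vᴴ * (X * Y) * V := by
    intro X Y
    calc _ = Vᴴ * X * (V * Vᴴ) * Y * V := by simp only [mul_assoc]
      _ = _ := by rw [hV', mul_one]; simp only [mul_assoc]
  set c := crossProduct p q
  -- Only the `(0,0)` entries are used. The commutator identity gives `2i` times the `(0,0)` entry
  -- of the conjugated `c = p × q`, and the anticommutator with the diagonalized `u` evaluates that
  -- entry as `-(u · c)/ρ`.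
  have h1 : (Vᴴ * pauliComb p * V) * (Vᴴ * pauliComb q * V) -
      (Vᴴ * pauliComb q * V) * (Vᴴ * pauliComb p * V) =
      (2 * Complex.I) • (Vᴴ * pauliComb c * V) := by
    rw [hmul, hmul, ← sub_mul, ← mul_sub, pauliComb_comm, mul_smul_comm, smul_mul_assoc]
  have h2 : (Vᴴ * pauliComb u * V) * (Vᴴ * pauliComb c * V) +
      (Vᴴ * pauliComb c * V) * (Vᴴ * pauliComb u * V) = ((2 * (u ⬝ᵥ c) : ℝ) : ℂ) • 1 := by
    rw [hmul, hmul, ← add_mul, ← mul_add, pauliComb_anticomm, mul_smul_comm, smul_mul_assoc,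
      mul_one, hV]
  rw [hu] at h2
  have h1' := congrFun (congrFun h1 0) 0
  have h2' := congrFun (congrFun h2 0) 0
  have hexp : ∀ X Y : Matrix (Fin 2) (Fin 2) ℂ, (X * Y) 0 0 = X 0 0 * Y 0 0 + X 0 1 * Y 1 0 :=
    fun X Y => by rw [Matrix.mul_apply, Fin.sum_univ_two]
  rw [Matrix.sub_apply, hexp (Vᴴ * pauliComb p * V), hexp (Vᴴ * pauliComb q * V), Matrix.smul_apply,
    smul_eq_mul] at h1'
  simp only [Matrix.add_apply, Matrix.diagonal_mul, Matrix.mul_diagonal, Matrix.smul_apply,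
    Matrix.cons_val_zero, Matrix.one_apply_eq, smul_eq_mul, mul_one] at h2'
  push_cast at h2'
  have hρ' : (ρ : ℂ) ≠ 0 := Complex.ofReal_ne_zero.2 hρ
  rw [eq_div_iff hρ']
  linear_combination (ρ : ℂ) * h1' - Complex.I * h2'

/-! ### Conical crossings and degenerate perturbation theory -/

/-- The Euclidean norm on `ℝ³`. -/
noncomputable def euclNorm (u : Fin 3 → ℝ) : ℝ := ‖(WithLp.toLp 2 u : EuclideanSpace ℝ (Fin 3))‖

lemma euclNorm_sq (u : Fin 3 → ℝ) : euclNorm u ^ 2 = u ⬝ᵥ u := by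
  rw [euclNorm, EuclideanSpace.real_norm_sq_eq]
  simp [dotProduct, pow_two]

lemma euclNorm_nonneg (u : Fin 3 → ℝ) : 0 ≤ euclNorm u := norm_nonneg _

lemma euclNorm_smul (r : ℝ) (u : Fin 3 → ℝ) : euclNorm (r • u) = |r| * euclNorm u := by
  rw [euclNorm, WithLp.toLp_smul, norm_smul, Real.norm_eq_abs, euclNorm]

lemma norm_le_euclNorm (u : Fin 3 → ℝ) : ‖u‖ ≤ euclNorm u :=
  (pi_norm_le_iff_of_nonneg (norm_nonneg _)).2 fun i =>
    PiLp.norm_apply_le (WithLp.toLp 2 u : EuclideanSpace ℝ (Fin 3)) i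

lemma euclNorm_pos {u : Fin 3 → ℝ} (hu : u ≠ 0) : 0 < euclNorm u :=
  (norm_pos_iff.2 hu).trans_le (norm_le_euclNorm u)

/-- `p₀` is a conical crossing of the family `G` of Hermitian matrices on `ℝ³`, with
linearization `A` in the basis `f`. -/
structure ConicalAt {N : ℕ} (n : ℕ) (G : (Fin 3 → ℝ) → Herm N) (p₀ : Fin 3 → ℝ)
    (f : Fin 2 → EuclideanSpace ℂ (Fin N)) (A S : Matrix (Fin 3) (Fin 3) ℝ)
    (ℓ ℓ' : (Fin 3 → ℝ) →ₗ[ℝ] ℝ) : Prop where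
  cross : eig (G p₀) n = eig (G p₀) (n + 1)
  mult : Module.finrank ℂ (eigSpace (G p₀) (eig (G p₀) n)) = 2
  unit : IsUnit S
  lower : (fun ε => eig (G (p₀ + ε)) n - (eig (G p₀) n + ℓ ε - euclNorm (S *ᵥ ε)))
    =o[𝓝 0] fun ε => ε
  upper : (fun ε => eig (G (p₀ + ε)) (n + 1) - (eig (G p₀) n + ℓ ε + euclNorm (S *ᵥ ε)))
    =o[𝓝 0] fun ε => ε
  orth : Orthonormal ℂ f
  span : Submodule.span ℂ (range f) = eigSpace (G p₀) (eig (G p₀) n)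
  pauli : ∀ i j : Fin 2, (fun ε => (reduced f (G (p₀ + ε)) - reduced f (G p₀)
    - ((ℓ' ε : ℝ) : ℂ) • (1 : Matrix (Fin 2) (Fin 2) ℂ) - pauliComb (A *ᵥ ε)) i j)
    =O[𝓝 0] fun ε => ‖ε‖ ^ 2

lemma SortedDiag.card_le_finrank {N : ℕ} {A : Herm N} {U : Matrix (Fin N) (Fin N) ℂ}
    {d : Fin N → ℝ} (h : SortedDiag A.1 U d) (μ : ℝ) (s : Finset (Fin N)) (hs : ∀ i ∈ s, d i = μ) :
    s.card ≤ Module.finrank ℂ (eigSpace A μ) := by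
  let v : s → EuclideanSpace ℂ (Fin N) := fun i => WithLp.toLp 2 fun a => U a i
  have hv : Orthonormal ℂ v := by
    rw [orthonormal_iff_ite]
    intro i j
    have := congrFun (congrFun h.star_mul i) j
    rw [Matrix.mul_apply, Matrix.one_apply] at this
    simp only [v, PiLp.inner_apply, RCLike.inner_apply, Subtype.ext_iff]
    rw [← this]
    exact Finset.sum_congr rfl fun a _ => mul_comm _ _
  have hmem : ∀ i, v i ∈ eigSpace A μ := by
    intro i
    rw [mem_eigSpace_iff]
    ext a
    have := congrFun (congrFun h.mul_eq a) i
    rw [Matrix.mul_diagonal, hs i i.2] at this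
    simpa [v, mul_comm, Matrix.mulVec, dotProduct, Matrix.mul_apply] using this
  have hli : LinearIndependent ℂ fun i => (⟨v i, hmem i⟩ : eigSpace A μ) := by
    apply LinearIndependent.of_comp (eigSpace A μ).subtype
    exact hv.linearIndependent
  simpa using hli.fintype_card_le_finrank

lemma exists_euclNorm_ge {S : Matrix (Fin 3) (Fin 3) ℝ} (hS : IsUnit S) :
    ∃ c > 0, ∀ ε : Fin 3 → ℝ, c * ‖ε‖ ≤ euclNorm (S *ᵥ ε) := by
  have hinj : Function.Injective (Matrix.toLin' S) := by
    simpa using! Matrix.mulVec_injective_of_isUnit hS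
  obtain ⟨K, hK, hL⟩ := (Matrix.toLin' S).exists_antilipschitzWith (LinearMap.ker_eq_bot.2 hinj)
  have hK' : (0 : ℝ) < K := hK
  refine ⟨(K : ℝ)⁻¹, inv_pos.2 hK', fun ε => ?_⟩
  have := hL.le_mul_dist ε 0
  simp only [dist_zero_right, map_zero, Matrix.toLin'_apply] at this
  rw [inv_mul_le_iff₀ hK']
  exact this.trans (mul_le_mul_of_nonneg_left (norm_le_euclNorm _) hK'.le)

namespace ConicalAt
variable {N n : ℕ} {G : (Fin 3 → ℝ) → Herm N} {p₀ : Fin 3 → ℝ}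
  {f : Fin 2 → EuclideanSpace ℂ (Fin N)} {A S : Matrix (Fin 3) (Fin 3) ℝ}
  {ℓ ℓ' : (Fin 3 → ℝ) →ₗ[ℝ] ℝ}

/-- The difference of the two expansions is `2‖Sε‖ + o(ε)` with `‖Sε‖ ≥ c‖ε‖`; an error of at most
`c‖ε‖` still leaves `c‖ε‖`. -/
lemma exists_gap_ge (h : ConicalAt n G p₀ f A S ℓ ℓ') :
    ∃ c > 0, ∀ᶠ ε in 𝓝 (0 : Fin 3 → ℝ), c * ‖ε‖ ≤ eig (G (p₀ + ε)) (n + 1) - eig (G (p₀ + ε)) n := by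
  obtain ⟨c, hc, hS⟩ := exists_euclNorm_ge h.unit
  refine ⟨c, hc, ?_⟩
  have := (h.upper.sub h.lower).bound hc
  filter_upwards [this] with ε hε
  rw [Real.norm_eq_abs] at hε
  have h1 := (abs_le.1 hε).1
  have h2 := hS ε
  linarith

/-- First-order asymptotics of the two eigenvalues along a ray. -/
lemma tendsto_eig_div (h : ConicalAt n G p₀ f A S ℓ ℓ') (η : Fin 3 → ℝ) :
    Tendsto (fun r : ℝ => (eig (G (p₀ + r • η)) n - eig (G p₀) n) / r) (𝓝[>] 0)
      (𝓝 (ℓ η - euclNorm (S *ᵥ η))) ∧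
    Tendsto (fun r : ℝ => (eig (G (p₀ + r • η)) (n + 1) - eig (G p₀) n) / r) (𝓝[>] 0)
      (𝓝 (ℓ η + euclNorm (S *ᵥ η))) := by
  have hray : Tendsto (fun r : ℝ => r • η) (𝓝[>] 0) (𝓝 0) := by
    have : Tendsto (fun r : ℝ => r • η) (𝓝 0) (𝓝 ((0 : ℝ) • η)) :=
      (continuous_id.smul continuous_const).tendsto 0
    rw [zero_smul] at this
    exact this.mono_left nhdsWithin_le_nhds
  have hO : (fun r : ℝ => r • η) =O[𝓝[>] 0] fun r => r := by
    refine IsBigO.of_bound ‖η‖ (Eventually.of_forall fun r => ?_)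
    rw [norm_smul, mul_comm]
  have aux : ∀ (e : (Fin 3 → ℝ) → ℝ) (c : ℝ), (fun ε => e ε - (eig (G p₀) n + ℓ ε +
      c * euclNorm (S *ᵥ ε))) =o[𝓝 0] (fun ε => ε) →
      Tendsto (fun r : ℝ => (e (r • η) - eig (G p₀) n) / r) (𝓝[>] 0)
        (𝓝 (ℓ η + c * euclNorm (S *ᵥ η))) := by
    intro e c he
    have h1 := ((he.comp_tendsto hray).trans_isBigO hO).tendsto_div_nhds_zero
    have h2 := h1.add_const (ℓ η + c * euclNorm (S *ᵥ η))
    rw [zero_add] at h2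
    refine h2.congr' ?_
    filter_upwards [self_mem_nhdsWithin] with r hr
    have hr : 0 < r := hr
    simp only [Function.comp_apply, map_smul, Matrix.mulVec_smul, euclNorm_smul, abs_of_pos hr,
      smul_eq_mul]
    field_simp
    ring
  constructor
  · simpa [sub_eq_add_neg] using aux (fun ε => eig (G (p₀ + ε)) n) (-1)
      (by simpa [sub_eq_add_neg] using h.lower)
  · simpa using aux (fun ε => eig (G (p₀ + ε)) (n + 1)) 1 (by simpa using h.upper)

end ConicalAt

section
open scoped Matrix.Norms.Operator

lemma dirDeriv_lowProj_relations {N n : ℕ} {G : (Fin 3 → ℝ) → Herm N} {p : Fin 3 → ℝ}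
    (hG : ContDiffAt ℝ ∞ (fun q => (G q).1) p) (hnN : n < N)
    (hgap : eig (G p) n < eig (G p) (n + 1)) (a : Fin 3) :
    (dirDeriv (fun q => lowProj n (G q)) a p * lowProj n (G p) +
      lowProj n (G p) * dirDeriv (fun q => lowProj n (G q)) a p =
        dirDeriv (fun q => lowProj n (G q)) a p) ∧
    (dirDeriv (fun q => (G q).1) a p * lowProj n (G p) +
        (G p).1 * dirDeriv (fun q => lowProj n (G q)) a p =
      dirDeriv (fun q => lowProj n (G q)) a p * (G p).1 +
        lowProj n (G p) * dirDeriv (fun q => (G q).1) a p) := by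
  have hev : ∀ᶠ q in 𝓝 p, eig (G q) n < eig (G q) (n + 1) :=
    (tendsto_eig hG.continuousAt n).eventually_lt (tendsto_eig hG.continuousAt (n + 1)) hgap
  have hP := ((contDiffAt_lowProj hG hnN hgap).differentiableAt (by simp)).hasFDerivAt
  have hH := (hG.differentiableAt (by simp)).hasFDerivAt
  constructor
  · have h1 := (hP.mul' hP).congr_of_eventuallyEq
      (hev.mono fun q hq => (lowProj_mul_self hnN hq).symm)
    have := DFunLike.congr_fun (h1.unique hP) (Pi.single a 1)
    rw [add_comm]
    exact this
  · have h1 := (hP.mul' hH).congr_of_eventuallyEq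
      (hev.mono fun q hq => (mul_lowProj_comm hnN hq))
    have := DFunLike.congr_fun (h1.unique (hH.mul' hP)) (Pi.single a 1)
    rw [add_comm, add_comm (dirDeriv (fun q => lowProj n (G q)) a p * (G p).1)]
    exact this.symm

lemma berryForm_lowProj_eq {N n : ℕ} {G : (Fin 3 → ℝ) → Herm N} {p : Fin 3 → ℝ}
    (hG : ContDiffAt ℝ ∞ (fun q => (G q).1) p) (hnN : n < N)
    (hgap : eig (G p) n < eig (G p) (n + 1)) {U : Matrix (Fin N) (Fin N) ℂ} {d : Fin N → ℝ}
    (hU : SortedDiag (G p).1 U d) (a b : Fin 3) :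
    berryForm (fun q => lowProj n (G q)) a b p =
      ∑ i : Fin N, ∑ j : Fin N, (if (i : ℕ) < n ∧ n ≤ (j : ℕ) then
        ((Uᴴ * dirDeriv (fun q => (G q).1) a p * U) i j *
            (Uᴴ * dirDeriv (fun q => (G q).1) b p * U) j i -
          (Uᴴ * dirDeriv (fun q => (G q).1) b p * U) i j *
            (Uᴴ * dirDeriv (fun q => (G q).1) a p * U) j i) /
          ((d i : ℂ) - d j) ^ 2 else 0) := by
  have h := fun c => dirDeriv_lowProj_relations hG hnN hgap c
  have := trace_lowProj_comm_eq hnN hgap hU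
    (D := ![dirDeriv (fun q => lowProj n (G q)) a p, dirDeriv (fun q => lowProj n (G q)) b p])
    (B := ![dirDeriv (fun q => (G q).1) a p, dirDeriv (fun q => (G q).1) b p])
    (by intro c; fin_cases c; exacts [(h a).1, (h b).1])
    (by intro c; fin_cases c; exacts [(h a).2, (h b).2])
  exact this

lemma continuous_dirDeriv {N : ℕ} {F : (Fin 3 → ℝ) → Matrix (Fin N) (Fin N) ℂ}
    (hF : ContDiff ℝ ∞ F) (a : Fin 3) : Continuous (dirDeriv F a) :=
  continuous_iff_continuousAt.2 fun _ => (contDiffAt_dirDeriv hF.contDiffAt a).continuousAt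

lemma tendsto_ray_slope {N : ℕ} {F : (Fin 3 → ℝ) → Matrix (Fin N) (Fin N) ℂ}
    (hF : ContDiff ℝ ∞ F) (p₀ η : Fin 3 → ℝ) :
    Tendsto (fun r : ℝ => ((r⁻¹ : ℝ) : ℂ) • (F (p₀ + r • η) - F p₀)) (𝓝[>] 0)
      (𝓝 (∑ a, ((η a : ℝ) : ℂ) • dirDeriv F a p₀)) := by
  have h : HasFDerivAt F (fderiv ℝ F p₀) p₀ := (hF.differentiable (by simp) p₀).hasFDerivAt
  have hl : HasDerivAt (fun r : ℝ => F (p₀ + r • η)) (fderiv ℝ F p₀ η) 0 := by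
    have h2 : HasDerivAt (fun r : ℝ => p₀ + r • η) η 0 := by
      simpa using ((hasDerivAt_id (0 : ℝ)).smul_const η).const_add p₀
    have h3 : HasFDerivAt F (fderiv ℝ F p₀) (p₀ + (0 : ℝ) • η) := by simpa using! h
    exact h3.comp_hasDerivAt (0 : ℝ) h2
  have h4 := hl.hasDerivWithinAt (s := Ioi 0)
  rw [hasDerivWithinAt_iff_tendsto_slope] at h4
  have h5 : fderiv ℝ F p₀ η = ∑ a, ((η a : ℝ) : ℂ) • dirDeriv F a p₀ := by
    conv_lhs => rw [show η = ∑ a, η a • (Pi.single a 1 : Fin 3 → ℝ) by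
      ext b; simp [Finset.sum_apply, Pi.single_apply]]
    refine (map_sum (fderiv ℝ F p₀) _ _).trans (Finset.sum_congr rfl fun a _ => ?_)
    refine (map_smul (fderiv ℝ F p₀) _ _).trans ?_
    ext i j
    simp [dirDeriv]
  rw [← h5]
  simp only [sdiff_singleton_eq_self (show (0 : ℝ) ∉ Ioi (0 : ℝ) by simp)] at h4
  refine h4.congr fun r => ?_
  ext i j
  simp [slope]

end

section
open scoped Matrix.Norms.Operator
namespace ConicalAt
variable {N n : ℕ} {G : (Fin 3 → ℝ) → Herm N} {p₀ : Fin 3 → ℝ}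
  {f : Fin 2 → EuclideanSpace ℂ (Fin N)} {A S : Matrix (Fin 3) (Fin 3) ℝ}
  {ℓ ℓ' : (Fin 3 → ℝ) →ₗ[ℝ] ℝ}

/-- The difference quotient along a ray converges to the compressed derivative, while the quadratic
remainder of the Pauli expansion disappears after division by `r`. -/
lemma reduced_directional (h : ConicalAt n G p₀ f A S ℓ ℓ')
    (hG : ContDiff ℝ ∞ fun p => (G p).1) (η : Fin 3 → ℝ) :
    coordMatrix f * (∑ a, ((η a : ℝ) : ℂ) • dirDeriv (fun p => (G p).1) a p₀) * (coordMatrix f)ᴴ =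
      ((ℓ' η : ℝ) : ℂ) • (1 : Matrix (Fin 2) (Fin 2) ℂ) + pauliComb (A *ᵥ η) := by
  ext i j
  have hslope := tendsto_ray_slope hG p₀ η
  have hc : Continuous fun X : Matrix (Fin N) (Fin N) ℂ =>
      (coordMatrix f * X * (coordMatrix f)ᴴ) i j := by
    have : Continuous fun X : Matrix (Fin N) (Fin N) ℂ => coordMatrix f * X * (coordMatrix f)ᴴ :=
      (continuous_const.matrix_mul continuous_id).matrix_mul continuous_const
    exact this.matrix_elem i j
  have h1 := (hc.tendsto _).comp hslope
  refine tendsto_nhds_unique h1 ?_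
  have hray : Tendsto (fun r : ℝ => r • η) (𝓝[>] 0) (𝓝 0) := by
    have : Tendsto (fun r : ℝ => r • η) (𝓝 0) (𝓝 ((0 : ℝ) • η)) :=
      (continuous_id.smul continuous_const).tendsto 0
    rw [zero_smul] at this
    exact this.mono_left nhdsWithin_le_nhds
  have hO := (h.pauli i j).comp_tendsto hray
  have ho : (fun r : ℝ => ‖r • η‖ ^ 2) =o[𝓝[>] 0] fun r : ℝ => r := by
    have h2 : (fun r : ℝ => r ^ 2) =o[𝓝[>] (0 : ℝ)] fun r : ℝ => r := by
      have := (isLittleO_pow_id (𝕜 := ℝ) (n := 2) (by norm_num)).mono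
        (nhdsWithin_le_nhds (s := Ioi (0 : ℝ)))
      exact this
    refine (h2.const_mul_left (‖η‖ ^ 2)).congr_left fun r => ?_
    rw [norm_smul, mul_pow, Real.norm_eq_abs, sq_abs, mul_comm]
  have h3 := hO.trans_isLittleO ho
  have h4 : Tendsto (fun r : ℝ => ((r⁻¹ : ℝ) : ℂ) * (reduced f (G (p₀ + r • η)) - reduced f (G p₀)
    - ((ℓ' (r • η) : ℝ) : ℂ) • (1 : Matrix (Fin 2) (Fin 2) ℂ) - pauliComb (A *ᵥ (r • η))) i j)
      (𝓝[>] 0) (𝓝 0) := by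
    rw [tendsto_zero_iff_norm_tendsto_zero]
    have := h3.norm_norm.tendsto_div_nhds_zero
    refine this.congr fun r => ?_
    simp [div_eq_inv_mul]
  have h5 := h4.add_const ((((ℓ' η : ℝ) : ℂ) • (1 : Matrix (Fin 2) (Fin 2) ℂ) +
    pauliComb (A *ᵥ η)) i j)
  rw [zero_add] at h5
  refine h5.congr' ?_
  filter_upwards [self_mem_nhdsWithin] with r hr
  have hr : (r : ℂ) ≠ 0 := Complex.ofReal_ne_zero.2 (ne_of_gt hr)
  have hps : pauliComb (A *ᵥ (r • η)) = (r : ℂ) • pauliComb (A *ᵥ η) := by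
    simp only [pauliComb, Matrix.mulVec_smul, Pi.smul_apply, smul_eq_mul, Finset.smul_sum, smul_smul,
      Complex.ofReal_mul]
  simp only [Function.comp_apply, hps, map_smul, smul_eq_mul, Matrix.mul_smul, Matrix.smul_mul,
    Matrix.mul_sub, Matrix.sub_mul, Matrix.sub_apply, Matrix.smul_apply, Matrix.add_apply, reduced,
    Complex.ofReal_mul, Complex.ofReal_inv]
  field_simp
  ring

lemma reduced_dirDeriv (h : ConicalAt n G p₀ f A S ℓ ℓ')
    (hG : ContDiff ℝ ∞ fun p => (G p).1) (a : Fin 3) :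
    coordMatrix f * dirDeriv (fun p => (G p).1) a p₀ * (coordMatrix f)ᴴ =
      ((ℓ' (Pi.single a 1) : ℝ) : ℂ) • (1 : Matrix (Fin 2) (Fin 2) ℂ) +
        pauliComb (A *ᵥ Pi.single a 1) := by
  rw [← h.reduced_directional hG]
  congr 2
  rw [Finset.sum_eq_single a]
  · simp
  · intro b _ hb
    simp [hb]
  · simp

/-- The limit frame of eigenvectors diagonalizes the compressed directional derivative. -/
lemma limit_block (h : ConicalAt n G p₀ f A S ℓ ℓ') (hn : 1 ≤ n) (hnN : n < N)
    (hG : ContDiff ℝ ∞ fun p => (G p).1) {η : Fin 3 → ℝ} {r : ℕ → ℝ}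
    (hr : Tendsto r atTop (𝓝[>] 0)) {U : ℕ → Matrix (Fin N) (Fin N) ℂ}
    {U₀ : Matrix (Fin N) (Fin N) ℂ} {d : ℕ → Fin N → ℝ} {d₀ : Fin N → ℝ}
    (hU : ∀ m, SortedDiag (G (p₀ + r m • η)).1 (U m) (d m))
    (hU₀ : SortedDiag (G p₀).1 U₀ d₀) (hlim : Tendsto U atTop (𝓝 U₀)) (k l : Fin 2) :
    (U₀ᴴ * (∑ a, ((η a : ℝ) : ℂ) • dirDeriv (fun p => (G p).1) a p₀) * U₀)
      (![⟨n - 1, by omega⟩, ⟨n, hnN⟩] k) (![⟨n - 1, by omega⟩, ⟨n, hnN⟩] l) =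
    Matrix.diagonal ![((ℓ η - euclNorm (S *ᵥ η) : ℝ) : ℂ),
      ((ℓ η + euclNorm (S *ᵥ η) : ℝ) : ℂ)] k l := by
  set ix : Fin 2 → Fin N := ![⟨n - 1, by omega⟩, ⟨n, hnN⟩] with hix
  set μ : Fin 2 → ℝ := ![ℓ η - euclNorm (S *ᵥ η), ℓ η + euclNorm (S *ᵥ η)] with hμ
  have hμ' : (![((ℓ η - euclNorm (S *ᵥ η) : ℝ) : ℂ), ((ℓ η + euclNorm (S *ᵥ η) : ℝ) : ℂ)] :
      Fin 2 → ℂ) = fun k => (μ k : ℂ) := by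
    ext k; fin_cases k <;> rfl
  have hd₀ : ∀ k, d₀ (ix k) = eig (G p₀) n := by
    intro k
    rw [hU₀.eig_eq]
    fin_cases k
    · simp [hix, Nat.sub_add_cancel hn]
    · simpa [hix] using h.cross.symm
  have hd : Tendsto (fun m => (d m (ix l) - eig (G p₀) n) / r m) atTop (𝓝 (μ l)) := by
    have hdm : ∀ m, d m = fun i : Fin N => eig (G (p₀ + r m • η)) (i + 1) := fun m => (hU m).eig_eq
    simp only [hdm]
    fin_cases l
    · simpa [hix, hμ, Nat.sub_add_cancel hn, Function.comp_def] using (h.tendsto_eig_div η).1.comp hr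
    · simpa [hix, hμ, Function.comp_def] using (h.tendsto_eig_div η).2.comp hr
  have hslope := (tendsto_ray_slope hG p₀ η).comp hr
  have h1 := Matrix.tendsto_elem (Matrix.tendsto_mul (Matrix.tendsto_mul
    (tendsto_const_nhds (x := U₀ᴴ)) hslope) hlim) (ix k) (ix l)
  have h2 := (Matrix.tendsto_elem (Matrix.tendsto_mul (tendsto_const_nhds (x := U₀ᴴ)) hlim)
    (ix k) (ix l)).mul ((Complex.continuous_ofReal.tendsto _).comp hd)
  rw [hU₀.star_mul, Matrix.one_apply] at h2
  rw [hμ', Matrix.diagonal_apply]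
  have hinj : ix k = ix l ↔ k = l := by
    have : n - 1 ≠ n := by omega
    fin_cases k <;> fin_cases l <;> simp [hix, Fin.ext_iff, this, this.symm]
  have h3 : (if ix k = ix l then (1 : ℂ) else 0) * (μ l : ℂ) = if k = l then (μ k : ℂ) else 0 := by
    simp only [hinj]
    split_ifs with hkl
    · rw [hkl, one_mul]
    · rw [zero_mul]
  rw [h3] at h2
  refine tendsto_nhds_unique h1 (h2.congr fun m => ?_)
  -- With the limit frame on the left and the moving frame on the right, each factor diagonalizes
  -- one of the two matrices. Entries of the increment are thus eigenvalue differences times entries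
  -- of `U₀* U m → 1`, and no rate of convergence of the frames is needed.
  have h4 : U₀ᴴ * ((G (p₀ + r m • η)).1 - (G p₀).1) * U m =
      U₀ᴴ * U m * Matrix.diagonal (fun i => (d m i : ℂ)) -
        Matrix.diagonal (fun i => (d₀ i : ℂ)) * (U₀ᴴ * U m) := by
    rw [mul_sub, sub_mul, hU₀.star_mul_eq, mul_assoc, (hU m).mul_eq]
    simp only [mul_assoc]
  have h5 := congrFun (congrFun h4 (ix k)) (ix l)
  rw [Matrix.sub_apply, Matrix.mul_diagonal, Matrix.diagonal_mul, hd₀] at h5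
  simp only [Function.comp_apply, Matrix.mul_smul, Matrix.smul_mul, Matrix.smul_apply, smul_eq_mul,
    h5]
  push_cast
  ring

/-- The two touching columns of `U` and the basis `f` span the same plane, so they differ by a
unitary `C`. Conjugation by `C` diagonalizes the Pauli matrix of `Aη`, which reduces the numerator
of the curvature to `pauliComb_conj_comm`. -/
lemma limit_values (h : ConicalAt n G p₀ f A S ℓ ℓ') (hn : 1 ≤ n) (hnN : n < N)
    (hG : ContDiff ℝ ∞ fun p => (G p).1) {η : Fin 3 → ℝ} (hη : η ≠ 0)
    {U : Matrix (Fin N) (Fin N) ℂ} {d : Fin N → ℝ}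
    (hU : SortedDiag (G p₀).1 U d)
    (hblock : ∀ k l, (Uᴴ * (∑ a, ((η a : ℝ) : ℂ) • dirDeriv (fun p => (G p).1) a p₀) * U)
      (![⟨n - 1, by omega⟩, ⟨n, hnN⟩] k) (![⟨n - 1, by omega⟩, ⟨n, hnN⟩] l) =
      Matrix.diagonal ![((ℓ η - euclNorm (S *ᵥ η) : ℝ) : ℂ),
      ((ℓ η + euclNorm (S *ᵥ η) : ℝ) : ℂ)] k l) :
    euclNorm (S *ᵥ η) = euclNorm (A *ᵥ η) ∧ ∀ a b : Fin 3,
    (Uᴴ * dirDeriv (fun p => (G p).1) a p₀ * U) ⟨n - 1, by omega⟩ ⟨n, hnN⟩ *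
        (Uᴴ * dirDeriv (fun p => (G p).1) b p₀ * U) ⟨n, hnN⟩ ⟨n - 1, by omega⟩ -
      (Uᴴ * dirDeriv (fun p => (G p).1) b p₀ * U) ⟨n - 1, by omega⟩ ⟨n, hnN⟩ *
        (Uᴴ * dirDeriv (fun p => (G p).1) a p₀ * U) ⟨n, hnN⟩ ⟨n - 1, by omega⟩ =
      -2 * Complex.I * (((A *ᵥ η) ⬝ᵥ crossProduct (A *ᵥ Pi.single a 1) (A *ᵥ Pi.single b 1) : ℝ) : ℂ)
        / (euclNorm (S *ᵥ η) : ℝ) := by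
  set ix : Fin 2 → Fin N := ![⟨n - 1, by omega⟩, ⟨n, hnN⟩] with hix
  set ρ := euclNorm (S *ᵥ η) with hρ
  have hρ0 : ρ ≠ 0 := by
    refine (euclNorm_pos ?_).ne'
    intro h0
    exact hη (Matrix.mulVec_injective_of_isUnit h.unit (by rw [h0, Matrix.mulVec_zero]))
  set F := (coordMatrix f)ᴴ with hF
  have hFs : Fᴴ = coordMatrix f := by rw [hF, Matrix.conjTranspose_conjTranspose]
  have hFF : Fᴴ * F = 1 := by
    ext j k
    rw [hFs, hF, Matrix.mul_apply, Matrix.one_apply, ← orthonormal_iff_ite.1 h.orth j k]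
    simp only [coordMatrix, Matrix.conjTranspose_apply, Matrix.of_apply, star_star,
      PiLp.inner_apply, RCLike.inner_apply]
    exact Finset.sum_congr rfl fun i _ => mul_comm _ _
  set W : Matrix (Fin N) (Fin 2) ℂ := U.submatrix id ix with hW
  have hWX : ∀ X : Matrix (Fin N) (Fin N) ℂ, ∀ k l, (Wᴴ * X * W) k l = (Uᴴ * X * U) (ix k) (ix l) :=
    fun X k l => rfl
  have hinj : ∀ k l, ix k = ix l ↔ k = l := by
    intro k l
    have : n - 1 ≠ n := by omega
    fin_cases k <;> fin_cases l <;> simp [hix, Fin.ext_iff, this, this.symm]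
  have hWW : Wᴴ * W = 1 := by
    ext k l
    have : (Wᴴ * W) k l = (Uᴴ * U) (ix k) (ix l) := rfl
    rw [this, hU.star_mul, Matrix.one_apply, Matrix.one_apply]
    simp only [hinj]
  have hd : ∀ k, d (ix k) = eig (G p₀) n := by
    intro k
    rw [hU.eig_eq]
    fin_cases k
    · simp [hix, Nat.sub_add_cancel hn]
    · simpa [hix] using h.cross.symm
  obtain ⟨C, hC⟩ : ∃ C : Matrix (Fin 2) (Fin 2) ℂ, W = F * C := by
    have hmem : ∀ k, (WithLp.toLp 2 fun a => W a k : EuclideanSpace ℂ (Fin N)) ∈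
        Submodule.span ℂ (range f) := by
      intro k
      rw [h.span, mem_eigSpace_iff]
      ext a
      have := congrFun (congrFun hU.mul_eq a) (ix k)
      rw [Matrix.mul_diagonal, hd] at this
      simpa [W, mul_comm, Matrix.mulVec, dotProduct, Matrix.mul_apply] using this
    choose c hc using fun k => (Submodule.mem_span_range_iff_exists_fun ℂ).1 (hmem k)
    refine ⟨Matrix.of fun j k => c k j, ?_⟩
    ext a k
    have := congrArg (fun v : EuclideanSpace ℂ (Fin N) => v a) (hc k)
    simp only [Fin.sum_univ_two, PiLp.add_apply, PiLp.smul_apply, smul_eq_mul] at this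
    rw [← this]
    simp [hF, Matrix.mul_apply, Fin.sum_univ_two, coordMatrix, mul_comm]
  have hCC : Cᴴ * C = 1 := by
    calc Cᴴ * C = Cᴴ * (Fᴴ * F) * C := by rw [hFF, Matrix.mul_one]
      _ = Wᴴ * W := by rw [hC, Matrix.conjTranspose_mul]; simp only [Matrix.mul_assoc]
      _ = 1 := hWW
  have hWC : ∀ X : Matrix (Fin N) (Fin N) ℂ,
      Wᴴ * X * W = Cᴴ * (coordMatrix f * X * (coordMatrix f)ᴴ) * C := by
    intro X
    rw [hC, Matrix.conjTranspose_mul, hFs]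
    simp only [Matrix.mul_assoc, hF]
  have hWX' : ∀ (c : ℂ) (Y : Matrix (Fin 2) (Fin 2) ℂ), Cᴴ * (c • 1 + Y) * C = c • 1 + Cᴴ * Y * C := by
    intro c Y
    rw [mul_add, add_mul, mul_smul_comm, smul_mul_assoc, mul_one, hCC]
  set DG := ∑ a, ((η a : ℝ) : ℂ) • dirDeriv (fun p => (G p).1) a p₀
  have hB : ((ℓ' η : ℝ) : ℂ) • (1 : Matrix (Fin 2) (Fin 2) ℂ) + Cᴴ * pauliComb (A *ᵥ η) * C =
      Matrix.diagonal ![((ℓ η - ρ : ℝ) : ℂ), ((ℓ η + ρ : ℝ) : ℂ)] := by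
    rw [← hWX', ← h.reduced_directional hG, ← hWC]
    ext k l
    rw [hWX]
    exact hblock k l
  have htr : (Cᴴ * pauliComb (A *ᵥ η) * C).trace = 0 := by
    rw [Matrix.trace_mul_comm, ← mul_assoc, mul_eq_one_comm.1 hCC, one_mul, pauliComb_trace]
  -- Pauli matrices are traceless, so taking traces identifies the scalar parts of the two
  -- expansions.
  have hℓ : (ℓ' η : ℂ) = ℓ η := by
    have := congrArg Matrix.trace hB
    rw [Matrix.trace_add, htr] at this
    simp at this
    linear_combination this / 2
  have hP : Cᴴ * pauliComb (A *ᵥ η) * C = Matrix.diagonal ![-(ρ : ℂ), ρ] := by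
    rw [← add_right_inj (((ℓ' η : ℝ) : ℂ) • (1 : Matrix (Fin 2) (Fin 2) ℂ)), hB, hℓ]
    ext k l
    fin_cases k <;> fin_cases l <;> simp [sub_eq_add_neg]
  constructor
  -- Squaring compares `ρ²` with `‖Aη‖²`, since `pauliComb v` squares to `‖v‖²`.
  · have hsq : (Cᴴ * pauliComb (A *ᵥ η) * C) * (Cᴴ * pauliComb (A *ᵥ η) * C) =
        (((A *ᵥ η) ⬝ᵥ (A *ᵥ η) : ℝ) : ℂ) • 1 := by
      have h2 : pauliComb (A *ᵥ η) * pauliComb (A *ᵥ η) =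
          (((A *ᵥ η) ⬝ᵥ (A *ᵥ η) : ℝ) : ℂ) • 1 := by
        have := pauliComb_anticomm (A *ᵥ η) (A *ᵥ η)
        rw [← two_smul ℂ, Complex.ofReal_mul, mul_smul] at this
        exact smul_right_injective _ (two_ne_zero' ℂ) (by simpa using this)
      calc _ = Cᴴ * pauliComb (A *ᵥ η) * (C * Cᴴ) * pauliComb (A *ᵥ η) * C := by
            simp only [mul_assoc]
        _ = Cᴴ * (pauliComb (A *ᵥ η) * pauliComb (A *ᵥ η)) * C := by
          rw [mul_eq_one_comm.1 hCC, mul_one]; simp only [mul_assoc]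
        _ = _ := by rw [h2, mul_smul_comm, smul_mul_assoc, mul_one, hCC]
    rw [hP] at hsq
    have h00 := congrFun (congrFun hsq 0) 0
    simp only [Matrix.diagonal_mul_diagonal, Matrix.diagonal_apply_eq, Matrix.cons_val_zero,
      Matrix.smul_apply, Matrix.one_apply_eq, smul_eq_mul, mul_one, neg_mul_neg] at h00
    have h01 : ρ * ρ = (A *ᵥ η) ⬝ᵥ (A *ᵥ η) := by exact_mod_cast h00
    rw [← euclNorm_sq, ← pow_two] at h01
    exact (pow_left_inj₀ (euclNorm_nonneg _) (euclNorm_nonneg _) two_ne_zero).1 h01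
  · intro a b
    -- The scalar part of the derivative is invisible off the diagonal.
    have hoff : ∀ (c : Fin 3) (k l : Fin 2), k ≠ l →
        (Uᴴ * dirDeriv (fun p => (G p).1) c p₀ * U) (ix k) (ix l) =
          (Cᴴ * pauliComb (A *ᵥ Pi.single c 1) * C) k l := by
      intro c k l hkl
      rw [← hWX, hWC, h.reduced_dirDeriv hG, hWX']
      simp [hkl]
    have e1 := hoff a 0 1 (by simp)
    have e2 := hoff b 0 1 (by simp)
    have e3 := hoff a 1 0 (by simp)
    have e4 := hoff b 1 0 (by simp)
    simp only [hix, Matrix.cons_val_zero, Matrix.cons_val_one] at e1 e2 e3 e4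
    rw [e1, e2, e3, e4]
    exact pauliComb_conj_comm hCC hρ0 hP _ _

end ConicalAt
end

/-! ### Blow-up of the curvature at a conical crossing -/

section
open scoped Matrix.Norms.Operator
namespace ConicalAt
variable {N n : ℕ} {G : (Fin 3 → ℝ) → Herm N} {p₀ : Fin 3 → ℝ}
  {f : Fin 2 → EuclideanSpace ℂ (Fin N)} {A S : Matrix (Fin 3) (Fin 3) ℝ}
  {ℓ ℓ' : (Fin 3 → ℝ) →ₗ[ℝ] ℝ}

/-- At the crossing only the two touching levels have a vanishing gap. -/
lemma eig_ne (h : ConicalAt n G p₀ f A S ℓ ℓ') (hn : 1 ≤ n) (hnN : n < N)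
    {U : Matrix (Fin N) (Fin N) ℂ} {d : Fin N → ℝ} (hU : SortedDiag (G p₀).1 U d)
    {i j : Fin N} (hi : (i : ℕ) < n) (hj : n ≤ (j : ℕ)) (hij : ¬ ((i : ℕ) = n - 1 ∧ (j : ℕ) = n)) :
    d i ≠ d j := by
  intro heq
  set i1 : Fin N := ⟨n - 1, by omega⟩
  set i2 : Fin N := ⟨n, hnN⟩
  have e1 : d i1 = eig (G p₀) n := by
    rw [hU.eig_eq]
    simp [i1, Nat.sub_add_cancel hn]
  have e2 : d i2 = eig (G p₀) n := by
    rw [hU.eig_eq]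
    exact h.cross.symm
  have hm := hU.2.1
  have h1 : d i ≤ d i1 := hm (by simp [i1, Fin.le_def]; omega)
  have h2 : d i2 ≤ d j := hm (by simp [i2, Fin.le_def]; omega)
  have h12 : i1 ≠ i2 := by simp [i1, i2, Fin.ext_iff]; omega
  obtain ⟨k, hk1, hk2, hk⟩ : ∃ k, k ≠ i1 ∧ k ≠ i2 ∧ d k = eig (G p₀) n := by
    by_cases hc : (i : ℕ) = n - 1
    · have hjn : (j : ℕ) ≠ n := fun hjn => hij ⟨hc, hjn⟩
      exact ⟨j, by simp [i1, Fin.ext_iff]; omega, by simp [i2, Fin.ext_iff]; omega, by linarith⟩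
    · exact ⟨i, by simp [i1, Fin.ext_iff]; omega, by simp [i2, Fin.ext_iff]; omega, by linarith⟩
  have := hU.card_le_finrank (eig (G p₀) n) {k, i1, i2} (by
    intro x hx
    simp only [Finset.mem_insert, Finset.mem_singleton] at hx
    rcases hx with rfl | rfl | rfl <;> assumption)
  rw [h.mult, Finset.card_eq_three.2 ⟨k, i1, i2, hk1, hk2, h12, rfl⟩] at this
  omega

lemma eventually_gap_ray (h : ConicalAt n G p₀ f A S ℓ ℓ') {η : Fin 3 → ℝ} (hη : η ≠ 0) :
    ∀ᶠ r in 𝓝[>] (0 : ℝ), eig (G (p₀ + r • η)) n < eig (G (p₀ + r • η)) (n + 1) := by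
  obtain ⟨c, hc, hgap⟩ := h.exists_gap_ge
  have hray : Tendsto (fun r : ℝ => r • η) (𝓝[>] 0) (𝓝 0) := by
    have : Tendsto (fun r : ℝ => r • η) (𝓝 0) (𝓝 ((0 : ℝ) • η)) :=
      (continuous_id.smul continuous_const).tendsto 0
    rw [zero_smul] at this
    exact this.mono_left nhdsWithin_le_nhds
  filter_upwards [hray.eventually hgap, self_mem_nhdsWithin] with r hr hr0
  have hr0 : 0 < r := hr0
  have : 0 < c * ‖r • η‖ := mul_pos hc (norm_pos_iff.2 (smul_ne_zero hr0.ne' hη))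
  linarith

/-- In the sum over pairs, `r²` kills every term whose gap stays open at `p₀`. For the touching pair
the gap divided by `r` tends to `-2ρ`, and the numerator `-2iκ/ρ` over `4ρ²` gives `-(i/2)κ/ρ³`. -/
lemma tendsto_berryForm (h : ConicalAt n G p₀ f A S ℓ ℓ') (hn : 1 ≤ n) (hnN : n < N)
    (hG : ContDiff ℝ ∞ fun p => (G p).1) {η : Fin 3 → ℝ} (hη : η ≠ 0) :
    euclNorm (S *ᵥ η) = euclNorm (A *ᵥ η) ∧ ∀ a b : Fin 3,
    Tendsto (fun r : ℝ => (r : ℂ) ^ 2 * berryForm (fun p => lowProj n (G p)) a b (p₀ + r • η))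
      (𝓝[>] 0) (𝓝 (-(Complex.I / 2) * (((A *ᵥ η) ⬝ᵥ
        crossProduct (A *ᵥ Pi.single a 1) (A *ᵥ Pi.single b 1) : ℝ) : ℂ) /
          ((euclNorm (S *ᵥ η) : ℝ) : ℂ) ^ 3)) := by
  have hray : Tendsto (fun r : ℝ => p₀ + r • η) (𝓝[>] 0) (𝓝 p₀) := by
    have : Tendsto (fun r : ℝ => p₀ + r • η) (𝓝 0) (𝓝 (p₀ + (0 : ℝ) • η)) :=
      (continuous_const.add (continuous_id.smul continuous_const)).tendsto 0
    rw [zero_smul, add_zero] at this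
    exact this.mono_left nhdsWithin_le_nhds
  have hsub : ∀ ns : ℕ → ℝ, Tendsto ns atTop (𝓝[>] 0) → ∃ (φ : ℕ → ℕ)
      (U : ℕ → Matrix (Fin N) (Fin N) ℂ) (U₀ : Matrix (Fin N) (Fin N) ℂ) (d₀ : Fin N → ℝ),
      StrictMono φ ∧ (∀ m, SortedDiag (G (p₀ + ns (φ m) • η)).1 (U m)
        fun i : Fin N => eig (G (p₀ + ns (φ m) • η)) (i + 1)) ∧
      Tendsto U atTop (𝓝 U₀) ∧ SortedDiag (G p₀).1 U₀ d₀ := by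
    intro ns hns
    choose U hU using fun m => exists_sortedDiag (G (p₀ + ns m • η))
    obtain ⟨U₀, d₀, φ, hφ, hU₀, hd, h0⟩ := SortedDiag.exists_subseq hU
      ((hG.continuous.tendsto p₀).comp (hray.comp hns))
    exact ⟨φ, U ∘ φ, U₀, d₀, hφ, fun m => hU (φ m), hU₀, h0⟩
  constructor
  · obtain ⟨ns, hns⟩ := exists_seq_tendsto (𝓝[>] (0 : ℝ))
    obtain ⟨φ, U, U₀, d₀, hφ, hU, hlim, hU₀⟩ := hsub ns hns
    exact (h.limit_values hn hnN hG hη hU₀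
      (h.limit_block hn hnN hG (hns.comp hφ.tendsto_atTop) hU hU₀ hlim)).1
  intro a b
  refine tendsto_of_subseq_tendsto fun ns hns => ?_
  obtain ⟨φ, U, U₀, d₀, hφ, hU, hlim, hU₀⟩ := hsub ns hns
  refine ⟨φ, ?_⟩
  have hr := hns.comp hφ.tendsto_atTop
  have hval := (h.limit_values hn hnN hG hη hU₀ (h.limit_block hn hnN hG hr hU hU₀ hlim)).2 a b
  set ρ := euclNorm (S *ᵥ η) with hρ
  have hρ0 : ρ ≠ 0 := by
    refine (euclNorm_pos ?_).ne'
    intro h0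
    exact hη (Matrix.mulVec_injective_of_isUnit h.unit (by rw [h0, Matrix.mulVec_zero]))
  set i1 : Fin N := ⟨n - 1, by omega⟩ with hi1
  set i2 : Fin N := ⟨n, hnN⟩ with hi2
  set κ := (A *ᵥ η) ⬝ᵥ crossProduct (A *ᵥ Pi.single a 1) (A *ᵥ Pi.single b 1)
  set L : ℂ := -(Complex.I / 2) * (κ : ℂ) / (ρ : ℂ) ^ 3 with hL
  set r := ns ∘ φ with hrdef
  set B : Fin 3 → ℕ → Matrix (Fin N) (Fin N) ℂ := fun c m =>
    (U m)ᴴ * dirDeriv (fun q => (G q).1) c (p₀ + r m • η) * U m with hB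
  set B₀ : Fin 3 → Matrix (Fin N) (Fin N) ℂ := fun c =>
    U₀ᴴ * dirDeriv (fun q => (G q).1) c p₀ * U₀ with hB₀
  have hBt : ∀ c i j, Tendsto (fun m => B c m i j) atTop (𝓝 (B₀ c i j)) := by
    intro c i j
    refine Matrix.tendsto_elem (Matrix.tendsto_mul (Matrix.tendsto_mul
      (Matrix.tendsto_conjTranspose hlim) ?_) hlim) i j
    exact ((continuous_dirDeriv hG c).tendsto p₀).comp (hray.comp hr)
  have hr0 : Tendsto (fun m => (r m : ℂ)) atTop (𝓝 0) := by
    have := (Complex.continuous_ofReal.tendsto 0).comp (hr.mono_right nhdsWithin_le_nhds)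
    simpa [Function.comp_def] using this
  have hrpos : ∀ᶠ m in atTop, 0 < r m := hr.eventually self_mem_nhdsWithin
  set d : ℕ → Fin N → ℝ := fun m i => eig (G (p₀ + r m • η)) (i + 1) with hd
  have hdt : ∀ i, Tendsto (fun m => (d m i : ℂ)) atTop (𝓝 (d₀ i)) := by
    intro i
    rw [hU₀.eig_eq]
    exact (Complex.continuous_ofReal.tendsto _).comp ((tendsto_eig hG.continuous.continuousAt
      ((i : ℕ) + 1)).comp (hray.comp hr))
  -- The limit is spread over a double sum with one nonzero entry so that convergence can be checked
  -- pair by pair.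
  have hsum : L = ∑ i : Fin N, ∑ j : Fin N, if i = i1 ∧ j = i2 then L else 0 := by
    rw [Finset.sum_eq_single i1, Finset.sum_eq_single i2]
    · simp
    · intro j _ hj
      simp [hj]
    · simp
    · intro i _ hi
      simp [hi]
    · simp
  rw [hsum]
  have hterms : ∀ i j : Fin N, Tendsto (fun m => if (i : ℕ) < n ∧ n ≤ (j : ℕ) then
      (r m : ℂ) ^ 2 * ((B a m i j * B b m j i - B b m i j * B a m j i) /
        ((d m i : ℂ) - d m j) ^ 2) else 0) atTop (𝓝 (if i = i1 ∧ j = i2 then L else 0)) := by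
    intro i j
    by_cases hc : (i : ℕ) < n ∧ n ≤ (j : ℕ)
    swap
    · have : ¬ (i = i1 ∧ j = i2) := by
        rintro ⟨rfl, rfl⟩
        exact hc ⟨by simp [hi1]; omega, by simp [hi2]⟩
      simp only [hc, this, if_false]
      exact tendsto_const_nhds
    simp only [hc, and_self, if_true]
    have hnum := ((hBt a i j).mul (hBt b j i)).sub ((hBt b i j).mul (hBt a j i))
    by_cases hij : i = i1 ∧ j = i2
    · obtain ⟨rfl, rfl⟩ := hij
      simp only [and_self, if_true]
      have hdd : Tendsto (fun m => (((d m i1 - d m i2) / r m : ℝ) : ℂ)) atTop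
          (𝓝 ((-(2 * ρ) : ℝ) : ℂ)) := by
        refine (Complex.continuous_ofReal.tendsto _).comp ?_
        have := ((h.tendsto_eig_div η).1.sub (h.tendsto_eig_div η).2).comp hr
        have e : ℓ η - euclNorm (S *ᵥ η) - (ℓ η + euclNorm (S *ᵥ η)) = -(2 * ρ) := by
          rw [hρ]; ring
        rw [e] at this
        refine this.congr fun m => ?_
        simp only [Function.comp_apply, hd, hi1, hi2, Nat.sub_add_cancel hn, hrdef]
        ring
      have hne : (((-(2 * ρ) : ℝ) : ℂ)) ^ 2 ≠ 0 :=
        pow_ne_zero _ (Complex.ofReal_ne_zero.2 (by simpa using hρ0))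
      have hlimit := hnum.div (hdd.pow 2) hne
      have hLv : (B₀ a i1 i2 * B₀ b i2 i1 - B₀ b i1 i2 * B₀ a i2 i1) / ((-(2 * ρ) : ℝ) : ℂ) ^ 2 =
          L := by
        rw [hB₀]
        simp only
        rw [hval, hL]
        have : (ρ : ℂ) ≠ 0 := Complex.ofReal_ne_zero.2 hρ0
        push_cast
        field_simp
      rw [hLv] at hlimit
      refine hlimit.congr' ?_
      filter_upwards [hrpos] with m hm
      have hm' : (r m : ℂ) ≠ 0 := Complex.ofReal_ne_zero.2 hm.ne'
      change (B a m i1 i2 * B b m i2 i1 - B b m i1 i2 * B a m i2 i1) /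
        (((d m i1 - d m i2) / r m : ℝ) : ℂ) ^ 2 = _
      push_cast
      rw [div_pow, div_div_eq_mul_div]
      ring
    · have hne := h.eig_ne hn hnN hU₀ hc.1 hc.2 (by
        rintro ⟨h1, h2⟩
        exact hij ⟨Fin.ext h1, Fin.ext h2⟩)
      have hne' : ((d₀ i : ℂ) - d₀ j) ^ 2 ≠ 0 :=
        pow_ne_zero _ (sub_ne_zero.2 fun h' => hne (Complex.ofReal_injective h'))
      have := (hr0.pow 2).mul (hnum.div (((hdt i).sub (hdt j)).pow 2) hne')
      simpa [hij] using this
  refine (tendsto_finsetSum _ fun i _ => tendsto_finsetSum _ fun j _ => hterms i j).congr' ?_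
  filter_upwards [hr.eventually (h.eventually_gap_ray hη)] with m hm
  have hform := berryForm_lowProj_eq (hG.contDiffAt (x := p₀ + r m • η)) hnN hm (hU m) a b
  change _ = (r m : ℂ) ^ 2 * berryForm (fun p => lowProj n (G p)) a b (p₀ + r m • η)
  rw [hform, Finset.mul_sum]
  refine Finset.sum_congr rfl fun i _ => ?_
  rw [Finset.mul_sum]
  refine Finset.sum_congr rfl fun j _ => ?_
  rw [mul_ite, mul_zero]
  rfl

/-- This is the uniform bound for dominated convergence: unitary entries are at most `1`, so the
numerators are bounded, and every denominator is at least `(c‖ε‖)²`. -/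
lemma exists_berryForm_le (h : ConicalAt n G p₀ f A S ℓ ℓ') (hnN : n < N)
    (hG : ContDiff ℝ ∞ fun p => (G p).1) :
    ∃ C, ∀ᶠ ε in 𝓝 (0 : Fin 3 → ℝ), ∀ a b,
      ‖ε‖ ^ 2 * ‖berryForm (fun p => lowProj n (G p)) a b (p₀ + ε)‖ ≤ C := by
  obtain ⟨c, hc, hgap⟩ := h.exists_gap_ge
  set b₀ : ℝ := ∑ a, ∑ k, ∑ l, ‖dirDeriv (fun q => (G q).1) a p₀ k l‖ with hb₀
  have hcont : Continuous fun p => ∑ a, ∑ k, ∑ l, ‖dirDeriv (fun q => (G q).1) a p k l‖ :=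
    continuous_finsetSum _ fun a _ => continuous_finsetSum _ fun k _ =>
      continuous_finsetSum _ fun l _ => ((continuous_dirDeriv hG a).matrix_elem k l).norm
  have hbd : ∀ᶠ ε in 𝓝 (0 : Fin 3 → ℝ),
      ∑ a, ∑ k, ∑ l, ‖dirDeriv (fun q => (G q).1) a (p₀ + ε) k l‖ < b₀ + 1 := by
    have ht : Tendsto (fun ε : Fin 3 → ℝ => p₀ + ε) (𝓝 0) (𝓝 p₀) := by
      have := (continuous_const_add p₀).tendsto (0 : Fin 3 → ℝ)
      rwa [add_zero] at this
    exact ((hcont.tendsto p₀).comp ht).eventually (gt_mem_nhds (by rw [← hb₀]; linarith))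
  refine ⟨∑ i : Fin N, ∑ j : Fin N, 2 * (b₀ + 1) ^ 2 / c ^ 2, ?_⟩
  have hb₀' : 0 ≤ b₀ := by positivity
  filter_upwards [hgap, hbd] with ε hε hb a b
  by_cases hε0 : ε = 0
  · rw [hε0, norm_zero, zero_pow two_ne_zero, zero_mul]
    positivity
  have hεpos : 0 < ‖ε‖ := norm_pos_iff.2 hε0
  have hg : eig (G (p₀ + ε)) n < eig (G (p₀ + ε)) (n + 1) := by
    have : 0 < c * ‖ε‖ := by positivity
    linarith
  obtain ⟨U, hU⟩ := exists_sortedDiag (G (p₀ + ε))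
  rw [berryForm_lowProj_eq (hG.contDiffAt (x := p₀ + ε)) hnN hg hU]
  have hent : ∀ e i j, ‖(Uᴴ * dirDeriv (fun q => (G q).1) e (p₀ + ε) * U) i j‖ ≤ b₀ + 1 := by
    intro e i j
    refine le_trans ?_ hb.le
    refine le_trans ?_ (Finset.single_le_sum (f := fun a => ∑ k, ∑ l,
      ‖dirDeriv (fun q => (G q).1) a (p₀ + ε) k l‖) (fun a _ => by positivity) (Finset.mem_univ e))
    rw [Matrix.mul_apply]
    simp only [Matrix.mul_apply, Finset.sum_mul]
    rw [Finset.sum_comm]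
    refine (norm_sum_le _ _).trans (Finset.sum_le_sum fun k _ => (norm_sum_le _ _).trans
      (Finset.sum_le_sum fun l _ => ?_))
    rw [norm_mul, norm_mul, Matrix.conjTranspose_apply, norm_star]
    have h1 := entry_norm_bound_of_unitary hU.1 k i
    have h2 := entry_norm_bound_of_unitary hU.1 l j
    calc _ ≤ 1 * ‖dirDeriv (fun q => (G q).1) e (p₀ + ε) k l‖ * 1 := by gcongr
      _ = _ := by ring
  rw [← le_div_iff₀' (by positivity)]
  refine (norm_sum_le _ _).trans ?_
  rw [Finset.sum_div]
  refine Finset.sum_le_sum fun i _ => (norm_sum_le _ _).trans ?_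
  rw [Finset.sum_div]
  refine Finset.sum_le_sum fun j _ => ?_
  split_ifs with hij
  swap
  · rw [norm_zero]
    positivity
  have hmono := hU.2.1
  have hsep : c * ‖ε‖ ≤ ‖((eig (G (p₀ + ε)) (i + 1) : ℝ) : ℂ) - (eig (G (p₀ + ε)) (j + 1) : ℝ)‖ := by
    rw [← Complex.ofReal_sub, Complex.norm_real, Real.norm_eq_abs, abs_sub_comm]
    refine hε.trans (le_trans ?_ (le_abs_self _))
    have h1 := @hmono i ⟨n - 1, by omega⟩ (by simp [Fin.le_def]; omega)
    have h2 := @hmono ⟨n, hnN⟩ j (by simp [Fin.le_def]; omega)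
    simp only [Nat.sub_add_cancel (show 1 ≤ n by omega)] at h1 h2
    linarith
  rw [norm_div, norm_pow, div_div]
  have hden : c ^ 2 * ‖ε‖ ^ 2 ≤
      ‖((eig (G (p₀ + ε)) (i + 1) : ℝ) : ℂ) - (eig (G (p₀ + ε)) (j + 1) : ℝ)‖ ^ 2 := by
    rw [← mul_pow]
    gcongr
  refine div_le_div₀ (by positivity) ?_ (by positivity) hden
  refine (norm_sub_le _ _).trans ?_
  rw [norm_mul, norm_mul]
  have := hent a i j
  have := hent b j i
  have := hent b i j
  have := hent a j i
  calc _ ≤ (b₀ + 1) * (b₀ + 1) + (b₀ + 1) * (b₀ + 1) := by gcongr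
    _ = _ := by ring

end ConicalAt
end

/-! ### Cutoff functions and the radial integral -/

open MeasureTheory in
lemma integral_toLp_comp {E : Type*} [NormedAddCommGroup E] [NormedSpace ℝ E]
    (g : EuclideanSpace ℝ (Fin 3) → E) :
    ∫ u : Fin 3 → ℝ, g (WithLp.toLp 2 u) = ∫ v, g v :=
  (PiLp.volume_preserving_toLp (Fin 3)).integral_comp
    (MeasurableEquiv.toLp 2 (Fin 3 → ℝ)).measurableEmbedding g

/-- A smooth cutoff function on the line: `1` for `t ≤ 1` and `0` for `4 ≤ t`. -/
noncomputable def cutoff (t : ℝ) : ℝ := 1 - Real.smoothTransition ((t - 1) / 3)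

lemma contDiff_cutoff : ContDiff ℝ ∞ cutoff :=
  contDiff_const.sub (Real.smoothTransition.contDiff.comp
    ((contDiff_id.sub contDiff_const).div_const 3))

lemma cutoff_of_le {t : ℝ} (h : t ≤ 1) : cutoff t = 1 := by
  rw [cutoff, Real.smoothTransition.zero_of_nonpos (by linarith), sub_zero]

lemma cutoff_of_ge {t : ℝ} (h : 4 ≤ t) : cutoff t = 0 := by
  rw [cutoff, Real.smoothTransition.one_of_one_le (by linarith), sub_self]

lemma continuous_deriv_cutoff : Continuous (deriv cutoff) :=
  contDiff_cutoff.continuous_deriv (by simp)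

lemma hasDerivAt_cutoff (t : ℝ) : HasDerivAt cutoff (deriv cutoff t) t :=
  (contDiff_cutoff.differentiable (by simp) t).hasDerivAt

lemma deriv_cutoff_of_lt {t : ℝ} (h : t < 1) : deriv cutoff t = 0 := by
  have : cutoff =ᶠ[𝓝 t] fun _ => 1 := by
    filter_upwards [gt_mem_nhds h] with s hs using cutoff_of_le hs.le
  rw [this.deriv_eq, deriv_const]

lemma deriv_cutoff_of_gt {t : ℝ} (h : 4 < t) : deriv cutoff t = 0 := by
  have : cutoff =ᶠ[𝓝 t] fun _ => 0 := by
    filter_upwards [lt_mem_nhds h] with s hs using cutoff_of_ge hs.le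
  rw [this.deriv_eq, deriv_const]

open MeasureTheory in
-- The integrand is the derivative of `cutoff (ρ²) / 2`, which falls from `1/2` to `0`.
lemma integral_radial_cutoff :
    ∫ ρ in Ioi (0 : ℝ), ρ ^ 2 • (deriv cutoff (ρ ^ 2) / ρ) = -1 / 2 := by
  have hder : ∀ ρ : ℝ, HasDerivAt (fun ρ => cutoff (ρ ^ 2) / 2) (ρ * deriv cutoff (ρ ^ 2)) ρ := by
    intro ρ
    have := ((hasDerivAt_cutoff (ρ ^ 2)).comp ρ ((hasDerivAt_id ρ).pow 2)).div_const 2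
    convert! this using 1
    simp
    ring
  have hcont : Continuous fun ρ : ℝ => ρ * deriv cutoff (ρ ^ 2) :=
    continuous_id.mul (continuous_deriv_cutoff.comp (continuous_id.pow 2))
  have hsupp : HasCompactSupport fun ρ : ℝ => ρ * deriv cutoff (ρ ^ 2) := by
    refine HasCompactSupport.intro (isCompact_Icc (a := (-2 : ℝ)) (b := 2)) fun ρ hρ => ?_
    rw [deriv_cutoff_of_gt, mul_zero]
    rw [mem_Icc, ← abs_le, not_le] at hρ
    rw [← sq_abs]
    nlinarith
  have h1 := integral_Ioi_of_hasDerivAt_of_tendsto' (a := 0) (m := 0) (fun ρ _ => hder ρ)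
    (hcont.integrable_of_hasCompactSupport hsupp).integrableOn (by
      refine tendsto_const_nhds.congr' ?_
      filter_upwards [eventually_ge_atTop (2 : ℝ)] with ρ hρ
      rw [cutoff_of_ge (by nlinarith), zero_div])
  rw [cutoff_of_le (by norm_num)] at h1
  rw [show (-1 : ℝ) / 2 = 0 - 1 / 2 by norm_num, ← h1]
  refine setIntegral_congr_fun measurableSet_Ioi fun ρ hρ => ?_
  have : ρ ≠ 0 := ne_of_gt hρ
  simp only [smul_eq_mul]
  field_simp

open MeasureTheory in
-- In polar coordinates this is the area `4π` of the unit sphere, obtained as `3` times the ball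
-- volume `4π/3`, times the radial integral `-1/2`.
lemma integral_cutoff_div_norm :
    ∫ u : Fin 3 → ℝ, deriv cutoff (u ⬝ᵥ u) / euclNorm u = -(2 * π) := by
  have h1 : (fun u : Fin 3 → ℝ => deriv cutoff (u ⬝ᵥ u) / euclNorm u) =
      fun u => (fun v : EuclideanSpace ℝ (Fin 3) => deriv cutoff (‖v‖ ^ 2) / ‖v‖)
        (WithLp.toLp 2 u) := by
    ext u
    rw [← euclNorm_sq]
    rfl
  rw [h1, integral_toLp_comp (fun v : EuclideanSpace ℝ (Fin 3) => deriv cutoff (‖v‖ ^ 2) / ‖v‖),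
    integral_fun_norm_addHaar volume (fun ρ => deriv cutoff (ρ ^ 2) / ρ)]
  rw [finrank_euclideanSpace_fin, integral_radial_cutoff, Measure.real,
    EuclideanSpace.volume_ball_fin_three]
  simp only [ENNReal.ofReal_one, one_pow, one_mul, smul_eq_mul, nsmul_eq_mul]
  rw [ENNReal.toReal_ofReal (by positivity)]
  push_cast
  ring

/-- The partial derivatives of the cutoff function `p ↦ cutoff (|A (p - p₀)|² / r²)`. -/
noncomputable def cutGrad (A : Matrix (Fin 3) (Fin 3) ℝ) (p₀ : Fin 3 → ℝ) (r : ℝ) (c : Fin 3)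
    (p : Fin 3 → ℝ) : ℝ :=
  deriv cutoff ((A *ᵥ (p - p₀)) ⬝ᵥ (A *ᵥ (p - p₀)) / r ^ 2) *
    (2 * ((A *ᵥ (p - p₀)) ⬝ᵥ (A *ᵥ Pi.single c 1)) / r ^ 2)

lemma continuous_quad (A : Matrix (Fin 3) (Fin 3) ℝ) (p₀ : Fin 3 → ℝ) :
    Continuous fun p : Fin 3 → ℝ => (A *ᵥ (p - p₀)) ⬝ᵥ (A *ᵥ (p - p₀)) := by
  have h : Continuous fun p : Fin 3 → ℝ => A *ᵥ (p - p₀) :=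
    continuous_const.matrix_mulVec (continuous_id.sub continuous_const)
  exact h.dotProduct h

lemma continuous_cutGrad (A : Matrix (Fin 3) (Fin 3) ℝ) (p₀ : Fin 3 → ℝ) (r : ℝ) (c : Fin 3) :
    Continuous (cutGrad A p₀ r c) := by
  have h : Continuous fun p : Fin 3 → ℝ => A *ᵥ (p - p₀) :=
    continuous_const.matrix_mulVec (continuous_id.sub continuous_const)
  exact (continuous_deriv_cutoff.comp ((continuous_quad A p₀).div_const _)).mul
    ((continuous_const.mul (h.dotProduct continuous_const)).div_const _)

lemma hasFDerivAt_cutoff_quad (A : Matrix (Fin 3) (Fin 3) ℝ) (p₀ : Fin 3 → ℝ) (r : ℝ)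
    (p : Fin 3 → ℝ) : ∃ L : (Fin 3 → ℝ) →L[ℝ] ℝ,
      HasFDerivAt (fun p => cutoff ((A *ᵥ (p - p₀)) ⬝ᵥ (A *ᵥ (p - p₀)) / r ^ 2)) L p ∧
      ∀ c, L (Pi.single c 1) = cutGrad A p₀ r c p := by
  have hlin : ∀ i, HasFDerivAt (fun p : Fin 3 → ℝ => (A *ᵥ (p - p₀)) i)
      ((LinearMap.toContinuousLinearMap ((LinearMap.proj i).comp (Matrix.toLin' A)))) p := by
    intro i
    have h1 := ((LinearMap.toContinuousLinearMap ((LinearMap.proj i).comp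
      (Matrix.toLin' A))).hasFDerivAt (x := p - p₀)).comp p ((hasFDerivAt_id p).sub_const p₀)
    exact h1
  have hq := HasFDerivAt.fun_sum (u := Finset.univ) fun i _ => (hlin i).mul (hlin i)
  have hq2 := hq.mul_const (r ^ 2)⁻¹
  have hc := (hasDerivAt_cutoff ((A *ᵥ (p - p₀)) ⬝ᵥ (A *ᵥ (p - p₀)) / r ^ 2)).comp_hasFDerivAt p
    (f := fun p => (A *ᵥ (p - p₀)) ⬝ᵥ (A *ᵥ (p - p₀)) / r ^ 2) (by
      simpa only [dotProduct, div_eq_mul_inv] using! hq2)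
  refine ⟨_, hc, fun c => ?_⟩
  simp only [cutGrad, dotProduct, smul_apply, sum_apply, add_apply, smul_eq_mul, LinearMap.coe_toContinuousLinearMap',
    LinearMap.comp_apply, LinearMap.proj_apply, Matrix.toLin'_apply]
  congr 1
  simp only [Fin.sum_univ_three]
  ring

/-- The pairing of the gradient of the cutoff function around `p₀` with the Berry field. -/
noncomputable def fluxDensity {N : ℕ} (P : (Fin 3 → ℝ) → Matrix (Fin N) (Fin N) ℂ)
    (A : Matrix (Fin 3) (Fin 3) ℝ) (p₀ : Fin 3 → ℝ) (r : ℝ) (p : Fin 3 → ℝ) : ℂ :=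
  ∑ c, (cutGrad A p₀ r c p : ℂ) * berryField P p c

lemma fluxDensity_eq_zero {N : ℕ} (P : (Fin 3 → ℝ) → Matrix (Fin N) (Fin N) ℂ)
    {A : Matrix (Fin 3) (Fin 3) ℝ} {p₀ : Fin 3 → ℝ} {r : ℝ} {p : Fin 3 → ℝ}
    (h : (A *ᵥ (p - p₀)) ⬝ᵥ (A *ᵥ (p - p₀)) / r ^ 2 < 1 ∨
      4 < (A *ᵥ (p - p₀)) ⬝ᵥ (A *ᵥ (p - p₀)) / r ^ 2) : fluxDensity P A p₀ r p = 0 := by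
  have : deriv cutoff ((A *ᵥ (p - p₀)) ⬝ᵥ (A *ᵥ (p - p₀)) / r ^ 2) = 0 :=
    h.elim deriv_cutoff_of_lt deriv_cutoff_of_gt
  simp [fluxDensity, cutGrad, this]

/-! ### Flux through a small ellipsoidal shell around a crossing -/

section
open scoped Matrix.Norms.Operator
namespace ConicalAt
variable {N n : ℕ} {G : (Fin 3 → ℝ) → Herm N} {p₀ : Fin 3 → ℝ}
  {f : Fin 2 → EuclideanSpace ℂ (Fin N)} {A S : Matrix (Fin 3) (Fin 3) ℝ}
  {ℓ ℓ' : (Fin 3 → ℝ) →ₗ[ℝ] ℝ}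

/-- A kernel vector of `A` would be a kernel vector of `S`, since `‖Sη‖ = ‖Aη‖`. -/
lemma isUnit_linearization (h : ConicalAt n G p₀ f A S ℓ ℓ') (hn : 1 ≤ n) (hnN : n < N)
    (hG : ContDiff ℝ ∞ fun p => (G p).1) : IsUnit A := by
  rw [← Matrix.mulVec_injective_iff_isUnit]
  have : Function.Injective (Matrix.toLin' A) := by
    rw [← LinearMap.ker_eq_bot, LinearMap.ker_eq_bot']
    intro η hη
    by_contra h0
    have h1 := (h.tendsto_berryForm hn hnN hG h0).1
    rw [Matrix.toLin'_apply] at hη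
    rw [hη] at h1
    have h2 : S *ᵥ η ≠ 0 := fun h3 =>
      h0 (Matrix.mulVec_injective_of_isUnit h.unit (by rw [h3, Matrix.mulVec_zero]))
    have h3 := euclNorm_pos h2
    rw [h1, euclNorm, WithLp.toLp_zero, norm_zero] at h3
    exact lt_irrefl _ h3
  exact this

/-- The Berry field is smooth in a punctured neighbourhood of the crossing. -/
lemma eventually_gap (h : ConicalAt n G p₀ f A S ℓ ℓ') :
    ∃ δ > 0, ∀ p, p ≠ p₀ → dist p p₀ < δ → eig (G p) n < eig (G p) (n + 1) := by
  obtain ⟨c, hc, hgap⟩ := h.exists_gap_ge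
  obtain ⟨δ, hδ, hball⟩ := Metric.eventually_nhds_iff.1 hgap
  refine ⟨δ, hδ, fun p hp hd => ?_⟩
  have := hball (y := p - p₀) (by rwa [dist_zero_right, ← dist_eq_norm])
  rw [add_sub_cancel] at this
  have h2 : 0 < c * ‖p - p₀‖ := mul_pos hc (norm_pos_iff.2 (sub_ne_zero.2 hp))
  linarith

/-- For small `r` the shell lies in the punctured neighbourhood where the gap is open; off the shell
the density is locally zero, whatever the Berry field does. -/
lemma eventually_continuous_fluxDensity (h : ConicalAt n G p₀ f A S ℓ ℓ') (hn : 1 ≤ n) (hnN : n < N)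
    (hG : ContDiff ℝ ∞ fun p => (G p).1) :
    ∀ᶠ r in 𝓝[>] (0 : ℝ), Continuous (fluxDensity (fun p => lowProj n (G p)) A p₀ r) := by
  obtain ⟨δ, hδ, hgap⟩ := h.eventually_gap
  obtain ⟨c, hc, hA⟩ := exists_euclNorm_ge (h.isUnit_linearization hn hnN hG)
  have hsmall : ∀ᶠ r in 𝓝[>] (0 : ℝ), r < c * δ / 2 :=
    (gt_mem_nhds (by positivity)).filter_mono nhdsWithin_le_nhds
  filter_upwards [hsmall, self_mem_nhdsWithin] with r hr hr0
  have hr0 : 0 < r := hr0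
  rw [continuous_iff_continuousAt]
  intro p
  have hq : Continuous fun p => (A *ᵥ (p - p₀)) ⬝ᵥ (A *ᵥ (p - p₀)) / r ^ 2 :=
    (continuous_quad A p₀).div_const _
  have hzero : ((A *ᵥ (p - p₀)) ⬝ᵥ (A *ᵥ (p - p₀)) / r ^ 2 < 1 ∨
      4 < (A *ᵥ (p - p₀)) ⬝ᵥ (A *ᵥ (p - p₀)) / r ^ 2) →
      ContinuousAt (fluxDensity (fun p => lowProj n (G p)) A p₀ r) p := by
    intro hp
    have : ∀ᶠ q in 𝓝 p, fluxDensity (fun p => lowProj n (G p)) A p₀ r q = 0 := by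
      rcases hp with hp | hp
      · filter_upwards [hq.continuousAt.eventually_lt_const hp] with q hq
          using fluxDensity_eq_zero _ (Or.inl hq)
      · filter_upwards [hq.continuousAt.eventually_const_lt hp] with q hq
          using fluxDensity_eq_zero _ (Or.inr hq)
    exact (continuousAt_const (y := (0 : ℂ))).congr (this.mono fun q hq => hq.symm)
  by_cases h1 : (A *ᵥ (p - p₀)) ⬝ᵥ (A *ᵥ (p - p₀)) / r ^ 2 < 1
  · exact hzero (Or.inl h1)
  by_cases h4 : 4 < (A *ᵥ (p - p₀)) ⬝ᵥ (A *ᵥ (p - p₀)) / r ^ 2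
  · exact hzero (Or.inr h4)
  push Not at h1 h4
  rw [← euclNorm_sq, ← div_pow] at h1 h4
  have hnn : 0 ≤ euclNorm (A *ᵥ (p - p₀)) / r := div_nonneg (euclNorm_nonneg _) hr0.le
  have h4' : euclNorm (A *ᵥ (p - p₀)) ≤ 2 * r := by
    rw [← div_le_iff₀ hr0]
    nlinarith
  have hne : p ≠ p₀ := by
    rintro rfl
    rw [sub_self, Matrix.mulVec_zero, euclNorm, WithLp.toLp_zero, norm_zero, zero_div] at h1
    norm_num at h1
  have hdist : dist p p₀ < δ := by
    rw [dist_eq_norm]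
    have := hA (p - p₀)
    by_contra hcon
    push Not at hcon
    nlinarith [mul_le_mul_of_nonneg_left hcon hc.le]
  have hX := (contDiffAt_berryField (contDiffAt_lowProj hG.contDiffAt hnN
    (hgap p hne hdist))).continuousAt
  exact tendsto_finsetSum _ fun c _ => ((Complex.continuous_ofReal.comp
    (continuous_cutGrad A p₀ r c)).continuousAt).mul (continuousAt_pi.1 hX c)

end ConicalAt
end

/-- The triple product with `Aη = ∑ η_b A e_b` retains only `b = c` and equals `η_c det A`; summing
against `Aη · A e_c` restores `‖Aη‖²`. -/
lemma sum_dot_cross (A : Matrix (Fin 3) (Fin 3) ℝ) (η : Fin 3 → ℝ) :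
    ∑ c : Fin 3, ((A *ᵥ η) ⬝ᵥ (A *ᵥ Pi.single c 1)) *
      ((A *ᵥ η) ⬝ᵥ crossProduct (A *ᵥ Pi.single (c + 1) 1) (A *ᵥ Pi.single (c + 2) 1)) =
      A.det * ((A *ᵥ η) ⬝ᵥ (A *ᵥ η)) := by
  have h : ∀ c : Fin 3, (A *ᵥ η) ⬝ᵥ crossProduct (A *ᵥ Pi.single (c + 1) 1)
      (A *ᵥ Pi.single (c + 2) 1) = η c * A.det := by
    intro c
    fin_cases c <;>
      simp [cross_apply, Matrix.det_fin_three, Matrix.mulVec, dotProduct, Fin.sum_univ_three,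
        show (2 : Fin 3) + 1 = 0 from rfl, show (2 : Fin 3) + 2 = 1 from rfl,
        show (1 : Fin 3) + 2 = 0 from rfl, show (1 : Fin 3) + 1 = 2 from rfl] <;>
      ring
  have hm : ∀ i, (A *ᵥ η) i = A i 0 * η 0 + A i 1 * η 1 + A i 2 * η 2 := fun i => by
    simp [Matrix.mulVec, dotProduct, Fin.sum_univ_three]
  simp only [h]
  simp only [Matrix.mulVec_single_one]
  generalize A.det = D
  simp only [dotProduct, Fin.sum_univ_three, Matrix.col_apply, hm]
  ring

section
open MeasureTheory
open scoped Matrix.Norms.Operator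

lemma integral_comp_scaled {A : Matrix (Fin 3) (Fin 3) ℝ} (hA : IsUnit A) (p₀ : Fin 3 → ℝ) {r : ℝ}
    (hr : 0 < r) {g : (Fin 3 → ℝ) → ℂ} (hg : Continuous g) :
    ∫ p, g p = ∫ u, ((r ^ 3 / |A.det| : ℝ) : ℂ) * g (p₀ + r • (A⁻¹ *ᵥ u)) := by
  have hdet : A.det ≠ 0 := ((Matrix.isUnit_iff_isUnit_det A).1 hA).ne_zero
  set T : Matrix (Fin 3) (Fin 3) ℝ := r • A⁻¹ with hT
  have hTdet : T.det = r ^ 3 * A.det⁻¹ := by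
    rw [hT, Matrix.det_smul, Matrix.det_nonsing_inv, Fintype.card_fin, Ring.inverse_eq_inv']
  have hTd : T.det ≠ 0 := by
    rw [hTdet]; positivity
  have h1 : ∫ p, g p = ∫ q, g (p₀ + q) := (integral_add_left_eq_self g p₀).symm
  have hg' : Continuous fun q => g (p₀ + q) := hg.comp (continuous_const_add p₀)
  have h2 := Real.map_matrix_volume_pi_eq_smul_volume_pi hTd
  have h3 : ∫ u, g (p₀ + Matrix.toLin' T u) = |T.det⁻¹| • ∫ q, g (p₀ + q) := by
    rw [← integral_map (φ := Matrix.toLin' T) (f := fun q => g (p₀ + q))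
      (LinearMap.continuous_of_finiteDimensional _).aemeasurable hg'.aestronglyMeasurable, h2,
      integral_smul_measure, ENNReal.toReal_ofReal (abs_nonneg _)]
  rw [integral_const_mul, h1]
  have h4 : ∀ u, Matrix.toLin' T u = r • (A⁻¹ *ᵥ u) := fun u => by
    rw [Matrix.toLin'_apply, hT, Matrix.smul_mulVec]
  simp only [h4] at h3
  rw [h3, Complex.real_smul, ← mul_assoc, ← Complex.ofReal_mul]
  have : r ^ 3 / |A.det| * |T.det⁻¹| = 1 := by
    rw [hTdet, abs_inv, abs_mul, abs_inv, abs_of_pos (pow_pos hr 3)]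
    have : |A.det| ≠ 0 := abs_ne_zero.2 hdet
    field_simp
  rw [this, Complex.ofReal_one, one_mul]

/-- Substituting `p = p₀ + r A⁻¹u` makes the shell a fixed round annulus. The Jacobian `r³/|det A|`
times the `1/r` of the cutoff gradient leaves the `r²` that balances the singularity of the Berry
field. In the limit the integrand is radial, `-i sgn(det A) cutoff'(|u|²)/|u|`. -/
lemma ConicalAt.tendsto_integral_fluxDensity {N n : ℕ} {G : (Fin 3 → ℝ) → Herm N} {p₀ : Fin 3 → ℝ}
    {f : Fin 2 → EuclideanSpace ℂ (Fin N)} {A S : Matrix (Fin 3) (Fin 3) ℝ}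
    {ℓ ℓ' : (Fin 3 → ℝ) →ₗ[ℝ] ℝ} (h : ConicalAt n G p₀ f A S ℓ ℓ') (hn : 1 ≤ n) (hnN : n < N)
    (hG : ContDiff ℝ ∞ fun p => (G p).1) :
    Tendsto (fun r => ∫ p, fluxDensity (fun p => lowProj n (G p)) A p₀ r p) (𝓝[>] 0)
      (𝓝 (2 * π * Complex.I * (((SignType.sign A.det : SignType) : ℤ) : ℂ))) := by
  have hA := h.isUnit_linearization hn hnN hG
  have hdet : A.det ≠ 0 := ((Matrix.isUnit_iff_isUnit_det A).1 hA).ne_zero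
  have hAinv : ∀ u, A *ᵥ (A⁻¹ *ᵥ u) = u := fun u => by
    rw [Matrix.mulVec_mulVec, Matrix.mul_nonsing_inv _ ((Matrix.isUnit_iff_isUnit_det A).1 hA),
      Matrix.one_mulVec]
  have hinv0 : ∀ u, u ≠ 0 → A⁻¹ *ᵥ u ≠ 0 := fun u hu h0 => hu (by
    rw [← hAinv u, h0, Matrix.mulVec_zero])
  set X := berryField (fun p => lowProj n (G p)) with hX
  let g : Fin 3 → (Fin 3 → ℝ) → ℝ := fun c u =>
    deriv cutoff (u ⬝ᵥ u) * (2 * (u ⬝ᵥ (A *ᵥ Pi.single c 1))) / |A.det|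
  have hgc : ∀ c, Continuous (g c) := fun c =>
    ((continuous_deriv_cutoff.comp (continuous_id.dotProduct continuous_id)).mul
      (continuous_const.mul (continuous_id.dotProduct continuous_const))).div_const _
  have hpt : ∀ r : ℝ, 0 < r → ∀ u, ((r ^ 3 / |A.det| : ℝ) : ℂ) *
      fluxDensity (fun p => lowProj n (G p)) A p₀ r (p₀ + r • (A⁻¹ *ᵥ u)) =
        ∑ c, (g c u : ℂ) * ((r : ℂ) ^ 2 * X (p₀ + r • (A⁻¹ *ᵥ u)) c) := by
    intro r hr u
    simp only [fluxDensity, Finset.mul_sum]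
    refine Finset.sum_congr rfl fun c _ => ?_
    have hcut : cutGrad A p₀ r c (p₀ + r • (A⁻¹ *ᵥ u)) =
        deriv cutoff (u ⬝ᵥ u) * (2 * (u ⬝ᵥ (A *ᵥ Pi.single c 1)) / r) := by
      rw [cutGrad, add_sub_cancel_left, Matrix.mulVec_smul, hAinv]
      simp only [smul_dotProduct, dotProduct_smul, smul_eq_mul]
      congr 1
      · congr 1
        field_simp
      · field_simp
    rw [hcut, ← hX]
    have : (r : ℂ) ≠ 0 := Complex.ofReal_ne_zero.2 hr.ne'
    have : ((|A.det| : ℝ) : ℂ) ≠ 0 := Complex.ofReal_ne_zero.2 (abs_ne_zero.2 hdet)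
    simp only [g]
    push_cast
    field_simp
  have hscaled : ∀ᶠ r in 𝓝[>] (0 : ℝ),
      ∫ p, fluxDensity (fun p => lowProj n (G p)) A p₀ r p =
        ∫ u, ∑ c, (g c u : ℂ) * ((r : ℂ) ^ 2 * X (p₀ + r • (A⁻¹ *ᵥ u)) c) := by
    filter_upwards [h.eventually_continuous_fluxDensity hn hnN hG, self_mem_nhdsWithin] with r hc hr
    have hr : 0 < r := hr
    rw [integral_comp_scaled hA p₀ hr hc]
    exact integral_congr_ae (Eventually.of_forall (hpt r hr))
  refine Tendsto.congr' (hscaled.mono fun r hr => hr.symm) ?_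
  set ann : Set (Fin 3 → ℝ) := {u | 1 ≤ u ⬝ᵥ u ∧ u ⬝ᵥ u ≤ 4} with hann
  have hdot : Continuous fun u : Fin 3 → ℝ => u ⬝ᵥ u := continuous_id.dotProduct continuous_id
  have hannc : IsCompact ann := by
    refine IsCompact.of_isClosed_subset (isCompact_closedBall (0 : Fin 3 → ℝ) 2) ?_ ?_
    · exact (isClosed_le continuous_const hdot).inter (isClosed_le hdot continuous_const)
    · intro u hu
      rw [mem_closedBall_zero_iff]
      refine (norm_le_euclNorm u).trans ?_
      have := hu.2
      rw [← euclNorm_sq] at this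
      nlinarith [euclNorm_nonneg u]
  have hann0 : ∀ u ∈ ann, u ≠ 0 := by
    rintro u hu rfl
    have := hu.1
    simp at this
    linarith
  have hginv : Continuous fun u : Fin 3 → ℝ => A⁻¹ *ᵥ u := continuous_const.matrix_mulVec continuous_id
  have hgz : ∀ c, ∀ u ∉ ann, g c u = 0 := by
    intro c u hu
    have : deriv cutoff (u ⬝ᵥ u) = 0 := by
      by_cases h1 : u ⬝ᵥ u < 1
      · exact deriv_cutoff_of_lt h1
      · exact deriv_cutoff_of_gt (not_le.1 fun h4 => hu ⟨not_lt.1 h1, h4⟩)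
    simp [g, this]
  obtain ⟨C, hC⟩ := h.exists_berryForm_le hnN hG
  obtain ⟨δ, hδ, hCδ⟩ := Metric.eventually_nhds_iff.1 hC
  have hC0 : 0 ≤ C := by
    have := hCδ (y := 0) (by simpa using hδ) 0 0
    simpa using this
  obtain ⟨R, hR⟩ := hannc.exists_bound_of_continuousOn hginv.continuousOn
  obtain ⟨M, hM⟩ := hannc.exists_bound_of_continuousOn
    (f := fun u => ∑ c, |g c u| / ‖A⁻¹ *ᵥ u‖ ^ 2) (by
      refine continuousOn_finsetSum _ fun c _ => (hgc c).abs.continuousOn.div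
        (hginv.norm.pow 2).continuousOn fun u hu => ?_
      exact pow_ne_zero _ (norm_ne_zero_iff.2 (hinv0 u (hann0 u hu))))
  have hsmall : ∀ᶠ r in 𝓝[>] (0 : ℝ), r < δ / (|R| + 1) :=
    (gt_mem_nhds (by positivity)).filter_mono nhdsWithin_le_nhds
  have hlimit : ∫ u, ((-(A.det / |A.det|) * (deriv cutoff (u ⬝ᵥ u) / euclNorm u) : ℝ) : ℂ) *
      Complex.I = 2 * π * Complex.I * (((SignType.sign A.det : SignType) : ℤ) : ℂ) := by
    rw [integral_mul_const, integral_complex_ofReal, integral_const_mul, integral_cutoff_div_norm]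
    have : A.det / |A.det| = (((SignType.sign A.det : SignType) : ℤ) : ℝ) := by
      rcases lt_or_gt_of_ne hdet with hneg | hpos
      · rw [abs_of_neg hneg, sign_neg hneg, div_neg, div_self hdet]
        simp
      · rw [abs_of_pos hpos, sign_pos hpos, div_self hdet]
        simp
    rw [this]
    generalize ((SignType.sign A.det : SignType) : ℤ) = s
    push_cast
    ring
  rw [← hlimit]
  -- The majorant is constant on the annulus: `C` bounds `‖ε‖²` times the curvature, and `M` absorbs
  -- the cutoff weights and `‖A⁻¹u‖⁻²`.
  refine tendsto_integral_filter_of_dominated_convergence (ann.indicator fun _ => M * C) ?_ ?_ ?_ ?_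
  · filter_upwards [h.eventually_continuous_fluxDensity hn hnN hG, self_mem_nhdsWithin] with r hc hr
    have hr : 0 < r := hr
    have hcont : Continuous fun u => ((r ^ 3 / |A.det| : ℝ) : ℂ) *
        fluxDensity (fun p => lowProj n (G p)) A p₀ r (p₀ + r • (A⁻¹ *ᵥ u)) :=
      continuous_const.mul (hc.comp (continuous_const.add (hginv.const_smul r)))
    exact (hcont.congr (hpt r hr)).aestronglyMeasurable
  · filter_upwards [hsmall, self_mem_nhdsWithin] with r hr hr0
    have hr0 : 0 < r := hr0
    refine Eventually.of_forall fun u => ?_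
    by_cases hu : u ∈ ann
    swap
    · simp [hgz _ u hu, hu]
    rw [indicator_of_mem hu]
    set η := A⁻¹ *ᵥ u with hη
    have hηpos : 0 < ‖η‖ := norm_pos_iff.2 (hinv0 u (hann0 u hu))
    have hdist : dist (r • η) 0 < δ := by
      rw [dist_zero_right, norm_smul, Real.norm_eq_abs, abs_of_pos hr0]
      have h1 : ‖η‖ ≤ |R| := (hR u hu).trans (le_abs_self R)
      rw [lt_div_iff₀ (by positivity)] at hr
      nlinarith
    have hXb : ∀ c, ‖(r : ℂ) ^ 2 * X (p₀ + r • η) c‖ ≤ C / ‖η‖ ^ 2 := by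
      intro c
      rw [le_div_iff₀ (by positivity)]
      have := hCδ hdist (c + 1) (c + 2)
      rw [norm_smul, Real.norm_eq_abs, abs_of_pos hr0, mul_pow] at this
      rw [norm_mul, norm_pow, Complex.norm_real, Real.norm_eq_abs, abs_of_pos hr0]
      calc _ = r ^ 2 * ‖η‖ ^ 2 * ‖X (p₀ + r • η) c‖ := by ring
        _ ≤ C := this
    calc _ ≤ ∑ c, |g c u| * (C / ‖η‖ ^ 2) := by
          refine (norm_sum_le _ _).trans (Finset.sum_le_sum fun c _ => ?_)
          rw [norm_mul, Complex.norm_real, Real.norm_eq_abs]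
          gcongr
          exact hXb c
      _ = (∑ c, |g c u| / ‖η‖ ^ 2) * C := by
          rw [Finset.sum_mul]
          exact Finset.sum_congr rfl fun c _ => by ring
      _ ≤ M * C := by
          gcongr
          exact (le_abs_self _).trans (hM u hu)
  · exact (integrable_indicator_iff hannc.measurableSet).2
      (integrableOn_const hannc.measure_lt_top.ne)
  · refine Eventually.of_forall fun u => ?_
    by_cases hu : u ∈ ann
    swap
    · have hz : deriv cutoff (u ⬝ᵥ u) = 0 := by
        by_cases h1 : u ⬝ᵥ u < 1
        · exact deriv_cutoff_of_lt h1
        · exact deriv_cutoff_of_gt (not_le.1 fun h4 => hu ⟨not_lt.1 h1, h4⟩)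
      simp [hgz _ u hu, hz]
    have hlim := fun c : Fin 3 => ((h.tendsto_berryForm hn hnN hG (hinv0 u (hann0 u hu))).2
      (c + 1) (c + 2)).const_mul (g c u : ℂ)
    have hS := (h.tendsto_berryForm hn hnN hG (hinv0 u (hann0 u hu))).1
    have hsum := tendsto_finsetSum Finset.univ fun c _ => hlim c
    convert! hsum using 2
    rw [hS]
    have hcr := sum_dot_cross A (A⁻¹ *ᵥ u)
    rw [hAinv] at hcr ⊢
    have hpos := euclNorm_pos (hann0 u hu)
    have hne : ((euclNorm u : ℝ) : ℂ) ≠ 0 := Complex.ofReal_ne_zero.2 hpos.ne'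
    have hda : ((|A.det| : ℝ) : ℂ) ≠ 0 := Complex.ofReal_ne_zero.2 (abs_ne_zero.2 hdet)
    rw [← euclNorm_sq] at hcr
    have hcr' := congrArg (fun x : ℝ => (x : ℂ)) hcr
    simp only [Complex.ofReal_sum, Complex.ofReal_mul, Complex.ofReal_pow] at hcr'
    have : ∀ c : Fin 3, (g c u : ℂ) * (-(Complex.I / 2) * ((u ⬝ᵥ crossProduct
        (A *ᵥ Pi.single (c + 1) 1) (A *ᵥ Pi.single (c + 2) 1) : ℝ) : ℂ) /
          ((euclNorm u : ℝ) : ℂ) ^ 3) =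
        (-Complex.I * (deriv cutoff (u ⬝ᵥ u) : ℝ) / ((|A.det| : ℝ) : ℂ) /
          ((euclNorm u : ℝ) : ℂ) ^ 3) * (((u ⬝ᵥ (A *ᵥ Pi.single c 1) : ℝ) : ℂ) *
          ((u ⬝ᵥ crossProduct
            (A *ᵥ Pi.single (c + 1) 1) (A *ᵥ Pi.single (c + 2) 1) : ℝ) : ℂ)) := by
      intro c
      simp only [g]
      push_cast
      field_simp
    rw [Finset.sum_congr rfl fun c _ => this c, ← Finset.mul_sum, hcr']
    push_cast
    field_simp
end

/-! ### The divergence theorem on a period box -/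

section
open MeasureTheory
open scoped Matrix.Norms.Operator

lemma berryField_add_period {N : ℕ} {P : (Fin 3 → ℝ) → Matrix (Fin N) (Fin N) ℂ} {v : Fin 3 → ℝ}
    (hP : ∀ p, P (p + v) = P p) (p : Fin 3 → ℝ) : berryField P (p + v) = berryField P p := by
  have hd : ∀ a, dirDeriv P a (p + v) = dirDeriv P a p := by
    intro a
    have h1 := fderiv_comp_add_right (𝕜 := ℝ) (f := P) (x := p) v
    have h2 : (fun x => P (x + v)) = P := funext hP
    rw [h2] at h1
    exact (DFunLike.congr_fun h1 (Pi.single a 1)).symm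
  ext c
  simp only [berryField, berryForm, hd, hP]

variable {N n K : ℕ} {G : (Fin 3 → ℝ) → Herm N} {p₀ : Fin K → Fin 3 → ℝ}
  {f : Fin K → Fin 2 → EuclideanSpace ℂ (Fin N)} {A S : Fin K → Matrix (Fin 3) (Fin 3) ℝ}
  {ℓ ℓ' : Fin K → (Fin 3 → ℝ) →ₗ[ℝ] ℝ}

/-- The function that is `0` near the points `p₀ k` and `1` away from them. -/
noncomputable def cutAway (A : Fin K → Matrix (Fin 3) (Fin 3) ℝ) (p₀ : Fin K → Fin 3 → ℝ) (r : ℝ)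
    (p : Fin 3 → ℝ) : ℝ :=
  1 - ∑ k, cutoff ((A k *ᵥ (p - p₀ k)) ⬝ᵥ (A k *ᵥ (p - p₀ k)) / r ^ 2)

/-- Near `p₀ k` its own bump equals `1` and all others equal `0`. The cut-off field is therefore
smooth across the crossing. -/
lemma cutAway_eventually_eq_zero {r : ℝ} (k : Fin K)
    (hr : ∀ j, j ≠ k → 4 < (A j *ᵥ (p₀ k - p₀ j)) ⬝ᵥ (A j *ᵥ (p₀ k - p₀ j)) / r ^ 2) :
    ∀ᶠ p in 𝓝 (p₀ k), cutAway A p₀ r p = 0 := by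
  have hq : ∀ j, Continuous fun p => (A j *ᵥ (p - p₀ j)) ⬝ᵥ (A j *ᵥ (p - p₀ j)) / r ^ 2 :=
    fun j => (continuous_quad (A j) (p₀ j)).div_const _
  have h1 : ∀ᶠ p in 𝓝 (p₀ k), ∀ j, j ≠ k →
      4 < (A j *ᵥ (p - p₀ j)) ⬝ᵥ (A j *ᵥ (p - p₀ j)) / r ^ 2 := by
    rw [eventually_all]
    intro j
    by_cases hj : j = k
    · exact Eventually.of_forall fun p h => absurd hj h
    · filter_upwards [(hq j).continuousAt.eventually_const_lt (hr j hj)] with p hp _ using hp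
  have h2 : ∀ᶠ p in 𝓝 (p₀ k), (A k *ᵥ (p - p₀ k)) ⬝ᵥ (A k *ᵥ (p - p₀ k)) / r ^ 2 < 1 :=
    (hq k).continuousAt.eventually_lt_const (by simp)
  filter_upwards [h1, h2] with p hp1 hp2
  rw [cutAway, Finset.sum_eq_single k, cutoff_of_le hp2.le, sub_self]
  · intro j _ hj
    exact cutoff_of_ge (hp1 j hj).le
  · simp

lemma hasFDerivAt_cutAway (r : ℝ) (p : Fin 3 → ℝ) : ∃ L : (Fin 3 → ℝ) →L[ℝ] ℝ,
    HasFDerivAt (cutAway A p₀ r) L p ∧ ∀ c, L (Pi.single c 1) = -∑ k, cutGrad (A k) (p₀ k) r c p := by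
  choose L hL hLc using fun k => hasFDerivAt_cutoff_quad (A k) (p₀ k) r p
  refine ⟨-∑ k, L k, ?_, fun c => ?_⟩
  · exact (HasFDerivAt.fun_sum fun k _ => hL k).const_sub 1
  · rw [neg_apply, sum_apply]
    simp only [hLc]

/-- The cut-off Berry field is differentiable, and its divergence is minus the flux density. -/
lemma cutAway_smul_berryField (hG : ContDiff ℝ ∞ fun p => (G p).1) (hnN : n < N) {r : ℝ}
    (hr : ∀ k j, j ≠ k → 4 < (A j *ᵥ (p₀ k - p₀ j)) ⬝ᵥ (A j *ᵥ (p₀ k - p₀ j)) / r ^ 2)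
    {p : Fin 3 → ℝ} (hp : (∃ k, p = p₀ k) ∨ eig (G p) n < eig (G p) (n + 1)) :
    DifferentiableAt ℝ (fun q => cutAway A p₀ r q • berryField (fun p => lowProj n (G p)) q) p ∧
    ∑ c, fderiv ℝ (fun q => cutAway A p₀ r q • berryField (fun p => lowProj n (G p)) q) p
      (Pi.single c 1) c = -∑ k, fluxDensity (fun p => lowProj n (G p)) (A k) (p₀ k) r p := by
  rcases hp with ⟨k, rfl⟩ | hgap
  · have h0 : (fun q => cutAway A p₀ r q • berryField (fun p => lowProj n (G p)) q)
        =ᶠ[𝓝 (p₀ k)] fun _ => 0 := by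
      filter_upwards [cutAway_eventually_eq_zero k (hr k)] with q hq
      rw [hq, zero_smul]
    have hd : HasFDerivAt (fun q => cutAway A p₀ r q • berryField (fun p => lowProj n (G p)) q)
        (0 : (Fin 3 → ℝ) →L[ℝ] (Fin 3 → ℂ)) (p₀ k) :=
      (hasFDerivAt_const 0 (p₀ k)).congr_of_eventuallyEq h0
    refine ⟨hd.differentiableAt, ?_⟩
    rw [hd.fderiv, Finset.sum_eq_zero fun c _ => by simp, eq_comm, neg_eq_zero]
    refine Finset.sum_eq_zero fun j _ => fluxDensity_eq_zero _ ?_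
    by_cases hj : j = k
    · left
      simp [hj]
    · exact Or.inr (hr k j hj)
  · have hP := contDiffAt_lowProj hG.contDiffAt hnN hgap
    have hX := ((contDiffAt_berryField hP).differentiableAt (by simp)).hasFDerivAt
    obtain ⟨L, hL, hLc⟩ := hasFDerivAt_cutAway (A := A) (p₀ := p₀) r p
    have hd := hL.fun_smul hX
    refine ⟨hd.differentiableAt, ?_⟩
    have hev : ∀ᶠ q in 𝓝 p, eig (G q) n < eig (G q) (n + 1) :=
      (tendsto_eig hG.continuous.continuousAt n).eventually_lt
        (tendsto_eig hG.continuous.continuousAt (n + 1)) hgap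
    have hdiv := berryField_divergence hP (hev.mono fun q hq => lowProj_mul_self hnN hq)
    rw [hd.fderiv]
    have hterm : ∀ c : Fin 3, (cutAway A p₀ r p • fderiv ℝ (berryField fun p => lowProj n (G p)) p +
        L.smulRight (berryField (fun p => lowProj n (G p)) p)) (Pi.single c 1) c =
        cutAway A p₀ r p * fderiv ℝ (berryField fun p => lowProj n (G p)) p (Pi.single c 1) c -
          ∑ k, (cutGrad (A k) (p₀ k) r c p : ℂ) * berryField (fun p => lowProj n (G p)) p c := by
      intro c
      simp only [add_apply, smul_apply, ContinuousLinearMap.smulRight_apply, Pi.add_apply,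
        Pi.smul_apply, Complex.real_smul, hLc]
      push_cast
      rw [neg_mul, Finset.sum_mul, sub_eq_add_neg]
    rw [Finset.sum_congr rfl fun c _ => hterm c, Finset.sum_sub_distrib, ← Finset.mul_sum, hdiv,
      mul_zero, zero_sub, Finset.sum_comm]
    rfl

/-- The divergence theorem for the cut-off field gives the balance at every small `r`. The face
integrals do not involve `r`, so the limit `r → 0` of the shell integrals identifies them. -/
lemma sum_flux_eq (hn : 1 ≤ n) (hnN : n < N) (hG : ContDiff ℝ ∞ fun p => (G p).1)
    {a b : Fin 3 → ℝ} (hab : a ≤ b) (hinj : Function.Injective p₀)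
    (hcon : ∀ k, ConicalAt n G (p₀ k) (f k) (A k) (S k) (ℓ k) (ℓ' k))
    (hint : ∀ k i, a i < p₀ k i ∧ p₀ k i < b i)
    (hgap : ∀ p ∈ Icc a b, (∀ k, p ≠ p₀ k) → eig (G p) n < eig (G p) (n + 1))
    (hper1 : ∀ p, G (p + Pi.single 1 (b 1 - a 1)) = G p)
    (hper2 : ∀ p, G (p + Pi.single 2 (b 2 - a 2)) = G p) :
    (∫ x in Icc (a ∘ (0 : Fin 3).succAbove) (b ∘ (0 : Fin 3).succAbove),
        berryField (fun p => lowProj n (G p)) ((0 : Fin 3).insertNth (b 0) x) 0) -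
      (∫ x in Icc (a ∘ (0 : Fin 3).succAbove) (b ∘ (0 : Fin 3).succAbove),
        berryField (fun p => lowProj n (G p)) ((0 : Fin 3).insertNth (a 0) x) 0) =
      -∑ k, 2 * π * Complex.I * (((SignType.sign (A k).det : SignType) : ℤ) : ℂ) := by
  set P := fun p => lowProj n (G p) with hP
  have hlim : Tendsto (fun r => -∑ k, ∫ p, fluxDensity P (A k) (p₀ k) r p) (𝓝[>] 0)
      (𝓝 (-∑ k, 2 * π * Complex.I * (((SignType.sign (A k).det : SignType) : ℤ) : ℂ))) :=
    (tendsto_finsetSum _ fun k _ => (hcon k).tendsto_integral_fluxDensity hn hnN hG).neg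
  refine tendsto_nhds_unique (tendsto_const_nhds.congr' ?_) hlim
  have hA := fun k => (hcon k).isUnit_linearization hn hnN hG
  have hcont : ∀ᶠ r in 𝓝[>] (0 : ℝ), ∀ k, Continuous (fluxDensity P (A k) (p₀ k) r) :=
    eventually_all.2 fun k => (hcon k).eventually_continuous_fluxDensity hn hnN hG
  have hfar : ∀ᶠ r in 𝓝[>] (0 : ℝ), ∀ k j, j ≠ k →
      4 < (A j *ᵥ (p₀ k - p₀ j)) ⬝ᵥ (A j *ᵥ (p₀ k - p₀ j)) / r ^ 2 := by
    refine eventually_all.2 fun k => eventually_all.2 fun j => ?_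
    by_cases hj : j = k
    · exact Eventually.of_forall fun r h => absurd hj h
    have hne : A j *ᵥ (p₀ k - p₀ j) ≠ 0 := fun h0 => by
      have := Matrix.mulVec_injective_of_isUnit (hA j) (h0.trans (Matrix.mulVec_zero _).symm)
      exact hj (hinj (sub_eq_zero.1 this).symm)
    have hpos := euclNorm_pos hne
    have hs : ∀ᶠ r in 𝓝[>] (0 : ℝ), r < euclNorm (A j *ᵥ (p₀ k - p₀ j)) / 2 :=
      (gt_mem_nhds (by positivity)).filter_mono nhdsWithin_le_nhds
    filter_upwards [hs, self_mem_nhdsWithin] with r hr hr0 _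
    have hr0 : 0 < r := hr0
    rw [← euclNorm_sq, lt_div_iff₀ (by positivity)]
    nlinarith
  -- The shells stay strictly inside the box. Hence the cutoff is `1` on all faces and each shell
  -- integral over the box is the integral over `ℝ³`.
  have hsupp : ∀ᶠ r in 𝓝[>] (0 : ℝ), ∀ k p, (∃ i, p i ≤ a i ∨ b i ≤ p i) →
      4 < (A k *ᵥ (p - p₀ k)) ⬝ᵥ (A k *ᵥ (p - p₀ k)) / r ^ 2 := by
    refine eventually_all.2 fun k => ?_
    obtain ⟨c, hc, hge⟩ := exists_euclNorm_ge (hA k)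
    have hs : ∀ᶠ r in 𝓝[>] (0 : ℝ), ∀ i : Fin 3,
        r < c * (p₀ k i - a i) / 2 ∧ r < c * (b i - p₀ k i) / 2 := by
      refine eventually_all.2 fun i => ?_
      have h1 : 0 < p₀ k i - a i := sub_pos.2 (hint k i).1
      have h2 : 0 < b i - p₀ k i := sub_pos.2 (hint k i).2
      exact ((gt_mem_nhds (by positivity)).filter_mono nhdsWithin_le_nhds).and
        ((gt_mem_nhds (by positivity)).filter_mono nhdsWithin_le_nhds)
    filter_upwards [hs, self_mem_nhdsWithin] with r hr hr0 p hp
    have hr0 : 0 < r := hr0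
    obtain ⟨i, hi⟩ := hp
    have h1 : |p i - p₀ k i| ≤ ‖p - p₀ k‖ := norm_le_pi_norm (p - p₀ k) i
    have h2 := hge (p - p₀ k)
    have h3 : 2 * r < c * |p i - p₀ k i| := by
      rcases hi with hi | hi
      · have := (hr i).1
        have h4 : p₀ k i - a i ≤ |p i - p₀ k i| := by
          rw [abs_sub_comm]
          exact le_trans (by linarith) (le_abs_self _)
        nlinarith
      · have := (hr i).2
        have h4 : b i - p₀ k i ≤ |p i - p₀ k i| := le_trans (by linarith) (le_abs_self _)
        nlinarith
    have h5 : 2 * r < euclNorm (A k *ᵥ (p - p₀ k)) := by nlinarith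
    rw [← euclNorm_sq, lt_div_iff₀ (by positivity)]
    nlinarith
  filter_upwards [hcont, hfar, hsupp, self_mem_nhdsWithin] with r hc hf hs hr0
  have hcut1 : ∀ p, (∃ i, p i ≤ a i ∨ b i ≤ p i) → cutAway A p₀ r p = 1 := by
    intro p hp
    rw [cutAway, Finset.sum_eq_zero fun k _ => cutoff_of_ge (hs k p hp).le, sub_zero]
  set Y := fun q => cutAway A p₀ r q • berryField P q with hY
  have hmain : ∀ p ∈ Icc a b, DifferentiableAt ℝ Y p ∧
      ∑ c, fderiv ℝ Y p (Pi.single c 1) c = -∑ k, fluxDensity P (A k) (p₀ k) r p := by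
    intro p hp
    refine cutAway_smul_berryField hG hnN hf ?_
    by_cases hk : ∃ k, p = p₀ k
    · exact Or.inl hk
    · exact Or.inr (hgap p hp fun k h => hk ⟨k, h⟩)
  have hcs : Continuous fun p => -∑ k, fluxDensity P (A k) (p₀ k) r p :=
    (continuous_finsetSum _ fun k _ => hc k).neg
  have hdiv := integral_divergence_of_hasFDerivAt_off_countable a b hab Y (fderiv ℝ Y) ∅
    countable_empty (fun p hp => (hmain p hp).1.continuousAt.continuousWithinAt)
    (fun p hp => (hmain p ⟨fun i => (hp.1 i (mem_univ i)).1.le,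
      fun i => (hp.1 i (mem_univ i)).2.le⟩).1.hasFDerivAt)
    ((hcs.continuousOn.integrableOn_Icc).congr_fun (fun p hp => (hmain p hp).2.symm)
      measurableSet_Icc)
  rw [setIntegral_congr_fun measurableSet_Icc fun p hp => (hmain p hp).2, integral_neg,
    integral_finsetSum _ fun k _ => (hc k).continuousOn.integrableOn_Icc] at hdiv
  have hfull : ∀ k, ∫ p in Icc a b, fluxDensity P (A k) (p₀ k) r p =
      ∫ p, fluxDensity P (A k) (p₀ k) r p := by
    intro k
    refine setIntegral_eq_integral_of_forall_compl_eq_zero fun p hp => ?_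
    refine fluxDensity_eq_zero _ (Or.inr (hs k p ?_))
    by_contra hcon
    push Not at hcon
    exact hp ⟨fun i => (hcon i).1.le, fun i => (hcon i).2.le⟩
  rw [Finset.sum_congr rfl fun k _ => hfull k] at hdiv
  rw [hdiv, Fin.sum_univ_three]
  have hfaceb : ∀ (i : Fin 3) (x : Fin 2 → ℝ), Y (i.insertNth (b i) x) =
      berryField P (i.insertNth (b i) x) := fun i x => by
    rw [hY]
    simp only
    rw [hcut1 _ ⟨i, Or.inr (by rw [Fin.insertNth_apply_same])⟩, one_smul]
  have hfacea : ∀ (i : Fin 3) (x : Fin 2 → ℝ), Y (i.insertNth (a i) x) =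
      berryField P (i.insertNth (a i) x) := fun i x => by
    rw [hY]
    simp only
    rw [hcut1 _ ⟨i, Or.inl (by rw [Fin.insertNth_apply_same])⟩, one_smul]
  have hins : ∀ (i : Fin 3) (x : Fin 2 → ℝ), (i.insertNth (b i) x : Fin 3 → ℝ) =
      (i.insertNth (a i) x : Fin 3 → ℝ) + Pi.single i (b i - a i) := by
    intro i x
    ext j
    rcases Fin.eq_self_or_eq_succAbove i j with rfl | ⟨j, rfl⟩
    · simp
    · simp
  have hp1 : ∀ p, berryField P (p + Pi.single 1 (b 1 - a 1)) = berryField P p :=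
    berryField_add_period fun p => by rw [hP]; simp only [hper1]
  have hp2 : ∀ p, berryField P (p + Pi.single 2 (b 2 - a 2)) = berryField P p :=
    berryField_add_period fun p => by rw [hP]; simp only [hper2]
  simp only [hfaceb, hfacea]
  -- Opposite lateral faces differ by a period and cancel; only the faces `s = a 0` and `s = b 0`
  -- remain.
  simp only [hins 1, hins 2, hp1, hp2, sub_self, add_zero]

end

/-! ### Chern numbers as fluxes through the end faces -/

section
open MeasureTheory

/-- The base corner `(x₀, y₀)` of the box will be chosen to avoid the crossings; periodicity moves
the window back to `[0, T]²`. -/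
lemma face_integral_eq {F : (Fin 3 → ℝ) → ℂ} {s x₀ y₀ T : ℝ} (a₀ b₀ : ℝ) (hT : 0 ≤ T)
    (hF : Continuous fun z : ℝ × ℝ => F ![s, z.1, z.2])
    (h1 : ∀ x y, F ![s, x + T, y] = F ![s, x, y]) (h2 : ∀ x y, F ![s, x, y + T] = F ![s, x, y]) :
    ∫ x in Icc (![a₀, x₀, y₀] ∘ (0 : Fin 3).succAbove)
      (![b₀, x₀ + T, y₀ + T] ∘ (0 : Fin 3).succAbove), F ((0 : Fin 3).insertNth s x) =
    ∫ x in (0 : ℝ)..T, ∫ y in (0 : ℝ)..T, F ![s, x, y] := by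
  have hmp := volume_preserving_finTwoArrow ℝ
  have hset : Icc (![a₀, x₀, y₀] ∘ (0 : Fin 3).succAbove) (![b₀, x₀ + T, y₀ + T] ∘ (0 : Fin 3).succAbove)
      = MeasurableEquiv.finTwoArrow ⁻¹' (Icc x₀ (x₀ + T) ×ˢ Icc y₀ (y₀ + T)) := by
    ext x
    simp only [mem_Icc, Pi.le_def, Fin.forall_fin_two, mem_preimage, mem_prod]
    exact ⟨fun h => ⟨⟨h.1.1, h.2.1⟩, ⟨h.1.2, h.2.2⟩⟩, fun h => ⟨⟨h.1.1, h.2.1⟩, ⟨h.1.2, h.2.2⟩⟩⟩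
  have hfun : ∀ x : Fin 2 → ℝ, F ((0 : Fin 3).insertNth s x) =
      (fun z : ℝ × ℝ => F ![s, z.1, z.2]) (MeasurableEquiv.finTwoArrow x) := by
    intro x
    simp only
    congr 1
    ext i
    fin_cases i <;> rfl
  simp only [hfun]
  rw [hset, hmp.setIntegral_preimage_emb MeasurableEquiv.finTwoArrow.measurableEmbedding
    (fun z : ℝ × ℝ => F ![s, z.1, z.2]), Measure.volume_eq_prod, setIntegral_prod]
  swap
  · exact hF.continuousOn.integrableOn_compact (isCompact_Icc.prod isCompact_Icc)
  have hinner : ∀ x, ∫ y in Icc y₀ (y₀ + T), F ![s, x, y] = ∫ y in (0 : ℝ)..T, F ![s, x, y] := by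
    intro x
    have hp : Function.Periodic (fun y => F ![s, x, y]) T := fun y => h2 x y
    rw [integral_Icc_eq_integral_Ioc, ← intervalIntegral.integral_of_le (by linarith),
      hp.intervalIntegral_add_eq y₀ 0, zero_add]
  simp only [hinner]
  have hp : Function.Periodic (fun x => ∫ y in (0 : ℝ)..T, F ![s, x, y]) T := fun x => by
    simp only [h1]
  rw [integral_Icc_eq_integral_Ioc, ← intervalIntegral.integral_of_le (by linarith),
    hp.intervalIntegral_add_eq x₀ 0, zero_add]

end

section
open scoped Matrix.Norms.Operator

lemma contDiff_matrix {N : ℕ} {E : Type*} [NormedAddCommGroup E] [NormedSpace ℝ E]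
    {F : E → Matrix (Fin N) (Fin N) ℂ} (h : ∀ i j, ContDiff ℝ ∞ fun x => F x i j) :
    ContDiff ℝ ∞ F := by
  have : F = fun x => ∑ i, ∑ j, F x i j • Matrix.single i j (1 : ℂ) := by
    ext1 x
    conv_lhs => rw [Matrix.matrix_eq_sum_single (F x)]
    simp [Matrix.smul_single]
  rw [this]
  exact ContDiff.sum fun i _ => ContDiff.sum fun j _ => (h i j).smul contDiff_const

lemma hasDerivAt_coord {N : ℕ} {P : (Fin 3 → ℝ) → Matrix (Fin N) (Fin N) ℂ} {q : Fin 3 → ℝ}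
    (hP : ContDiffAt ℝ ∞ P q) (a : Fin 3) (i j : Fin N) :
    HasDerivAt (fun t : ℝ => P (q + t • Pi.single a 1) i j) (dirDeriv P a q i j) 0 := by
  have h1 : HasFDerivAt P (fderiv ℝ P q) (q + (0 : ℝ) • Pi.single a 1) := by
    rw [zero_smul, add_zero]
    exact (hP.differentiableAt (by simp)).hasFDerivAt
  have h2 : HasDerivAt (fun t : ℝ => q + t • (Pi.single a 1 : Fin 3 → ℝ)) (Pi.single a 1) 0 := by
    simpa using ((hasDerivAt_id (0 : ℝ)).smul_const (Pi.single a 1 : Fin 3 → ℝ)).const_add q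
  have h3 := h1.comp_hasDerivAt (0 : ℝ) h2
  exact (LinearMap.toContinuousLinearMap
    (Matrix.entryLinearMap ℝ ℂ i j)).hasFDerivAt.comp_hasDerivAt (0 : ℝ) h3

/-- Component `0` of the Berry field is the form in the directions `1, 2`, that is, in `ξ₁, ξ₂`. -/
lemma berryCurvature_eq {N n : ℕ} {G : (Fin 3 → ℝ) → Herm N} {H : Torus2 → Herm N} {s : ℝ}
    (hs : ∀ x y : ℝ, G ![s, x, y] = H (x, y)) (x y : ℝ)
    (hP : ContDiffAt ℝ ∞ (fun p => lowProj n (G p)) ![s, x, y]) :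
    berryCurvature (eigenbundle n H) ((x : AddCircle (2 * π)), (y : AddCircle (2 * π))) =
      berryField (fun p => lowProj n (G p)) ![s, x, y] 0 := by
  have h0 : ∀ x y : ℝ, projMatrix (eigenbundle n H (x, y)) = lowProj n (G ![s, x, y]) := by
    intro x y
    rw [hs]
    rfl
  have hd1 : partial₁ (fun η => projMatrix (eigenbundle n H η)) (x, y) =
      dirDeriv (fun p => lowProj n (G p)) 1 ![s, x, y] := by
    ext i j
    refine ((hasDerivAt_coord hP 1 i j).congr_of_eventuallyEq
      (Eventually.of_forall fun t => ?_)).deriv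
    have : ![s, x, y] + t • (Pi.single 1 1 : Fin 3 → ℝ) = ![s, x + t, y] := by
      ext k
      fin_cases k <;> simp
    simp only [this, ← h0, AddCircle.coe_add]
  have hd2 : partial₂ (fun η => projMatrix (eigenbundle n H η)) (x, y) =
      dirDeriv (fun p => lowProj n (G p)) 2 ![s, x, y] := by
    ext i j
    refine ((hasDerivAt_coord hP 2 i j).congr_of_eventuallyEq
      (Eventually.of_forall fun t => ?_)).deriv
    have : ![s, x, y] + t • (Pi.single 2 1 : Fin 3 → ℝ) = ![s, x, y + t] := by
      ext k
      fin_cases k <;> simp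
    simp only [this, ← h0, AddCircle.coe_add]
  simp only [berryCurvature, hd1, hd2, h0]
  rfl

lemma chernNumber_eq {N n : ℕ} (hnN : n < N) {G : (Fin 3 → ℝ) → Herm N}
    (hG : ContDiff ℝ ∞ fun p => (G p).1) {H : Torus2 → Herm N} (hgap : Gapped n H) {s : ℝ}
    (hs : ∀ x y : ℝ, G ![s, x, y] = H (x, y)) (a₀ b₀ x₀ y₀ : ℝ)
    (h1 : ∀ p, G (p + Pi.single 1 (2 * π)) = G p) (h2 : ∀ p, G (p + Pi.single 2 (2 * π)) = G p) :
    chernNumber (eigenbundle n H) = Complex.I / (2 * π) *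
      ∫ x in Icc (![a₀, x₀, y₀] ∘ (0 : Fin 3).succAbove)
      (![b₀, x₀ + 2 * π, y₀ + 2 * π] ∘ (0 : Fin 3).succAbove),
        berryField (fun p => lowProj n (G p)) ((0 : Fin 3).insertNth s x) 0 := by
  have hP : ∀ x y : ℝ, ContDiffAt ℝ ∞ (fun p => lowProj n (G p)) ![s, x, y] := fun x y =>
    contDiffAt_lowProj hG.contDiffAt hnN (by rw [hs]; exact hgap _)
  have hX1 : ∀ p, berryField (fun p => lowProj n (G p)) (p + Pi.single 1 (2 * π)) =
      berryField (fun p => lowProj n (G p)) p := berryField_add_period fun p => by rw [h1]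
  have hX2 : ∀ p, berryField (fun p => lowProj n (G p)) (p + Pi.single 2 (2 * π)) =
      berryField (fun p => lowProj n (G p)) p := berryField_add_period fun p => by rw [h2]
  rw [face_integral_eq (F := fun p => berryField (fun p => lowProj n (G p)) p 0) a₀ b₀
    Real.two_pi_pos.le]
  · simp only [chernNumber, berryCurvature_eq hs _ _ (hP _ _)]
  · refine continuous_iff_continuousAt.2 fun z => ?_
    have hc : Continuous fun z : ℝ × ℝ => (![s, z.1, z.2] : Fin 3 → ℝ) := by
      refine continuous_pi fun i => ?_
      fin_cases i
      · exact continuous_const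
      · exact continuous_fst
      · exact continuous_snd
    have := (continuousAt_pi.1 (contDiffAt_berryField (hP z.1 z.2)).continuousAt 0)
    exact ContinuousAt.comp (f := fun z : ℝ × ℝ => (![s, z.1, z.2] : Fin 3 → ℝ)) this hc.continuousAt
  · intro x y
    rw [← hX1 ![s, x, y]]
    congr 2
    ext k
    fin_cases k <;> simp
  · intro x y
    rw [← hX2 ![s, x, y]]
    congr 2
    ext k
    fin_cases k <;> simp

/-! ### Smooth extension of the homotopy to all of `ℝ³` -/

/-- A smooth map `ℝ → [0,1]` that is the identity on `[δ, 1 - δ]`. -/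
noncomputable def squash (δ s : ℝ) : ℝ :=
  Real.smoothTransition (s / δ) * s * (1 - Real.smoothTransition ((s - (1 - δ)) / δ)) +
    Real.smoothTransition ((s - (1 - δ)) / δ)

lemma contDiff_squash (δ : ℝ) : ContDiff ℝ ∞ (squash δ) := by
  have h1 : ContDiff ℝ ∞ fun s : ℝ => Real.smoothTransition (s / δ) :=
    Real.smoothTransition.contDiff.comp (contDiff_id.div_const δ)
  have h2 : ContDiff ℝ ∞ fun s : ℝ => Real.smoothTransition ((s - (1 - δ)) / δ) :=
    Real.smoothTransition.contDiff.comp ((contDiff_id.sub contDiff_const).div_const δ)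
  exact ((h1.mul contDiff_id).mul (contDiff_const.sub h2)).add h2

lemma squash_of_le {δ s : ℝ} (hδ : 0 < δ) (h : s ≤ 1 - δ) :
    squash δ s = Real.smoothTransition (s / δ) * s := by
  have : Real.smoothTransition ((s - (1 - δ)) / δ) = 0 :=
    Real.smoothTransition.zero_of_nonpos (div_nonpos_of_nonpos_of_nonneg (by linarith) hδ.le)
  simp [squash, this]

lemma squash_of_ge {δ s : ℝ} (hδ : 0 < δ) (h : δ ≤ s) :
    squash δ s = s + (1 - s) * Real.smoothTransition ((s - (1 - δ)) / δ) := by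
  have : Real.smoothTransition (s / δ) = 1 :=
    Real.smoothTransition.one_of_one_le ((one_le_div hδ).2 h)
  rw [squash, this]
  ring

lemma squash_eq_self {δ s : ℝ} (hδ : 0 < δ) (h1 : δ ≤ s) (h2 : s ≤ 1 - δ) : squash δ s = s := by
  rw [squash_of_le hδ h2, Real.smoothTransition.one_of_one_le ((one_le_div hδ).2 h1), one_mul]

lemma squash_mem {δ : ℝ} (hδ : 0 < δ) (hδ' : δ < 1 / 2) (s : ℝ) : squash δ s ∈ Icc (0 : ℝ) 1 := by
  rcases le_total s (1 - δ) with h | h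
  · rw [squash_of_le hδ h]
    rcases le_total s 0 with h0 | h0
    · rw [Real.smoothTransition.zero_of_nonpos (div_nonpos_of_nonpos_of_nonneg h0 hδ.le)]
      simp
    · have h1 := Real.smoothTransition.nonneg (s / δ)
      have h2 := Real.smoothTransition.le_one (s / δ)
      constructor
      · positivity
      · nlinarith
  · rw [squash_of_ge hδ (by linarith)]
    have h1 := Real.smoothTransition.nonneg ((s - (1 - δ)) / δ)
    have h2 := Real.smoothTransition.le_one ((s - (1 - δ)) / δ)
    rcases le_total 1 s with h0 | h0
    · rw [Real.smoothTransition.one_of_one_le ((one_le_div hδ).2 (by linarith))]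
      simp
    · constructor <;> nlinarith

lemma squash_zero {δ : ℝ} (hδ : 0 < δ) (hδ' : δ < 1 / 2) : squash δ 0 = 0 := by
  rw [squash_of_le hδ (by linarith), mul_zero]

lemma squash_one {δ : ℝ} (hδ : 0 < δ) (hδ' : δ < 1 / 2) : squash δ 1 = 1 := by
  rw [squash_of_ge hδ (by linarith)]
  simp

/-- On `[0,1]` the map only decreases values below `δ` and only increases values above `1 - δ`.
Reparametrizing by it therefore creates no new crossings. -/
lemma eq_of_squash_eq {δ s t : ℝ} (hδ : 0 < δ) (hs : s ∈ Icc (0 : ℝ) 1)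
    (ht : δ < t) (ht' : t < 1 - δ) (h : squash δ s = t) : s = t := by
  by_cases h1 : s ≤ δ
  · rw [squash_of_le hδ (by linarith)] at h
    have := Real.smoothTransition.le_one (s / δ)
    nlinarith [hs.1]
  by_cases h2 : 1 - δ ≤ s
  · rw [squash_of_ge hδ (by linarith)] at h
    have := Real.smoothTransition.nonneg ((s - (1 - δ)) / δ)
    nlinarith [hs.2]
  · rw [squash_eq_self hδ (by linarith) (by linarith)] at h
    exact h

/-- The lift to `ℝ³` of a family on `[0,1] × 𝕋²`, extended to all real values of the parameter. -/
noncomputable def liftFamily {N : ℕ} (H : ℝ × Torus2 → Herm N) (δ : ℝ) (p : Fin 3 → ℝ) : Herm N :=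
  H (squash δ (p 0), ((p 1 : AddCircle (2 * π)), (p 2 : AddCircle (2 * π))))

lemma contDiff_liftFamily {N : ℕ} {H : ℝ × Torus2 → Herm N} (hH : SmoothCylinder H) {δ : ℝ}
    (hδ : 0 < δ) (hδ' : δ < 1 / 2) : ContDiff ℝ ∞ fun p => (liftFamily H δ p).1 := by
  refine contDiff_matrix fun i j => ?_
  have hg : ContDiff ℝ ∞ fun p : Fin 3 → ℝ => ((squash δ (p 0), p 1, p 2) : ℝ × ℝ × ℝ) :=
    ((contDiff_squash δ).comp (contDiff_apply ℝ ℝ (0 : Fin 3))).prodMk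
      ((contDiff_apply ℝ ℝ (1 : Fin 3)).prodMk (contDiff_apply ℝ ℝ (2 : Fin 3)))
  exact (hH i j).comp_contDiff hg fun p => ⟨squash_mem hδ hδ' _, mem_univ _⟩

lemma liftFamily_period {N : ℕ} (H : ℝ × Torus2 → Herm N) (δ : ℝ) (p : Fin 3 → ℝ) :
    liftFamily H δ (p + Pi.single 1 (2 * π)) = liftFamily H δ p ∧
    liftFamily H δ (p + Pi.single 2 (2 * π)) = liftFamily H δ p := by
  constructor <;> simp [liftFamily]

end

/-! ### Transfer of the crossings to the box -/

lemma eig_le_eig_succ {N n : ℕ} (hn : 1 ≤ n) (hnN : n < N) (A : Herm N) :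
    eig A n ≤ eig A (n + 1) := by
  obtain ⟨U, hU⟩ := exists_sortedDiag A
  have := @hU.2.1 ⟨n - 1, by omega⟩ ⟨n, hnN⟩ (by simp [Fin.le_def])
  simpa [Nat.sub_add_cancel hn] using this

lemma tendsto_toLp_smallShifts {ζ : ℝ × Torus2} (h0 : 0 < ζ.1) (h1 : ζ.1 < 1) :
    Tendsto (fun ε : Fin 3 → ℝ => (WithLp.toLp 2 ε : EuclideanSpace ℝ (Fin 3))) (𝓝 0)
      (smallShifts ζ) := by
  have hc : Continuous fun ε : Fin 3 → ℝ => (WithLp.toLp 2 ε : EuclideanSpace ℝ (Fin 3)) :=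
    PiLp.continuous_toLp 2 _
  refine tendsto_nhdsWithin_iff.2 ⟨by simpa using hc.tendsto 0, ?_⟩
  have hcont : Continuous fun ε : Fin 3 → ℝ => ζ.1 + ε 0 :=
    continuous_const.add (continuous_apply 0)
  have e1 : ∀ᶠ ε in 𝓝 (0 : Fin 3 → ℝ), 0 < ζ.1 + ε 0 :=
    hcont.continuousAt.eventually_const_lt (by simpa using h0)
  have e2 : ∀ᶠ ε in 𝓝 (0 : Fin 3 → ℝ), ζ.1 + ε 0 < 1 :=
    hcont.continuousAt.eventually_lt_const (by simpa using h1)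
  filter_upwards [e1, e2] with ε h1 h2
  exact ⟨⟨h1.le, h2.le⟩, mem_univ _⟩

lemma isBigO_toLp : (fun ε : Fin 3 → ℝ => (WithLp.toLp 2 ε : EuclideanSpace ℝ (Fin 3)))
    =O[𝓝 0] fun ε => ε :=
  ((PiLp.continuousLinearEquiv 2 ℝ (fun _ : Fin 3 => ℝ)).symm :
    (Fin 3 → ℝ) →L[ℝ] EuclideanSpace ℝ (Fin 3)).isBigO_id (𝓝 0)

/-- Near `p` the squashing map is the identity and the constraint `s ∈ [0,1]` is inactive, so both
expansions carry over; replacing the Euclidean norm by the sup norm does not affect the error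
orders. -/
lemma conicalAt_liftFamily {N n : ℕ} {H : ℝ × Torus2 → Herm N} {ζ : ℝ × Torus2}
    (hcross : CrossConically n H ζ) {f : Fin 2 → EuclideanSpace ℂ (Fin N)}
    {A : Matrix (Fin 3) (Fin 3) ℝ} (hA : IsPauliLinearization n H ζ f A) {δ : ℝ}
    (hδ : 0 < δ) (h0 : δ < ζ.1) (h1 : ζ.1 < 1 - δ) {p : Fin 3 → ℝ} (hp0 : p 0 = ζ.1)
    (hp1 : (p 1 : AddCircle (2 * π)) = ζ.2.1) (hp2 : (p 2 : AddCircle (2 * π)) = ζ.2.2) :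
    ∃ S ℓ ℓ', ConicalAt n (liftFamily H δ) p f A S ℓ ℓ' := by
  obtain ⟨hz, hmult, a, S, hS, hlow, hup⟩ := hcross
  obtain ⟨horth, hspan, a', hpauli⟩ := hA
  have hlim := tendsto_toLp_smallShifts (ζ := ζ) (by linarith) (by linarith)
  let ℓ : EuclideanSpace ℝ (Fin 3) → (Fin 3 → ℝ) →ₗ[ℝ] ℝ := fun a =>
    (innerₛₗ ℝ a).comp (WithLp.linearEquiv 2 ℝ (Fin 3 → ℝ)).symm.toLinearMap
  have hℓ : ∀ a ε, ℓ a ε = inner ℝ a (WithLp.toLp 2 ε : EuclideanSpace ℝ (Fin 3)) := fun _ _ => rfl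
  have hcont : Continuous fun ε : Fin 3 → ℝ => ζ.1 + ε 0 :=
    continuous_const.add (continuous_apply 0)
  have hGp : liftFamily H δ p = H ζ := by
    rw [liftFamily, hp0, hp1, hp2, squash_eq_self hδ h0.le h1.le]
  have hG : ∀ᶠ ε in 𝓝 (0 : Fin 3 → ℝ), liftFamily H δ (p + ε) =
      H (shiftPoint ζ (WithLp.toLp 2 ε)) := by
    have e1 : ∀ᶠ ε in 𝓝 (0 : Fin 3 → ℝ), δ < ζ.1 + ε 0 :=
      hcont.continuousAt.eventually_const_lt (by simpa using h0)
    have e2 : ∀ᶠ ε in 𝓝 (0 : Fin 3 → ℝ), ζ.1 + ε 0 < 1 - δ :=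
      hcont.continuousAt.eventually_lt_const (by simpa using h1)
    filter_upwards [e1, e2] with ε he1 he2
    simp only [liftFamily, shiftPoint, Pi.add_apply, AddCircle.coe_add, hp0, hp1, hp2]
    rw [squash_eq_self hδ he1.le he2.le]
  refine ⟨S, ℓ a, ℓ a', ?_, ?_, hS, ?_, ?_, horth, ?_, ?_⟩
  · rw [hGp]
    exact hz.2
  · rw [hGp]
    exact hmult
  · refine ((hlow.comp_tendsto hlim).trans_isBigO isBigO_toLp).congr' ?_ EventuallyEq.rfl
    filter_upwards [hG] with ε hε
    rw [hε, hGp, hℓ]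
    rfl
  · refine ((hup.comp_tendsto hlim).trans_isBigO isBigO_toLp).congr' ?_ EventuallyEq.rfl
    filter_upwards [hG] with ε hε
    rw [hε, hGp, hℓ]
    rfl
  · rw [hGp]
    exact hspan
  · intro i j
    have h2 : (fun ε : Fin 3 → ℝ => ‖(WithLp.toLp 2 ε : EuclideanSpace ℝ (Fin 3))‖ ^ 2)
        =O[𝓝 0] fun ε => ‖ε‖ ^ 2 := isBigO_toLp.norm_norm.pow 2
    refine (((hpauli i j).comp_tendsto hlim).trans h2).congr' ?_ EventuallyEq.rfl
    filter_upwards [hG] with ε hε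
    rw [hε, hGp, hℓ]
    rfl

/-- The circle is cut at a point that avoids the finitely many given ones. Their lifts are then
interior to the period window, and unique even in the closed window. -/
lemma AddCircle.exists_notMem_lift {K : ℕ} (ξ : Fin K → AddCircle (2 * π)) :
    ∃ (x₀ : ℝ) (x : Fin K → ℝ), (∀ k, (x k : AddCircle (2 * π)) = ξ k) ∧
      (∀ k, x₀ < x k ∧ x k < x₀ + 2 * π) ∧
      ∀ k, ∀ y ∈ Icc x₀ (x₀ + 2 * π), (y : AddCircle (2 * π)) = ξ k → y = x k := by
  have : Fact (0 < 2 * π) := ⟨Real.two_pi_pos⟩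
  have hlift : ∀ (a : ℝ) (z : AddCircle (2 * π)), ∃ x ∈ Ico a (a + 2 * π),
      (x : AddCircle (2 * π)) = z := by
    intro a z
    have : z ∈ ((↑) : ℝ → AddCircle (2 * π)) '' Ico a (a + 2 * π) := by
      rw [AddCircle.coe_image_Ico_eq]
      trivial
    exact this
  choose r hr hrξ using fun k => hlift 0 (ξ k)
  obtain ⟨x₀, hx₀, hx₀r⟩ : ∃ x₀ ∈ Ico (0 : ℝ) (0 + 2 * π), x₀ ∉ range r := by
    have hinf : (Ico (0 : ℝ) (0 + 2 * π)).Infinite := Ico_infinite (by linarith [Real.two_pi_pos])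
    obtain ⟨x, hx⟩ := (hinf.sdiff (finite_range r)).nonempty
    exact ⟨x, hx.1, hx.2⟩
  have hne : ∀ k, (x₀ : AddCircle (2 * π)) ≠ ξ k := fun k h =>
    hx₀r ⟨k, ((AddCircle.coe_eq_coe_iff_of_mem_Ico hx₀ (hr k)).1 (h.trans (hrξ k).symm)).symm⟩
  choose x hx hxξ using fun k => hlift x₀ (ξ k)
  refine ⟨x₀, x, hxξ, fun k => ⟨lt_of_le_of_ne (hx k).1 ?_, (hx k).2⟩, ?_⟩
  · intro h
    exact hne k (by rw [h, hxξ])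
  · intro k y hy hyξ
    have hy' : y ∈ Ico x₀ (x₀ + 2 * π) := by
      refine ⟨hy.1, lt_of_le_of_ne hy.2 ?_⟩
      rintro rfl
      rw [AddCircle.coe_add, AddCircle.coe_period, add_zero] at hyξ
      exact hne k hyξ
    exact (AddCircle.coe_eq_coe_iff_of_mem_Ico hy' (hx k)).1 (hyξ.trans (hxξ k).symm)

lemma exists_collar {K : ℕ} {s : Fin K → ℝ} (hs : ∀ k, 0 < s k ∧ s k < 1) :
    ∃ δ : ℝ, 0 < δ ∧ δ < 1 / 2 ∧ ∀ k, δ < s k ∧ s k < 1 - δ := by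
  have h1 : ∀ᶠ δ in 𝓝[>] (0 : ℝ), δ < 1 / 2 :=
    (gt_mem_nhds (by norm_num)).filter_mono nhdsWithin_le_nhds
  have h2 : ∀ᶠ δ in 𝓝[>] (0 : ℝ), ∀ k, δ < s k ∧ δ < 1 - s k := eventually_all.2 fun k =>
    ((gt_mem_nhds (hs k).1).and (gt_mem_nhds (sub_pos.2 (hs k).2))).filter_mono nhdsWithin_le_nhds
  obtain ⟨δ, ⟨h1, h2⟩, h0⟩ := ((h1.and h2).and self_mem_nhdsWithin).exists
  exact ⟨δ, h0, h1, fun k => ⟨(h2 k).1, by linarith [(h2 k).2]⟩⟩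

/-! ### Proof of the theorem -/

theorem mainTheorem3 {N n : ℕ} (hn : 1 ≤ n) (hnN : n < N)
    (H₀ H₁ : Torus2 → Herm N)
    (hH₀ : SmoothTorus H₀) (hH₁ : SmoothTorus H₁)
    (hgap₀ : Gapped n H₀) (hgap₁ : Gapped n H₁)
    (H : ℝ × Torus2 → Herm N) (hH : H ∈ conicalHomotopies n H₀ H₁)
    (K : ℕ) (ζ : Fin K → ℝ × Torus2) (hζ : Function.Injective ζ)
    (hcross : crossings n H = Set.range ζ)
    (f : Fin K → Fin 2 → EuclideanSpace ℂ (Fin N))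
    (A : Fin K → Matrix (Fin 3) (Fin 3) ℝ)
    (hA : ∀ k, IsPauliLinearization n H (ζ k) (f k) (A k)) :
    chernNumber (eigenbundle n H₁) - chernNumber (eigenbundle n H₀) =
      ((∑ k, ((SignType.sign (A k).det : SignType) : ℤ) : ℤ) : ℂ) := by
  obtain ⟨⟨hsm, hH0, hH1⟩, hcon⟩ := hH
  have hmem : ∀ k, ζ k ∈ crossings n H := fun k => hcross ▸ mem_range_self k
  -- The gaps of `H₀` and `H₁` keep the crossings away from the ends of the cylinder.
  have hs : ∀ k, 0 < (ζ k).1 ∧ (ζ k).1 < 1 := by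
    intro k
    obtain ⟨⟨hI, -⟩, he⟩ := hmem k
    refine ⟨lt_of_le_of_ne hI.1 fun h => ?_, lt_of_le_of_ne hI.2 fun h => ?_⟩
    · have : H (ζ k) = H₀ (ζ k).2 := by rw [← hH0, h]
      rw [this] at he
      exact (hgap₀ _).ne he
    · have : H (ζ k) = H₁ (ζ k).2 := by rw [← hH1, ← h]
      rw [this] at he
      exact (hgap₁ _).ne he
  obtain ⟨δ, hδ, hδ', hζδ⟩ := exists_collar hs
  obtain ⟨x₀, x, hx, hxI, hxu⟩ := AddCircle.exists_notMem_lift fun k => (ζ k).2.1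
  obtain ⟨y₀, y, hy, hyI, hyu⟩ := AddCircle.exists_notMem_lift fun k => (ζ k).2.2
  have hG := contDiff_liftFamily hsm hδ hδ'
  choose S ℓ ℓ' hcone using fun k => conicalAt_liftFamily (hcon _ (hmem k)) (hA k) hδ (hζδ k).1
    (hζδ k).2 (p := ![(ζ k).1, x k, y k]) rfl (hx k) (hy k)
  have hper := liftFamily_period H δ
  have hinj : Function.Injective fun k => (![(ζ k).1, x k, y k] : Fin 3 → ℝ) := by
    intro k j h
    have h0 : (ζ k).1 = (ζ j).1 := congr_fun h 0
    have h1 : x k = x j := congr_fun h 1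
    have h2 : y k = y j := congr_fun h 2
    refine hζ (Prod.ext h0 (Prod.ext ?_ ?_))
    · rw [← hx k, ← hx j, h1]
    · rw [← hy k, ← hy j, h2]
  have hflux := sum_flux_eq hn hnN hG (a := ![0, x₀, y₀]) (b := ![1, x₀ + 2 * π, y₀ + 2 * π])
    (fun i => by fin_cases i <;> simp [Real.pi_pos.le]) hinj hcone
    (fun k i => by
      fin_cases i
      · exact hs k
      · exact hxI k
      · exact hyI k)
    (fun p hp hne => by
      -- A closed gap in the box is a crossing of `H` at the squashed point; uniqueness of the lifts
      -- and `eq_of_squash_eq` then force `p` to be one of the chosen points.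
      refine lt_of_le_of_ne (eig_le_eig_succ hn hnN _) fun he => ?_
      have hcr : (squash δ (p 0), ((p 1 : AddCircle (2 * π)), (p 2 : AddCircle (2 * π)))) ∈
          crossings n H := ⟨⟨squash_mem hδ hδ' _, mem_univ _⟩, he⟩
      rw [hcross] at hcr
      obtain ⟨k, hk⟩ := hcr
      refine hne k ?_
      ext i
      fin_cases i
      · exact eq_of_squash_eq hδ ⟨hp.1 0, hp.2 0⟩ (hζδ k).1 (hζδ k).2 (congrArg (fun z => z.1) hk).symm
      · exact hxu k _ ⟨hp.1 1, hp.2 1⟩ (congrArg (fun z => z.2.1) hk).symm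
      · exact hyu k _ ⟨hp.1 2, hp.2 2⟩ (congrArg (fun z => z.2.2) hk).symm)
    (fun p => by simpa using (hper p).1) (fun p => by simpa using (hper p).2)
  have hc1 := chernNumber_eq hnN hG hgap₁ (s := 1)
    (fun x y => by simp [liftFamily, squash_one hδ hδ', hH1]) 0 1 x₀ y₀
    (fun p => (hper p).1) (fun p => (hper p).2)
  have hc0 := chernNumber_eq hnN hG hgap₀ (s := 0)
    (fun x y => by simp [liftFamily, squash_zero hδ hδ', hH0]) 0 1 x₀ y₀
    (fun p => (hper p).1) (fun p => (hper p).2)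
  rw [hc1, hc0, ← mul_sub]
  refine (congrArg (fun z => Complex.I / (2 * π) * z) hflux).trans ?_
  have hpi : (π : ℂ) ≠ 0 := Complex.ofReal_ne_zero.2 Real.pi_ne_zero
  rw [← Finset.mul_sum, Int.cast_sum]
  generalize ∑ k, (((SignType.sign (A k).det : SignType) : ℤ) : ℂ) = z
  field_simp
  -- The prefactor `i/(2π)` times the flux `-2πi` is `-i² = 1`.
  linear_combination (-z) * Complex.I_sq
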